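/- Let $M$ be a compact complex manifold of dimension $n$. For a Hermitian metric $g$ on $M$ let $\nabla$ be its Chern connection, with torsion $T(X,Y)=\nabla_XY-\nabla_YX-[X,Y]$ and curvature $\Omega(X,Y,Z,W)=g\big((\nabla_X\nabla_Y-\nabla_Y\nabla_X-\nabla_{[X,Y]})Z,W\big)$, all extended complex multilinearly to $TM\otimes\mathbb C$. In local holomorphic coordinates write $\Omega_{i\bar jk\bar l}=\Omega(\partial_{z_i},\partial_{\bar z_j},\partial_{z_k},\partial_{\bar z_l})$, $T_{ij\bar l}=g(T(\partial_{z_i},\partial_{z_j}),\partial_{\bar z_l})$, $T_{\bar i\bar jl}=\overline{T_{ij\bar l}}$, and (with summation over repeated indices) $$S^{g}_{i\bar j}=g^{m\bar n}\Omega_{m\bar ni\bar j},\qquad Q^{g}_{i\bar j}=\tfrac12\,g^{m\bar n}g^{p\bar s}\,T_{pm\bar j}\,T_{\bar s\bar ni}.$$ The Chern curvature of $g$ is called Griffiths non-negative (resp. positive) if $\Omega(\xi,\bar\xi,\eta,\bar\eta)\ge 0$ (resp. $>0$) for all $x\in M$ and all non-zero $\xi,\eta\in T^{1,0}_xM$.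 **Theorem.** Let $g(t)$, $t\in[0,\tau)$, be a smooth family of Hermitian metrics on $M$ (smooth on $M\times[0,\tau)$) which solves the Hermitian curvature flow $$\frac{d g_{i\bar j}(t)}{dt}=-S^{g(t)}_{i\bar j}-Q^{g(t)}_{i\bar j},\qquad g(0)=g_0.$$ If the Chern curvature $\Omega^{g_0}$ is Griffiths non-negative (resp. positive), then the Chern curvature $\Omega^{g(t)}$ is Griffiths non-negative (resp. positive) for every $t\in[0,\tau)$. -/

import Mathlib

open scoped Manifold ContDiff ComplexConjugate

noncomputable section

namespace HermitianFlow

/-- The model space of a complex manifold of dimension `n`. -/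
abbrev Cn (n : ℕ) : Type := Fin n → ℂ

/-! ### Chern connection, torsion and curvature in a holomorphic chart

Here `h : Cn n → Matrix (Fin n) (Fin n) ℂ` is the matrix of a Hermitian metric in a holomorphic
chart, `h z i j = g(∂/∂z_i, ∂/∂z̄_j)`. A field of type (1,0) is given by its components
`Y : Cn n → Cn n`, that is `Y = ∑ p, Y^p ∂/∂z_p`. -/

/-- The Wirtinger derivative `∂f/∂z_i`. -/
def dz {n : ℕ} (i : Fin n) (f : Cn n → ℂ) (z : Cn n) : ℂ :=
  (fderiv ℝ f z (Pi.single i 1) - Complex.I * fderiv ℝ f z (Pi.single i Complex.I)) / 2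

/-- The Wirtinger derivative `∂f/∂z̄_i`. -/
def dzbar {n : ℕ} (i : Fin n) (f : Cn n → ℂ) (z : Cn n) : ℂ :=
  (fderiv ℝ f z (Pi.single i 1) + Complex.I * fderiv ℝ f z (Pi.single i Complex.I)) / 2

/-- The inverse metric `g^{i j̄}`, normalised by `∑ j, g^{i j̄} g_{k j̄} = δ^i_k`. -/
def invMetric {n : ℕ} (h : Matrix (Fin n) (Fin n) ℂ) : Matrix (Fin n) (Fin n) ℂ :=
  (h⁻¹).transpose

/-- The coefficients `Γ_{ik}^p = ∑ q, g^{p q̄} ∂_i g_{k q̄}` of the Chern connection,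
`∇_{∂/∂z_i} ∂/∂z_k = ∑ p, Γ_{ik}^p ∂/∂z_p`. -/
def christoffel {n : ℕ} (h : Cn n → Matrix (Fin n) (Fin n) ℂ) (i k p : Fin n) (z : Cn n) : ℂ :=
  ∑ q, invMetric (h z) p q * dz i (fun w => h w k q) z

/-- The Chern connection preserves the metric:
`∂_i g(∂_k, ∂̄_l) = g(∇_i ∂_k, ∂̄_l)` (recall `∇_i ∂̄_l = 0`). -/
theorem christoffel_metric {n : ℕ} (h : Cn n → Matrix (Fin n) (Fin n) ℂ) (z : Cn n)
    (hz : IsUnit (h z).det) (i k l : Fin n) :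
    ∑ p, christoffel h i k p z * h z p l = dz i (fun w => h w k l) z := by
  have hinv : (h z)⁻¹ * h z = 1 := Matrix.nonsing_inv_mul _ hz
  have key : ∀ q, ∑ p, (h z)⁻¹ q p * h z p l = if q = l then 1 else 0 := by
    intro q
    have := congrFun (congrFun hinv q) l
    rwa [Matrix.mul_apply, Matrix.one_apply] at this
  simp only [christoffel, invMetric, Matrix.transpose_apply, Finset.sum_mul]
  rw [Finset.sum_comm]
  have : ∀ q, ∑ p, (h z)⁻¹ q p * dz i (fun w => h w k q) z * h z p l
      = (if q = l then 1 else 0) * dz i (fun w => h w k q) z := by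
    intro q
    rw [← key q, Finset.sum_mul]
    exact Finset.sum_congr rfl fun p _ => by ring
  simp [this]

/-- The Chern connection is the only connection with this property (among those whose
(0,1)-part is `∂̄`). -/
theorem christoffel_unique {n : ℕ} (h : Cn n → Matrix (Fin n) (Fin n) ℂ) (z : Cn n)
    (hz : IsUnit (h z).det) (A : Fin n → Fin n → Fin n → ℂ)
    (hA : ∀ i k l, ∑ p, A i k p * h z p l = dz i (fun w => h w k l) z) (i k p : Fin n) :
    A i k p = christoffel h i k p z := by
  have hinv : h z * (h z)⁻¹ = 1 := Matrix.mul_nonsing_inv _ hz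
  have hrow : Matrix.vecMul (A i k) (h z)
      = Matrix.vecMul (fun p => christoffel h i k p z) (h z) := by
    funext l
    have := (hA i k l).trans (christoffel_metric h z hz i k l).symm
    simpa [Matrix.vecMul, dotProduct] using this
  have h2 := congrArg (fun v => Matrix.vecMul v (h z)⁻¹) hrow
  simp only [Matrix.vecMul_vecMul, hinv, Matrix.vecMul_one] at h2
  exact congrFun h2 p

/-- The Chern covariant derivative `∇_{∂/∂z_i} Y` of a (1,0)-field `Y`. -/
def nabla {n : ℕ} (h : Cn n → Matrix (Fin n) (Fin n) ℂ) (i : Fin n) (Y : Cn n → Cn n) :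
    Cn n → Cn n :=
  fun z p => dz i (fun w => Y w p) z + ∑ k, christoffel h i k p z * Y z k

/-- The Chern covariant derivative `∇_{∂/∂z̄_j} Y` of a (1,0)-field `Y`; it is `∂̄`. -/
def nablaBar {n : ℕ} (j : Fin n) (Y : Cn n → Cn n) : Cn n → Cn n :=
  fun z p => dzbar j (fun w => Y w p) z

/-- The coordinate field `∂/∂z_k`. -/
def coordField {n : ℕ} (k : Fin n) : Cn n → Cn n := fun _ => Pi.single k 1

/-- `T_{ij}^k`: the torsion `T(∂_i, ∂_j) = ∇_i ∂_j - ∇_j ∂_i` (coordinate fields commute). -/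
def torsion {n : ℕ} (h : Cn n → Matrix (Fin n) (Fin n) ℂ) (i j k : Fin n) (z : Cn n) : ℂ :=
  nabla h i (coordField j) z k - nabla h j (coordField i) z k

/-- `T_{ij l̄} = g(T(∂_i, ∂_j), ∂̄_l)`. Its complex conjugate is `T_{ī j̄ l}`. -/
def torsionLow {n : ℕ} (h : Cn n → Matrix (Fin n) (Fin n) ℂ) (i j l : Fin n) (z : Cn n) : ℂ :=
  ∑ k, torsion h i j k z * h z k l

/-- The Chern curvature `Ω_{i j̄ k l̄} = g((∇_i ∇_{j̄} - ∇_{j̄} ∇_i) ∂_k, ∂̄_l)`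
(coordinate fields commute). -/
def curvature {n : ℕ} (h : Cn n → Matrix (Fin n) (Fin n) ℂ) (i j k l : Fin n) (z : Cn n) : ℂ :=
  ∑ p, (nabla h i (nablaBar j (coordField k)) z p
    - nablaBar j (nabla h i (coordField k)) z p) * h z p l

/-- The second Chern-Ricci curvature `S_{i j̄} = g^{m r̄} Ω_{m r̄ i j̄}`. -/
def secondRicci {n : ℕ} (h : Cn n → Matrix (Fin n) (Fin n) ℂ) (i j : Fin n) (z : Cn n) : ℂ :=
  ∑ m, ∑ r, invMetric (h z) m r * curvature h m r i j z

/-- The torsion term `Q_{i j̄} = ½ g^{m r̄} g^{p s̄} T_{pm j̄} T_{s̄ r̄ i}`. -/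
def torsionQuad {n : ℕ} (h : Cn n → Matrix (Fin n) (Fin n) ℂ) (i j : Fin n) (z : Cn n) : ℂ :=
  (1 / 2) * ∑ m, ∑ r, ∑ p, ∑ s, invMetric (h z) m r * invMetric (h z) p s *
    torsionLow h p m j z * conj (torsionLow h s r i z)

/-- `Ω(ξ, ξ̄, η, η̄)` for `ξ = ∑ i, ξ^i ∂/∂z_i` and `η = ∑ k, η^k ∂/∂z_k`. -/
def curvatureForm {n : ℕ} (h : Cn n → Matrix (Fin n) (Fin n) ℂ) (z : Cn n) (ξ η : Cn n) : ℂ :=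
  ∑ i, ∑ j, ∑ k, ∑ l, curvature h i j k l z * ξ i * conj (ξ j) * η k * conj (η l)

/-! ### Hermitian metrics on complex manifolds -/

section Manifold

variable {n : ℕ} {M : Type*} [TopologicalSpace M] [ChartedSpace (Cn n) M]

/-- The coefficient matrix `g(∂/∂z_i, ∂/∂z̄_j)`, at the point with coordinates `z` in the chart
`e`, of a field of sesquilinear forms on the (holomorphic) tangent spaces. The coordinate vector
`∂/∂z_i` is the image of the `i`-th basis vector under the differential of `e⁻¹`. -/
def coeff (g : ∀ x : M, TangentSpace 𝓘(ℂ, Cn n) x →ₗ[ℂ] TangentSpace 𝓘(ℂ, Cn n) x →ₗ⋆[ℂ] ℂ)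
    (e : OpenPartialHomeomorph M (Cn n)) (z : Cn n) : Matrix (Fin n) (Fin n) ℂ :=
  Matrix.of fun i j => g (e.symm z)
    (mfderiv 𝓘(ℂ, Cn n) 𝓘(ℂ, Cn n) e.symm z (Pi.single i 1 : Cn n))
    (mfderiv 𝓘(ℂ, Cn n) 𝓘(ℂ, Cn n) e.symm z (Pi.single j 1 : Cn n))

variable (n M) in
/-- The holomorphic charts of the complex manifold `M`. -/
def holomorphicCharts : Set (OpenPartialHomeomorph M (Cn n)) :=
  IsManifold.maximalAtlas 𝓘(ℂ, Cn n) ω M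

variable (n M) in
/-- A smooth Hermitian metric on the complex manifold `M`: the form `form x ξ η` is `g(ξ, η̄)`
for `ξ, η` in the holomorphic tangent space at `x` (that is, in `T^{1,0}_x M`). -/
structure HermitianMetric where
  /-- The form `g(ξ, η̄)`, linear in `ξ` and conjugate-linear in `η`. -/
  form : ∀ x : M, TangentSpace 𝓘(ℂ, Cn n) x →ₗ[ℂ] TangentSpace 𝓘(ℂ, Cn n) x →ₗ⋆[ℂ] ℂ
  conj_symm : ∀ (x : M) (ξ η : TangentSpace 𝓘(ℂ, Cn n) x), conj (form x ξ η) = form x η ξ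
  pos : ∀ (x : M) (ξ : TangentSpace 𝓘(ℂ, Cn n) x), ξ ≠ 0 → 0 < (form x ξ ξ).re
  smooth : ∀ e ∈ holomorphicCharts n M, ContDiffOn ℝ ∞ (fun z i j => coeff form e z i j) e.target

/-- The coefficient matrix `g_{i j̄}` of a Hermitian metric in a chart. -/
def HermitianMetric.inChart (g : HermitianMetric n M) (e : OpenPartialHomeomorph M (Cn n)) :
    Cn n → Matrix (Fin n) (Fin n) ℂ :=
  coeff g.form e

/-- The Chern curvature of `g` is Griffiths non-negative: `Ω(ξ, ξ̄, η, η̄) ≥ 0` for all nonzero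
`ξ, η` in `T^{1,0} M`, with `ξ, η` given by their components in a holomorphic chart. (The number
`Ω(ξ, ξ̄, η, η̄)` is real and does not depend on the chart.) -/
def HermitianMetric.GriffithsNonneg (g : HermitianMetric n M) : Prop :=
  ∀ e ∈ holomorphicCharts n M, ∀ z ∈ e.target, ∀ ξ η : Cn n, ξ ≠ 0 → η ≠ 0 →
    0 ≤ (curvatureForm (g.inChart e) z ξ η).re

/-- The Chern curvature of `g` is Griffiths positive. -/
def HermitianMetric.GriffithsPos (g : HermitianMetric n M) : Prop :=
  ∀ e ∈ holomorphicCharts n M, ∀ z ∈ e.target, ∀ ξ η : Cn n, ξ ≠ 0 → η ≠ 0 →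
    0 < (curvatureForm (g.inChart e) z ξ η).re

/-- `g t`, `t ∈ [0, τ)`, is a (smooth) solution of the Hermitian curvature flow
`dg_{i j̄}/dt = - S_{i j̄} - Q_{i j̄}`, `g(0) = g₀`. Only the metrics `g t` with `t ∈ [0, τ)` matter,
and the time derivative at `0` is one-sided. -/
structure IsHermitianCurvatureFlow (g₀ : HermitianMetric n M) (τ : ℝ)
    (g : ℝ → HermitianMetric n M) : Prop where
  initial : g 0 = g₀
  smooth : ∀ e ∈ holomorphicCharts n M,
    ContDiffOn ℝ ∞ (fun (q : ℝ × Cn n) i j => (g q.1).inChart e q.2 i j)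
      (Set.Ico 0 τ ×ˢ e.target)
  evolution : ∀ e ∈ holomorphicCharts n M, ∀ z ∈ e.target, ∀ t ∈ Set.Ico 0 τ, ∀ i j : Fin n,
    HasDerivWithinAt (fun s => (g s).inChart e z i j)
      (- secondRicci ((g t).inChart e) i j z - torsionQuad ((g t).inChart e) i j z)
      (Set.Ico 0 τ) t

end Manifold

end HermitianFlow

end

open scoped Manifold ContDiff ComplexConjugate

noncomputable section

set_option linter.unusedSectionVars false
set_option linter.unusedSimpArgs false

namespace HermitianFlow
/-! ### Matrices over a ring with derivations -/

section MatrixDerivation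

variable {ι R : Type*} [Fintype ι] [DecidableEq ι] [CommRing R] [Algebra ℂ R]

/-! The theorem is a tensor maximum principle. Write `Ω(ξ,η)` for `Ω(ξ,ξ̄,η,η̄)` and consider
`Ω(ξ,η) + ψ(t)|ξ|²|η|²`. It suffices to find `κ` such that, when this form is non-negative at time
`t` and vanishes at a pair of unit vectors, its time derivative with `c = ψ(t)` frozen is at least
`-κ|c|`. If `ψ' > κ|ψ|`, a first zero is then impossible: the total derivative there would be
positive, while the form was positive before. A small positive `ψ`, sent to zero, gives the
non-negative case; a negative exponentially decaying `ψ` gives the positive case. Compactness of `M`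
supplies a uniform `κ` and a first time (`exists_maximum_principle`).

The derivative estimate rests on an exact evolution formula at one point (`IsGauge.evolution`). The
last two indices of `Ω` are viewed as indices of the holomorphic bundle `T^{1,0}M`, the first two as
base directions. The base keeps its coordinates, unitary at the point; the bundle receives a
holomorphic frame in which the metric `k` satisfies `k = 1`, `∂k = 0`, `∂∂k = 0` at the point. There
`Ω = -∂∂̄k`, and covariant commutation formulas reduce to the commutation of partial derivatives.
The base coordinates cannot be normalised in this way because of torsion. Its first-order effects
are absorbed by extending `ξ` to a holomorphic field `Ξ` and `η` to an antiholomorphic field `H`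
with prescribed first derivatives: all derivative terms of `∂_tΩ` then combine into `∑_m ∂_m∂̄_m
[Ω(Ξ,H)]`, which is non-negative at a spatial minimum.

What remains are squares, terms containing the factor `Ω(ξ,ξ̄,·,η̄)`, which vanishes at a null pair
by first variation, and a quadratic reaction term. With `B_{pq} = Ω(∂_p,ξ̄,∂_q,η̄)`, the Laplacian
commutation produces `-|B|²`, and the torsion term `Q` of the flow contributes `½|B-Bᵀ|²` through
the Bianchi identity `∂̄T = -(B-Bᵀ)`. Together these are `-∑ B_{pq} conj B_{qp}`; this is why the
flow contains exactly this `Q`. The sum of this with `∑ Ω_{pq̄ηη̄} Ω_{ξξ̄qp̄}` is non-negative at a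
null pair: the second variation of the form makes a block matrix positive semidefinite, and a trace
inequality applies (`null_trace_nonneg`).

For the perturbed form all these statements hold up to an error of order `|c|`, with constants
depending on bounds for the curvature and the first derivatives of the metric
(`IsGauge.evolution_lower_bound`). The calculus takes place in the ring of smooth functions on a
space-time domain, where derivatives are commuting derivations. Tensoriality of the curvature under
holomorphic changes of coordinates carries the local estimates to the manifold. -/

/-- The entrywise action of a derivation on matrices. -/
def mapD (X : Derivation ℂ R R) : Matrix ι ι R →ₗ[ℂ] Matrix ι ι R :=
  X.toLinearMap.mapMatrix

@[simp] theorem mapD_apply (X : Derivation ℂ R R) (M : Matrix ι ι R) (i j : ι) :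
    mapD X M i j = X (M i j) := rfl

theorem mapD_mul (X : Derivation ℂ R R) (M N : Matrix ι ι R) :
    mapD X (M * N) = mapD X M * N + M * mapD X N := by
  ext i j
  simp only [mapD_apply, Matrix.mul_apply, Matrix.add_apply, map_sum, Derivation.leibniz,
    smul_eq_mul, Finset.sum_add_distrib]
  rw [add_comm]
  congr 1
  exact Finset.sum_congr rfl fun k _ => mul_comm _ _

theorem mapD_one (X : Derivation ℂ R R) : mapD X (1 : Matrix ι ι R) = 0 := by
  ext i j
  by_cases h : i = j <;> simp [Matrix.one_apply, h]

theorem mapD_transpose (X : Derivation ℂ R R) (M : Matrix ι ι R) :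
    mapD X M.transpose = (mapD X M).transpose := rfl

theorem mapD_inv (X : Derivation ℂ R R) (M : Matrix ι ι R) (hM : IsUnit M.det) :
    mapD X M⁻¹ = - (M⁻¹ * mapD X M * M⁻¹) := by
  have h1 : mapD X (M * M⁻¹) = 0 := by rw [Matrix.mul_nonsing_inv _ hM, mapD_one]
  rw [mapD_mul] at h1
  have h2 := congrArg (fun N => M⁻¹ * N) h1
  simp only [mul_add, mul_zero, ← mul_assoc, Matrix.nonsing_inv_mul _ hM, one_mul] at h2
  exact eq_neg_of_add_eq_zero_right h2

/-- The curvature `- X Y M + (X M) M⁻¹ (Y M)` of a matrix-valued metric. -/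
def curvM (X Y : Derivation ℂ R R) (M : Matrix ι ι R) : Matrix ι ι R :=
  - mapD X (mapD Y M) + mapD X M * M⁻¹ * mapD Y M

/-- The curvature is covariant under holomorphic changes of frame. -/
theorem curvM_gauge (X Y : Derivation ℂ R R) (A M B : Matrix ι ι R) (hA : IsUnit A.det)
    (hB : IsUnit B.det) (hM : IsUnit M.det) (hYA : mapD Y A = 0) (hXB : mapD X B = 0)
    (hXYB : mapD X (mapD Y B) = 0) :
    curvM X Y (A * M * B) = A * curvM X Y M * B := by
  have e1 : (A * M * B)⁻¹ = B⁻¹ * M⁻¹ * A⁻¹ := by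
    rw [Matrix.mul_inv_rev, Matrix.mul_inv_rev, mul_assoc]
  have a1 : A⁻¹ * A = 1 := Matrix.nonsing_inv_mul _ hA
  have b1 : B * B⁻¹ = 1 := Matrix.mul_nonsing_inv _ hB
  have m1 : M⁻¹ * M = 1 := Matrix.nonsing_inv_mul _ hM
  have m2 : M * M⁻¹ = 1 := Matrix.mul_nonsing_inv _ hM
  have e2 : mapD X (A * M * B) = (mapD X A * M + A * mapD X M) * B := by
    rw [mapD_mul, mapD_mul, hXB, mul_zero, add_zero]
  have e3 : mapD Y (A * M * B) = A * (mapD Y M * B + M * mapD Y B) := by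
    rw [mapD_mul, mapD_mul, hYA, zero_mul, zero_add, mul_add]; simp only [mul_assoc]
  have e4 : (mapD X A * M + A * mapD X M) * B * (B⁻¹ * M⁻¹ * A⁻¹) *
      (A * (mapD Y M * B + M * mapD Y B))
      = (mapD X A * M + A * mapD X M) * (B * B⁻¹) * M⁻¹ * (A⁻¹ * A) *
        (mapD Y M * B + M * mapD Y B) := by
    simp only [mul_assoc]
  have e5 : mapD X (A * (mapD Y M * B + M * mapD Y B)) =
      mapD X A * (mapD Y M * B + M * mapD Y B) +
        A * (mapD X (mapD Y M) * B + mapD X M * mapD Y B) := by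
    rw [mapD_mul, map_add, mapD_mul, mapD_mul, hXB, hXYB]; noncomm_ring
  have e6 : (mapD X A * M + A * mapD X M) * M⁻¹ * (mapD Y M * B + M * mapD Y B)
      = mapD X A * (M * M⁻¹) * mapD Y M * B + mapD X A * (M * M⁻¹) * M * mapD Y B
       + A * mapD X M * M⁻¹ * mapD Y M * B + A * mapD X M * (M⁻¹ * M) * mapD Y B := by
    noncomm_ring
  rw [curvM, e2, e3, e1, e4, b1, a1, mul_one, mul_one, e5, e6, m1, m2, curvM]
  noncomm_ring

end MatrixDerivation

/-! ### Rings with Wirtinger derivations -/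

/-- A commutative ring of complex-valued functions of `z ∈ ℂⁿ` and of time, with the commuting
derivations `∂/∂z_i`, `∂/∂z̄_i`, `∂/∂t`. -/
structure WirtingerRing (n : ℕ) (R : Type*) [CommRing R] [StarRing R] [Algebra ℂ R] where
  /-- The derivation `∂/∂z_i`. -/
  d : Fin n → Derivation ℂ R R
  /-- The derivation `∂/∂z̄_i`. -/
  db : Fin n → Derivation ℂ R R
  /-- The derivation `∂/∂t`. -/
  dt : Derivation ℂ R R
  d_comm : ∀ i j f, d i (d j f) = d j (d i f)
  d_db : ∀ i j f, d i (db j f) = db j (d i f)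
  dt_d : ∀ i f, dt (d i f) = d i (dt f)
  dt_db : ∀ i f, dt (db i f) = db i (dt f)
  star_d : ∀ i f, star (d i f) = db i (star f)

theorem derivation_sum_apply {R ι : Type*} [CommRing R] [Algebra ℂ R] (s : Finset ι)
    (X : ι → Derivation ℂ R R) (f : R) : (∑ i ∈ s, X i) f = ∑ i ∈ s, X i f := by
  classical
  induction s using Finset.induction_on with
  | empty => simp
  | insert a s ha ih => rw [Finset.sum_insert ha, Finset.sum_insert ha, Derivation.add_apply, ih]

namespace WirtingerRing

variable {n : ℕ} {R : Type*} [CommRing R] [StarRing R] [Algebra ℂ R] [StarModule ℂ R]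
  (W : WirtingerRing n R)

theorem star_db (i : Fin n) (f : R) : star (W.db i f) = W.d i (star f) := by
  have := W.star_d i (star f)
  rw [star_star] at this
  rw [← this, star_star]

theorem db_comm (i j : Fin n) (f : R) : W.db i (W.db j f) = W.db j (W.db i f) := by
  have := congrArg star (W.d_comm i j (star f))
  simpa only [star_d, star_star] using this

/-- The derivation along a constant (1,0)-vector. -/
def D (u : Fin n → ℂ) : Derivation ℂ R R := ∑ i, u i • W.d i

/-- The derivation along the conjugate of a constant (1,0)-vector. -/
def Db (u : Fin n → ℂ) : Derivation ℂ R R := ∑ i, conj (u i) • W.db i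

theorem D_apply (u : Fin n → ℂ) (f : R) : W.D u f = ∑ i, u i • W.d i f := by
  simp [D, derivation_sum_apply]

theorem Db_apply (u : Fin n → ℂ) (f : R) : W.Db u f = ∑ i, conj (u i) • W.db i f := by
  simp [Db, derivation_sum_apply]

theorem star_D (u : Fin n → ℂ) (f : R) : star (W.D u f) = W.Db u (star f) := by
  simp [D_apply, Db_apply, star_sum, star_smul, star_d]

theorem star_Db (u : Fin n → ℂ) (f : R) : star (W.Db u f) = W.D u (star f) := by
  simp [D_apply, Db_apply, star_sum, star_smul, star_db]

theorem d_D (i : Fin n) (u : Fin n → ℂ) (f : R) : W.d i (W.D u f) = W.D u (W.d i f) := by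
  simp [D_apply, W.d_comm i]

theorem d_Db (i : Fin n) (u : Fin n → ℂ) (f : R) : W.d i (W.Db u f) = W.Db u (W.d i f) := by
  simp [Db_apply, W.d_db i]

theorem db_D (i : Fin n) (u : Fin n → ℂ) (f : R) : W.db i (W.D u f) = W.D u (W.db i f) := by
  simp [D_apply, ← W.d_db]

theorem db_Db (i : Fin n) (u : Fin n → ℂ) (f : R) : W.db i (W.Db u f) = W.Db u (W.db i f) := by
  simp [Db_apply, W.db_comm i]

theorem D_Db (u v : Fin n → ℂ) (f : R) : W.D u (W.Db v f) = W.Db v (W.D u f) := by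
  simp only [W.D_apply u, map_sum, Derivation.map_smul, d_Db]

theorem dt_D (u : Fin n → ℂ) (f : R) : W.dt (W.D u f) = W.D u (W.dt f) := by
  simp [D_apply, W.dt_d]

theorem dt_Db (u : Fin n → ℂ) (f : R) : W.dt (W.Db u f) = W.Db u (W.dt f) := by
  simp [Db_apply, W.dt_db]

theorem mapD_D_apply (u : Fin n → ℂ) (M : Matrix (Fin n) (Fin n) R) :
    mapD (W.D u) M = ∑ i, u i • mapD (W.d i) M := by
  ext k l
  simp [D_apply, Matrix.sum_apply]

theorem mapD_Db_apply (u : Fin n → ℂ) (M : Matrix (Fin n) (Fin n) R) :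
    mapD (W.Db u) M = ∑ i, conj (u i) • mapD (W.db i) M := by
  ext k l
  simp [Db_apply, Matrix.sum_apply]

theorem mapD_d_conjTranspose (i : Fin n) (M : Matrix (Fin n) (Fin n) R) :
    (mapD (W.d i) M).conjTranspose = mapD (W.db i) M.conjTranspose := by
  ext k l
  simp [Matrix.conjTranspose_apply, star_d]

theorem mapD_db_conjTranspose (i : Fin n) (M : Matrix (Fin n) (Fin n) R) :
    (mapD (W.db i) M).conjTranspose = mapD (W.d i) M.conjTranspose := by
  ext k l
  simp [Matrix.conjTranspose_apply, star_db]

theorem mapD_D_conjTranspose (u : Fin n → ℂ) (M : Matrix (Fin n) (Fin n) R) :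
    (mapD (W.D u) M).conjTranspose = mapD (W.Db u) M.conjTranspose := by
  ext k l
  simp [Matrix.conjTranspose_apply, star_D]

theorem mapD_Db_conjTranspose (u : Fin n → ℂ) (M : Matrix (Fin n) (Fin n) R) :
    (mapD (W.Db u) M).conjTranspose = mapD (W.D u) M.conjTranspose := by
  ext k l
  simp [Matrix.conjTranspose_apply, star_Db]

end WirtingerRing

/-! ### Contraction with constant vectors -/

section Contraction

variable {n : ℕ} {A : Type*} [AddCommGroup A] [Module ℂ A]

/-- The contraction `∑ k l, u^k v̄^l M_{k l̄}`. -/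
def con (u v : Fin n → ℂ) : Matrix (Fin n) (Fin n) A →ₗ[ℂ] A :=
  ∑ k, ∑ l, (u k * conj (v l)) • Matrix.entryLinearMap ℂ A k l

theorem con_apply (u v : Fin n → ℂ) (M : Matrix (Fin n) (Fin n) A) :
    con u v M = ∑ k, ∑ l, (u k * conj (v l)) • M k l := by
  simp [con, LinearMap.sum_apply]

theorem map_con {B F : Type*} [AddCommGroup B] [Module ℂ B] [FunLike F A B]
    [LinearMapClass F ℂ A B] (X : F) (u v : Fin n → ℂ) (M : Matrix (Fin n) (Fin n) A) :
    X (con u v M) = con u v (M.map X) := by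
  simp [con_apply]

theorem conj_con (u v : Fin n → ℂ) (M : Matrix (Fin n) (Fin n) ℂ) :
    conj (con u v M) = con v u M.conjTranspose := by
  simp only [con_apply, map_sum, smul_eq_mul, map_mul, Complex.conj_conj,
    Matrix.conjTranspose_apply]
  rw [Finset.sum_comm]
  refine Finset.sum_congr rfl fun k _ => Finset.sum_congr rfl fun l _ => ?_
  rw [mul_comm (conj (u l)), RCLike.star_def]

theorem con_mul_conjTranspose (u v : Fin n → ℂ) (M N : Matrix (Fin n) (Fin n) ℂ) :
    con u v (M * N.conjTranspose) =
      ∑ q, (∑ k, u k * M k q) * conj (∑ l, v l * N l q) := by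
  simp only [con_apply, Matrix.mul_apply, smul_eq_mul, Matrix.conjTranspose_apply, map_sum]
  have e : ∀ q, (∑ k, u k * M k q) * ∑ l, conj (v l * N l q) =
      ∑ k, ∑ l, u k * conj (v l) * (M k q * star (N l q)) := fun q => by
    rw [Finset.sum_mul_sum]
    refine Finset.sum_congr rfl fun k _ => Finset.sum_congr rfl fun l _ => ?_
    rw [map_mul, RCLike.star_def]
    ring
  rw [Finset.sum_congr rfl fun q _ => e q]
  symm
  rw [Finset.sum_comm]
  refine Finset.sum_congr rfl fun k _ => ?_
  rw [Finset.sum_comm]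
  exact Finset.sum_congr rfl fun l _ => (Finset.mul_sum _ _ _).symm

end Contraction

/-! ### Normal holomorphic frames and the jets of the curvature at a point -/

section NormalFrame

variable {n : ℕ} {R : Type*} [CommRing R] [StarRing R] [Algebra ℂ R] [StarModule ℂ R]
  {W : WirtingerRing n R} {ev : R →ₐ[ℂ] ℂ} {k : Matrix (Fin n) (Fin n) R}

theorem WirtingerRing.D_single (W : WirtingerRing n R) (i : Fin n) :
    W.D (Pi.single i 1) = W.d i := by
  ext f
  rw [W.D_apply, Finset.sum_eq_single i] <;> simp +contextual [Pi.single_apply]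

theorem WirtingerRing.Db_single (W : WirtingerRing n R) (i : Fin n) :
    W.Db (Pi.single i 1) = W.db i := by
  ext f
  rw [W.Db_apply, Finset.sum_eq_single i] <;> simp +contextual [Pi.single_apply]

theorem mapD_comm {X Y : Derivation ℂ R R} (h : ∀ f, X (Y f) = Y (X f))
    (M : Matrix (Fin n) (Fin n) R) : mapD X (mapD Y M) = mapD Y (mapD X M) := by
  ext i j
  exact h _

theorem mapMatrix_conjTranspose (hev : ∀ x, ev (star x) = conj (ev x))
    (M : Matrix (Fin n) (Fin n) R) :
    ev.mapMatrix M.conjTranspose = (ev.mapMatrix M).conjTranspose := by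
  ext i j
  simp [Matrix.conjTranspose_apply, hev]

theorem ev_con (u v : Fin n → ℂ) (M : Matrix (Fin n) (Fin n) R) :
    ev (con u v M) = con u v (ev.mapMatrix M) := map_con ev u v M

theorem derivation_con (X : Derivation ℂ R R) (u v : Fin n → ℂ) (M : Matrix (Fin n) (Fin n) R) :
    X (con u v M) = con u v (mapD X M) := map_con X.toLinearMap u v M

theorem ev_inv (M : Matrix (Fin n) (Fin n) R) (hM : IsUnit M.det)
    (h1 : ev.mapMatrix M = 1) : ev.mapMatrix M⁻¹ = 1 := by
  have := congrArg ev.mapMatrix (Matrix.mul_nonsing_inv _ hM)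
  rwa [map_mul, h1, one_mul, map_one] at this

/-- At the point of evaluation the frame is unitary, and all the derivatives of the metric `k` of
type (1,0) and (2,0) vanish. -/
structure IsNormalAt (W : WirtingerRing n R) (ev : R →ₐ[ℂ] ℂ) (k : Matrix (Fin n) (Fin n) R) :
    Prop where
  isUnit : IsUnit k.det
  herm : k.conjTranspose = k
  conj_ev : ∀ x, ev (star x) = conj (ev x)
  one : ev.mapMatrix k = 1
  ev_d : ∀ i, ev.mapMatrix (mapD (W.d i) k) = 0
  ev_dd : ∀ i j, ev.mapMatrix (mapD (W.d i) (mapD (W.d j) k)) = 0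

/-- The curvature `Ω(u, v̄)` in a normal frame, as a matrix. -/
def curvAt (W : WirtingerRing n R) (ev : R →ₐ[ℂ] ℂ) (k : Matrix (Fin n) (Fin n) R)
    (u v : Fin n → ℂ) : Matrix (Fin n) (Fin n) ℂ :=
  - ev.mapMatrix (mapD (W.D u) (mapD (W.Db v) k))

namespace IsNormalAt

variable (hk : IsNormalAt W ev k)
include hk

theorem ev_D (u : Fin n → ℂ) : ev.mapMatrix (mapD (W.D u) k) = 0 := by
  simp only [W.mapD_D_apply, map_sum, map_smul, hk.ev_d, smul_zero, Finset.sum_const_zero]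

theorem ev_Db (u : Fin n → ℂ) : ev.mapMatrix (mapD (W.Db u) k) = 0 := by
  have := congrArg Matrix.conjTranspose (hk.ev_D u)
  rwa [← mapMatrix_conjTranspose hk.conj_ev, W.mapD_D_conjTranspose, hk.herm,
    Matrix.conjTranspose_zero] at this

theorem ev_DD (u v : Fin n → ℂ) : ev.mapMatrix (mapD (W.D u) (mapD (W.D v) k)) = 0 := by
  simp only [W.mapD_D_apply, map_sum, map_smul, hk.ev_dd, smul_zero, Finset.sum_const_zero]

theorem ev_DbDb (u v : Fin n → ℂ) : ev.mapMatrix (mapD (W.Db u) (mapD (W.Db v) k)) = 0 := by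
  have := congrArg Matrix.conjTranspose (hk.ev_DD u v)
  rwa [← mapMatrix_conjTranspose hk.conj_ev, W.mapD_D_conjTranspose, W.mapD_D_conjTranspose,
    hk.herm, Matrix.conjTranspose_zero] at this

theorem ev_DDb (u v : Fin n → ℂ) :
    ev.mapMatrix (mapD (W.D u) (mapD (W.Db v) k)) = - curvAt W ev k u v := by
  rw [curvAt, neg_neg]

theorem ev_DbD (u v : Fin n → ℂ) :
    ev.mapMatrix (mapD (W.Db v) (mapD (W.D u) k)) = - curvAt W ev k u v := by
  rw [← mapD_comm (W.D_Db u v), hk.ev_DDb]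

theorem curvAt_conjTranspose (u v : Fin n → ℂ) :
    (curvAt W ev k u v).conjTranspose = curvAt W ev k v u := by
  rw [curvAt, curvAt, Matrix.conjTranspose_neg, ← mapMatrix_conjTranspose hk.conj_ev,
    W.mapD_D_conjTranspose, W.mapD_Db_conjTranspose, hk.herm, mapD_comm (W.D_Db v u)]

theorem ev_inv : ev.mapMatrix k⁻¹ = 1 := HermitianFlow.ev_inv k hk.isUnit hk.one

theorem ev_curvM (u v : Fin n → ℂ) :
    ev.mapMatrix (curvM (W.D u) (W.Db v) k) = curvAt W ev k u v := by
  simp only [curvM, curvAt, map_add, map_neg, map_mul, hk.ev_D, zero_mul, add_zero]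

/-- A single derivative can hit only one of the two first-order factors in the quadratic term of the
curvature, and the other factor vanishes at the point. As `X` is arbitrary, this covers the time
derivative as well. -/
theorem ev_deriv_curvM (X : Derivation ℂ R R) (u v : Fin n → ℂ) :
    ev.mapMatrix (mapD X (curvM (W.D u) (W.Db v) k)) =
      - ev.mapMatrix (mapD X (mapD (W.D u) (mapD (W.Db v) k))) := by
  simp only [curvM, map_add, map_neg, mapD_mul, map_mul, hk.ev_D, hk.ev_Db, zero_mul, mul_zero,
    add_zero]

/-- The quadratic term survives only when `W.Db w'` falls on `W.D u` of the metric and `W.D w` falls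
on `W.Db v` of it, so that both factors become mixed derivatives. The opposite distribution gives
pure second derivatives, which vanish in a normal frame. -/
theorem ev_deriv_deriv_curvM (w w' u v : Fin n → ℂ) :
    ev.mapMatrix (mapD (W.D w) (mapD (W.Db w') (curvM (W.D u) (W.Db v) k))) =
      - ev.mapMatrix (mapD (W.D w) (mapD (W.Db w') (mapD (W.D u) (mapD (W.Db v) k)))) +
        curvAt W ev k u w' * curvAt W ev k w v := by
  simp only [curvM, map_add, map_neg, mapD_mul, map_mul, hk.ev_D, hk.ev_Db, zero_mul, mul_zero,
    add_zero, zero_add, hk.ev_DD, hk.ev_DbDb, hk.ev_DbD, hk.ev_DDb, hk.ev_inv, mul_one, neg_mul,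
    mul_neg, neg_neg]

theorem ev_deriv_deriv_inv (u v : Fin n → ℂ) :
    ev.mapMatrix (mapD (W.D u) (mapD (W.Db v) k⁻¹)) = curvAt W ev k u v := by
  simp only [mapD_inv _ _ hk.isUnit, map_add, map_neg, mapD_mul, map_mul, hk.ev_D, hk.ev_Db,
    zero_mul, mul_zero, add_zero, zero_add, hk.ev_DDb, hk.ev_inv, mul_one, one_mul, neg_neg]

theorem ev_deriv_inv (u : Fin n → ℂ) : ev.mapMatrix (mapD (W.D u) k⁻¹) = 0 := by
  simp only [mapD_inv _ _ hk.isUnit, map_neg, map_mul, hk.ev_D, zero_mul, mul_zero, neg_zero]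

theorem ev_derivBar_inv (u : Fin n → ℂ) : ev.mapMatrix (mapD (W.Db u) k⁻¹) = 0 := by
  simp only [mapD_inv _ _ hk.isUnit, map_neg, map_mul, hk.ev_Db, zero_mul, mul_zero, neg_zero]

end IsNormalAt

theorem curvAt_sum_left {κ : Type*} (s : Finset κ) (c : κ → ℂ) (u : κ → Fin n → ℂ)
    (v : Fin n → ℂ) :
    curvAt W ev k (∑ i ∈ s, c i • u i) v = ∑ i ∈ s, c i • curvAt W ev k (u i) v := by
  simp only [curvAt, W.mapD_D_apply, map_sum, map_smul, Finset.sum_apply, Pi.smul_apply,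
    smul_eq_mul, Finset.sum_smul, mul_smul, smul_neg, Finset.sum_neg_distrib, Finset.smul_sum]
  rw [Finset.sum_comm]

theorem curvAt_sum_right {κ : Type*} (s : Finset κ) (c : κ → ℂ) (u : Fin n → ℂ)
    (v : κ → Fin n → ℂ) :
    curvAt W ev k u (∑ i ∈ s, c i • v i) = ∑ i ∈ s, conj (c i) • curvAt W ev k u (v i) := by
  simp only [curvAt, W.mapD_Db_apply, map_sum, map_smul, Finset.sum_apply, Pi.smul_apply,
    smul_eq_mul, Finset.sum_smul, mul_smul, smul_neg, Finset.sum_neg_distrib, Finset.smul_sum,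
    map_mul]
  rw [Finset.sum_comm]

theorem eq_sum_single (u : Fin n → ℂ) : u = ∑ i, u i • (Pi.single i 1 : Fin n → ℂ) := by
  ext j
  simp [Finset.sum_apply, Pi.single_apply]

end NormalFrame

/-! ### The second derivatives of the second Chern-Ricci term -/

section SecondRicci

variable {n : ℕ} {R : Type*} [CommRing R] [StarRing R] [Algebra ℂ R] [StarModule ℂ R]
  {W : WirtingerRing n R} {ev : R →ₐ[ℂ] ℂ} {k : Matrix (Fin n) (Fin n) R}

/-- The basis vector `∂/∂z_m`. -/
abbrev basisVec {n : ℕ} (m : Fin n) : Fin n → ℂ := Pi.single m 1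

/-- The contraction of `g^{m r̄} Ω_{m r̄}` with `η, η̄`. -/
def ricciTrace (W : WirtingerRing n R) (g k : Matrix (Fin n) (Fin n) R) (η : Fin n → ℂ) : R :=
  ∑ m, ∑ r, g r m * con η η (curvM (W.d m) (W.db r) k)

theorem IsNormalAt.ricciTrace_deriv_aux (hk : IsNormalAt W ev k) (g : Matrix (Fin n) (Fin n) R)
    (ξ η : Fin n → ℂ) (H : Matrix (Fin n) (Fin n) ℂ) (hg : ev.mapMatrix g = 1)
    (hg1 : ev.mapMatrix (mapD (W.D ξ) g) = - H)
    (hg2 : ev.mapMatrix (mapD (W.Db ξ) g) = - H.conjTranspose)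
    (hg3 : ev.mapMatrix (mapD (W.D ξ) (mapD (W.Db ξ) g)) =
      curvAt W ev k ξ ξ + H.conjTranspose * H) (m r : Fin n) :
    ev (W.D ξ (W.Db ξ (g r m * con η η (curvM (W.d m) (W.db r) k)))) =
      (if r = m then con η η (- ev.mapMatrix (mapD (W.D ξ) (mapD (W.Db ξ)
          (mapD (W.d m) (mapD (W.db r) k)))) +
        curvAt W ev k (basisVec m) ξ * curvAt W ev k ξ (basisVec r)) else 0)
      + H r m * con η η (ev.mapMatrix (mapD (W.Db ξ) (mapD (W.d m) (mapD (W.db r) k))))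
      + conj (H m r) * con η η (ev.mapMatrix (mapD (W.D ξ) (mapD (W.d m) (mapD (W.db r) k))))
      + (curvAt W ev k ξ ξ + H.conjTranspose * H) r m *
        con η η (curvAt W ev k (basisVec m) (basisVec r)) := by
  have e0 := congrFun (congrFun hg r) m
  have e1 := congrFun (congrFun hg1 r) m
  have e2 := congrFun (congrFun hg2 r) m
  have e3 := congrFun (congrFun hg3 r) m
  simp only [AlgHom.mapMatrix_apply, Matrix.map_apply, mapD_apply, Matrix.neg_apply,
    Matrix.conjTranspose_apply, RCLike.star_def] at e0 e1 e2 e3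
  have c1 := hk.ev_deriv_deriv_curvM ξ ξ (basisVec m) (basisVec r)
  have c2 := hk.ev_deriv_curvM (W.D ξ) (basisVec m) (basisVec r)
  have c3 := hk.ev_deriv_curvM (W.Db ξ) (basisVec m) (basisVec r)
  have c4 := hk.ev_curvM (basisVec m) (basisVec r)
  rw [W.D_single, W.Db_single] at c1 c2 c3 c4
  simp only [Derivation.leibniz, map_add, smul_eq_mul, map_mul, derivation_con, ev_con, e0, e1, e2,
    e3, c1, c2, c3, c4, Matrix.one_apply, map_neg]
  split_ifs <;> ring

/-- The matrix `g` stands for the inverse of the coordinate metric, which is unitary at the point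
but not normal; `H` is the first derivative of that metric, and `hg1`-`hg3` record the resulting jet
of the inverse. The terms with derivatives of `g` combine into curvature terms in the directions `a
m`, namely minus the rows of `H`. They match the terms produced by a holomorphic field `Ξ` with `∂_m
Ξ = a m` inside the Laplacian. Only `Ω(ξ,ξ̄)` contracted with `Ω_{m r̄ η η̄}` is left as a genuine
reaction term, besides a product of two curvatures. -/
theorem IsNormalAt.ricciTrace_deriv (hk : IsNormalAt W ev k) (g : Matrix (Fin n) (Fin n) R)
    (ξ η : Fin n → ℂ) (H : Matrix (Fin n) (Fin n) ℂ) (hg : ev.mapMatrix g = 1)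
    (hg1 : ev.mapMatrix (mapD (W.D ξ) g) = - H)
    (hg2 : ev.mapMatrix (mapD (W.Db ξ) g) = - H.conjTranspose)
    (hg3 : ev.mapMatrix (mapD (W.D ξ) (mapD (W.Db ξ) g)) =
      curvAt W ev k ξ ξ + H.conjTranspose * H)
    (a : Fin n → Fin n → ℂ) (ha : ∀ m i, a m i = - H m i) :
    ev (W.D ξ (W.Db ξ (ricciTrace W g k η))) =
      ∑ m, (con η η (- ev.mapMatrix (mapD (W.d m) (mapD (W.db m)
          (mapD (W.D ξ) (mapD (W.Db ξ) k)))) +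
        curvAt W ev k (basisVec m) ξ * curvAt W ev k ξ (basisVec m))
      - con η η (ev.mapMatrix (mapD (W.db m) (mapD (W.D (a m)) (mapD (W.Db ξ) k))))
      - con η η (ev.mapMatrix (mapD (W.d m) (mapD (W.D ξ) (mapD (W.Db (a m)) k))))
      + con η η (curvAt W ev k (a m) (a m)))
      + ∑ m, ∑ r, curvAt W ev k ξ ξ r m * con η η (curvAt W ev k (basisVec m) (basisVec r)) := by
  simp only [ricciTrace, map_sum]
  rw [Finset.sum_congr rfl fun m _ => Finset.sum_congr rfl fun r _ =>
    hk.ricciTrace_deriv_aux g ξ η H hg hg1 hg2 hg3 m r]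
  simp only [Finset.sum_add_distrib, Finset.sum_sub_distrib, Matrix.add_apply, add_mul]
  have s1 : ∀ m, (∑ r, if r = m then con η η (- ev.mapMatrix (mapD (W.D ξ) (mapD (W.Db ξ)
          (mapD (W.d m) (mapD (W.db r) k)))) +
        curvAt W ev k (basisVec m) ξ * curvAt W ev k ξ (basisVec r)) else 0)
      = con η η (- ev.mapMatrix (mapD (W.d m) (mapD (W.db m)
          (mapD (W.D ξ) (mapD (W.Db ξ) k)))) +
        curvAt W ev k (basisVec m) ξ * curvAt W ev k ξ (basisVec m)) := by
    intro m
    rw [Finset.sum_ite_eq' Finset.univ m]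
    simp only [Finset.mem_univ, if_true]
    -- Commuting fourth-order partial derivatives exchanges the direction `ξ` with the trace
    -- direction. In a normal frame this does the work of the second Bianchi identity; the curvature
    -- products were already separated off.
    have : mapD (W.D ξ) (mapD (W.Db ξ) (mapD (W.d m) (mapD (W.db m) k))) =
        mapD (W.d m) (mapD (W.db m) (mapD (W.D ξ) (mapD (W.Db ξ) k))) := by
      ext i j
      simp only [mapD_apply, ← W.d_Db, ← W.d_D, ← W.db_Db, ← W.db_D]
    rw [this]
  have s2 : ∑ m, ∑ r, H r m *
        con η η (ev.mapMatrix (mapD (W.Db ξ) (mapD (W.d m) (mapD (W.db r) k))))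
      = - ∑ m, con η η (ev.mapMatrix (mapD (W.db m) (mapD (W.D (a m)) (mapD (W.Db ξ) k)))) := by
    rw [Finset.sum_comm, ← Finset.sum_neg_distrib]
    refine Finset.sum_congr rfl fun r _ => ?_
    simp only [W.mapD_D_apply (a r), map_sum, map_smul, ha, neg_smul, map_neg,
      Finset.sum_neg_distrib, neg_neg, smul_eq_mul]
    refine Finset.sum_congr rfl fun m _ => ?_
    have : mapD (W.Db ξ) (mapD (W.d m) (mapD (W.db r) k)) =
        mapD (W.db r) (mapD (W.d m) (mapD (W.Db ξ) k)) := by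
      ext i j
      simp only [mapD_apply]
      rw [W.d_db, ← W.db_Db, ← W.d_Db]
    rw [this]
  have s3 : ∑ m, ∑ r, conj (H m r) *
        con η η (ev.mapMatrix (mapD (W.D ξ) (mapD (W.d m) (mapD (W.db r) k))))
      = - ∑ m, con η η (ev.mapMatrix (mapD (W.d m) (mapD (W.D ξ) (mapD (W.Db (a m)) k)))) := by
    rw [← Finset.sum_neg_distrib]
    refine Finset.sum_congr rfl fun r _ => ?_
    simp only [W.mapD_Db_apply (a r), map_sum, map_smul, ha, neg_smul, map_neg,
      Finset.sum_neg_distrib, neg_neg, smul_eq_mul]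
    refine Finset.sum_congr rfl fun m _ => ?_
    rw [mapD_comm (W.d_D r ξ)]
  -- The square of the first derivative in the jet of `g` is, by sesquilinearity, the curvature
  -- evaluated on the pairs `a p, a p`; the two minus signs cancel.
  have s4 : ∑ m, ∑ r, (H.conjTranspose * H) r m *
        con η η (curvAt W ev k (basisVec m) (basisVec r))
      = ∑ p, con η η (curvAt W ev k (a p) (a p)) := by
    have : ∀ p, con η η (curvAt W ev k (a p) (a p)) = ∑ m, ∑ r, conj (H p r) * H p m *
        con η η (curvAt W ev k (basisVec m) (basisVec r)) := by
      intro p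
      conv_lhs => rw [eq_sum_single (a p)]
      simp only [curvAt_sum_left, curvAt_sum_right, map_sum, map_smul, smul_eq_mul, Finset.mul_sum]
      simp only [ha, map_neg]
      rw [Finset.sum_comm]
      refine Finset.sum_congr rfl fun m _ => Finset.sum_congr rfl fun r _ => by ring
    simp only [this, Matrix.mul_apply, Matrix.conjTranspose_apply, Finset.sum_mul, RCLike.star_def]
    rw [Finset.sum_congr rfl fun m _ => Finset.sum_comm, Finset.sum_comm]
  rw [Finset.sum_congr rfl fun m _ => s1 m, s2, s3, s4]
  simp only [map_add, Finset.sum_add_distrib]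
  ring

end SecondRicci

/-! ### The torsion in a normal frame and its derivatives -/

section TorsionTrace

variable {n : ℕ} {R : Type*} [CommRing R] [StarRing R] [Algebra ℂ R] [StarModule ℂ R]
  {W : WirtingerRing n R} {ev : R →ₐ[ℂ] ℂ} {k : Matrix (Fin n) (Fin n) R}

theorem derivation_trace (X : Derivation ℂ R R) (M : Matrix (Fin n) (Fin n) R) :
    X M.trace = (mapD X M).trace := by
  simp [Matrix.trace, map_sum]

theorem ev_trace (M : Matrix (Fin n) (Fin n) R) :
    ev M.trace = (ev.mapMatrix M).trace := by
  simp [Matrix.trace, map_sum]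

theorem mapMatrix_transpose (M : Matrix (Fin n) (Fin n) R) :
    ev.mapMatrix M.transpose = (ev.mapMatrix M).transpose := rfl

/-- At the point the first derivatives of `k⁻¹` vanish and its mixed second derivative is `Ω(ξ,ξ̄)`.
So each copy of `k⁻¹` contributes one curvature term, and the remaining terms come from Leibniz
applied to `σ` and its adjoint, including two squares of first derivatives. -/
theorem IsNormalAt.trace_deriv (hk : IsNormalAt W ev k) (ξ : Fin n → ℂ)
    (σ : Matrix (Fin n) (Fin n) R) :
    ev (W.D ξ (W.Db ξ (k⁻¹ * σ * k⁻¹.transpose * σ.conjTranspose).trace)) =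
      (curvAt W ev k ξ ξ * ev.mapMatrix σ * (ev.mapMatrix σ).conjTranspose).trace
      + (ev.mapMatrix σ * (curvAt W ev k ξ ξ).transpose * (ev.mapMatrix σ).conjTranspose).trace
      + (ev.mapMatrix (mapD (W.D ξ) (mapD (W.Db ξ) σ)) * (ev.mapMatrix σ).conjTranspose).trace
      + (ev.mapMatrix σ *
        (ev.mapMatrix (mapD (W.D ξ) (mapD (W.Db ξ) σ))).conjTranspose).trace
      + (ev.mapMatrix (mapD (W.D ξ) σ) * (ev.mapMatrix (mapD (W.D ξ) σ)).conjTranspose).trace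
      + (ev.mapMatrix (mapD (W.Db ξ) σ) * (ev.mapMatrix (mapD (W.Db ξ) σ)).conjTranspose).trace := by
  have hi := hk.ev_inv
  rw [derivation_trace, derivation_trace, ev_trace]
  simp only [mapD_mul, map_add, mapD_transpose, map_mul, mapMatrix_transpose, hk.ev_deriv_inv,
    hk.ev_derivBar_inv, hi, hk.ev_deriv_deriv_inv, mapMatrix_conjTranspose hk.conj_ev,
    ← W.mapD_D_conjTranspose, ← W.mapD_Db_conjTranspose,
    Matrix.transpose_zero, Matrix.transpose_one, zero_mul, mul_zero, one_mul, mul_one, zero_add,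
    add_zero, add_mul, Matrix.trace_add, mapD_comm (W.D_Db ξ ξ) σ]
  ring

/-- The data of a holomorphic change of frame `P`, which is the identity at the point of
evaluation, from the metric `h` to the metric `k`. -/
structure IsGauge (W : WirtingerRing n R) (ev : R →ₐ[ℂ] ℂ) (h P k : Matrix (Fin n) (Fin n) R) :
    Prop where
  unit_h : IsUnit h.det
  unit_P : IsUnit P.det
  holo : ∀ i, mapD (W.db i) P = 0
  one : ev.mapMatrix P = 1
  eq : k = P.transpose * h * P.map star

theorem WirtingerRing.Db_map_eq_zero (W : WirtingerRing n R) (P : Matrix (Fin n) (Fin n) R)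
    (hP : ∀ i, mapD (W.db i) P = 0) (u : Fin n → ℂ) : mapD (W.Db u) P = 0 := by
  simp only [W.mapD_Db_apply, hP, smul_zero, Finset.sum_const_zero]

theorem map_star_eq (P : Matrix (Fin n) (Fin n) R) : P.map star = P.conjTranspose.transpose := rfl

theorem WirtingerRing.d_map_star (W : WirtingerRing n R) (P : Matrix (Fin n) (Fin n) R)
    (hP : ∀ i, mapD (W.db i) P = 0) (i : Fin n) : mapD (W.d i) (P.map star) = 0 := by
  rw [map_star_eq, mapD_transpose, ← W.mapD_db_conjTranspose, hP]
  simp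

theorem WirtingerRing.D_map_star (W : WirtingerRing n R) (P : Matrix (Fin n) (Fin n) R)
    (hP : ∀ i, mapD (W.db i) P = 0) (u : Fin n → ℂ) : mapD (W.D u) (P.map star) = 0 := by
  simp only [W.mapD_D_apply, W.d_map_star P hP, smul_zero, Finset.sum_const_zero]

/-- The matrix `T(∂_p, ∂_m, η̄)`, where `∂θ_m = g(∂_m, η̄)`. -/
def torsionOf (W : WirtingerRing n R) (θ : Fin n → R) : Matrix (Fin n) (Fin n) R :=
  Matrix.of fun p m => W.d p (θ m) - W.d m (θ p)

/-- Contraction of the second index with `η̄`. -/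
def rightCon (η : Fin n → ℂ) (M : Matrix (Fin n) (Fin n) R) (m : Fin n) : R :=
  ∑ l, conj (η l) • M m l

namespace IsGauge

variable {h P : Matrix (Fin n) (Fin n) R} (hg : IsGauge W ev h P k)
include hg

theorem unit_transpose : IsUnit P.transpose.det := by
  rw [Matrix.det_transpose]; exact hg.unit_P

theorem unit_star : IsUnit (P.map star).det := by
  rw [map_star_eq, Matrix.det_transpose, Matrix.det_conjTranspose]
  exact hg.unit_P.star

theorem curvM_eq (u v : Fin n → ℂ) : curvM (W.D u) (W.Db v) k =
    P.transpose * curvM (W.D u) (W.Db v) h * P.map star := by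
  rw [hg.eq]
  refine curvM_gauge _ _ _ _ _ hg.unit_transpose hg.unit_star hg.unit_h ?_ ?_ ?_
  · rw [mapD_transpose, W.Db_map_eq_zero P hg.holo, Matrix.transpose_zero]
  · exact W.D_map_star P hg.holo u
  · rw [mapD_comm (W.D_Db u v), W.D_map_star P hg.holo u, map_zero]

theorem star_one (hev : ∀ x, ev (star x) = conj (ev x)) : ev.mapMatrix (P.map star) = 1 := by
  rw [map_star_eq, mapMatrix_transpose, mapMatrix_conjTranspose hev, hg.one]
  simp

/-- The matrix `(Pᵀ)⁻¹`. -/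
theorem inv_mul_eq : (P.transpose)⁻¹ * k = h * P.map star := by
  rw [hg.eq, mul_assoc, ← mul_assoc, Matrix.nonsing_inv_mul _ hg.unit_transpose, one_mul]

theorem ev_J : ev.mapMatrix (P.transpose)⁻¹ = 1 := by
  refine HermitianFlow.ev_inv _ hg.unit_transpose ?_
  rw [mapMatrix_transpose, hg.one, Matrix.transpose_one]

theorem Db_J (u : Fin n → ℂ) : mapD (W.Db u) (P.transpose)⁻¹ = 0 := by
  rw [mapD_inv _ _ hg.unit_transpose, mapD_transpose, W.Db_map_eq_zero P hg.holo]
  simp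

/-- Differentiate `J k = h P̄` with `J = (Pᵀ)⁻¹`. At the point `W.D u` kills `k`, and it kills the
antiholomorphic factor `P̄` identically. -/
theorem ev_D_J (hk : IsNormalAt W ev k) (u : Fin n → ℂ) :
    ev.mapMatrix (mapD (W.D u) (P.transpose)⁻¹) = ev.mapMatrix (mapD (W.D u) h) := by
  have := congrArg (fun M => ev.mapMatrix (mapD (W.D u) M)) hg.inv_mul_eq
  simpa only [mapD_mul, map_add, map_mul, hk.ev_D, hk.one, mul_zero, mul_one, add_zero,
    W.D_map_star P hg.holo, map_zero, hg.star_one hk.conj_ev] using this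

theorem ev_D_P (hk : IsNormalAt W ev k) (u : Fin n → ℂ) :
    (ev.mapMatrix (mapD (W.D u) P)).transpose = - ev.mapMatrix (mapD (W.D u) h) := by
  have := congrArg (fun M => ev.mapMatrix (mapD (W.D u) M))
    (Matrix.mul_nonsing_inv _ hg.unit_transpose)
  simp only [mapD_mul, map_add, map_mul, hg.ev_J, hg.ev_D_J hk, mapD_one, map_zero, mul_one,
    mapD_transpose, mapMatrix_transpose, hg.one, Matrix.transpose_one, one_mul] at this
  exact eq_neg_of_add_eq_zero_left this

/-- The torsion in the frame `P`, contracted with `η̄`. -/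
def _root_.HermitianFlow.frameTorsion (W : WirtingerRing n R) (P k : Matrix (Fin n) (Fin n) R)
    (η : Fin n → ℂ) : Matrix (Fin n) (Fin n) R :=
  P.transpose * torsionOf W (((P.transpose)⁻¹).mulVec (rightCon η k)) * P

omit hg in
theorem _root_.HermitianFlow.torsionOf_transpose (W : WirtingerRing n R) (θ : Fin n → R) :
    (torsionOf W θ).transpose = - torsionOf W θ := by
  ext i j
  simp [torsionOf]

omit hg in
theorem _root_.HermitianFlow.frameTorsion_transpose (W : WirtingerRing n R)
    (P k : Matrix (Fin n) (Fin n) R) (η : Fin n → ℂ) :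
    (frameTorsion W P k η).transpose = - frameTorsion W P k η := by
  simp only [frameTorsion, Matrix.transpose_mul, torsionOf_transpose, Matrix.transpose_transpose,
    Matrix.mul_assoc, Matrix.mul_neg, Matrix.neg_mul]

omit hg in
theorem _root_.HermitianFlow.derivation_rightCon (X : Derivation ℂ R R) (η : Fin n → ℂ)
    (M : Matrix (Fin n) (Fin n) R) (m : Fin n) : X (rightCon η M m) = rightCon η (mapD X M) m := by
  simp [rightCon]

omit hg in
theorem _root_.HermitianFlow.ev_rightCon (η : Fin n → ℂ)
    (M : Matrix (Fin n) (Fin n) R) (m : Fin n) :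
    ev (rightCon η M m) = ∑ l, conj (η l) * ev.mapMatrix M m l := by
  simp [rightCon]

/-- This is the first Bianchi identity with torsion. The torsion is the antisymmetrised first
derivative of the metric, `J` is holomorphic, and `∂∂̄k = -Ω`; hence its `∂̄`-derivative is minus
the antisymmetrised curvature. -/
theorem ev_Db_torsionOf (hk : IsNormalAt W ev k) (ξ η : Fin n → ℂ) (B : Matrix (Fin n) (Fin n) ℂ)
    (hB : ∀ p m, B p m = ∑ l, conj (η l) * curvAt W ev k (basisVec p) ξ m l) :
    ev.mapMatrix (mapD (W.Db ξ) (torsionOf W (((P.transpose)⁻¹).mulVec (rightCon η k)))) =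
      - (B - B.transpose) := by
  have key : ∀ p m, ev (W.Db ξ (W.d p (((P.transpose)⁻¹).mulVec (rightCon η k) m))) =
      - B p m := by
    intro p m
    have hJ : ∀ a, W.Db ξ ((P.transpose)⁻¹ m a) = 0 := fun a => congrFun (congrFun (hg.Db_J ξ) m) a
    have hJ1 : ∀ a, ev ((P.transpose)⁻¹ m a) = (1 : Matrix (Fin n) (Fin n) ℂ) m a :=
      fun a => congrFun (congrFun hg.ev_J m) a
    rw [← W.d_Db, ← W.D_single]
    simp only [Matrix.mulVec, dotProduct, map_sum, Derivation.leibniz, smul_eq_mul, hJ, mul_zero,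
      add_zero, map_add, map_mul, derivation_rightCon, ev_rightCon, hk.ev_Db, hk.ev_DDb,
      Matrix.zero_apply, Finset.sum_const_zero, zero_mul, hJ1]
    simp [Matrix.one_apply, hB]
  ext p m
  simp only [AlgHom.mapMatrix_apply, Matrix.map_apply, mapD_apply, torsionOf, Matrix.of_apply,
    map_sub, key, Matrix.neg_apply, Matrix.sub_apply, Matrix.transpose_apply]
  ring

/-- Of the three derivatives, `∂̄_ξ` must fall on `k`, since `J` is holomorphic. If `∂_ξ` falls on
`J`, the term with `B` arises; if `∂_p` does, the term `N`, which carries a factor `Ω(ξ,ξ̄,·,η̄)`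
and is therefore harmless at a null pair; if none does, the third derivatives `K`. -/
theorem ev_D_Db_torsionOf (hk : IsNormalAt W ev k) (ξ η : Fin n → ℂ)
    (B N K : Matrix (Fin n) (Fin n) ℂ)
    (hB : ∀ p m, B p m = ∑ l, conj (η l) * curvAt W ev k (basisVec p) ξ m l)
    (hN : ∀ p m, N p m = ∑ a, ev.mapMatrix (mapD (W.d p) h) m a *
      ∑ l, conj (η l) * curvAt W ev k ξ ξ a l)
    (hK : ∀ p m, K p m = ∑ l, conj (η l) *
      ev.mapMatrix (mapD (W.d p) (mapD (W.D ξ) (mapD (W.Db ξ) k))) m l) :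
    ev.mapMatrix (mapD (W.D ξ) (mapD (W.Db ξ)
      (torsionOf W (((P.transpose)⁻¹).mulVec (rightCon η k))))) =
      (- (B * (ev.mapMatrix (mapD (W.D ξ) h)).transpose) - N + K)
      - (- (B * (ev.mapMatrix (mapD (W.D ξ) h)).transpose) - N + K).transpose := by
  have key : ∀ p m, ev (W.D ξ (W.Db ξ (W.d p (((P.transpose)⁻¹).mulVec (rightCon η k) m)))) =
      (- (B * (ev.mapMatrix (mapD (W.D ξ) h)).transpose) - N + K) p m := by
    intro p m
    have hJ : ∀ a, W.Db ξ ((P.transpose)⁻¹ m a) = 0 := fun a => congrFun (congrFun (hg.Db_J ξ) m) a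
    have hJ1 : ∀ a, ev ((P.transpose)⁻¹ m a) = (1 : Matrix (Fin n) (Fin n) ℂ) m a :=
      fun a => congrFun (congrFun hg.ev_J m) a
    have hJ2 : ∀ u a, ev (W.D u ((P.transpose)⁻¹ m a)) = ev.mapMatrix (mapD (W.D u) h) m a :=
      fun u a => congrFun (congrFun (hg.ev_D_J hk u) m) a
    rw [← W.d_Db, ← W.d_D, ← W.D_single]
    simp only [Matrix.mulVec, dotProduct, map_sum, Derivation.leibniz, smul_eq_mul, hJ, mul_zero,
      add_zero, map_add, map_mul, derivation_rightCon, ev_rightCon, hk.ev_Db, hk.ev_DDb,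
      Matrix.zero_apply, Finset.sum_const_zero, zero_mul, hJ1, hJ2]
    simp only [Matrix.neg_apply, Matrix.add_apply, Matrix.sub_apply, hN, hK, Matrix.mul_apply, hB,
      Matrix.transpose_apply, Finset.sum_add_distrib, mul_neg, neg_mul, Finset.sum_neg_distrib]
    rw [W.D_single]
    simp only [Matrix.one_apply, ite_mul, one_mul, zero_mul, Finset.sum_ite_eq, Finset.mem_univ,
      if_true]
    simp only [mul_comm (∑ l, conj (η l) * curvAt W ev k (basisVec p) ξ _ l),
      mul_comm (ev.mapMatrix (mapD (W.d p) h) _ _), Finset.sum_const_zero, add_zero]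
    ring
  ext p m
  simp only [AlgHom.mapMatrix_apply, Matrix.map_apply, mapD_apply, torsionOf, Matrix.of_apply,
    map_sub, key, Matrix.sub_apply, Matrix.transpose_apply]

theorem ev_frameTorsion :
    ev.mapMatrix (frameTorsion W P k η) =
      ev.mapMatrix (torsionOf W (((P.transpose)⁻¹).mulVec (rightCon η k))) := by
  rw [frameTorsion, map_mul, map_mul, mapMatrix_transpose, hg.one, Matrix.transpose_one, one_mul,
    mul_one]

theorem ev_Db_frameTorsion (hk : IsNormalAt W ev k) (ξ η : Fin n → ℂ)
    (B : Matrix (Fin n) (Fin n) ℂ)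
    (hB : ∀ p m, B p m = ∑ l, conj (η l) * curvAt W ev k (basisVec p) ξ m l) :
    ev.mapMatrix (mapD (W.Db ξ) (frameTorsion W P k η)) = - (B - B.transpose) := by
  simp only [frameTorsion, mapD_mul, mapD_transpose, W.Db_map_eq_zero P hg.holo,
    Matrix.transpose_zero, zero_mul, mul_zero, zero_add, add_zero, map_mul, mapMatrix_transpose,
    hg.one, Matrix.transpose_one, one_mul, mul_one]
  exact hg.ev_Db_torsionOf hk ξ η B hB

/-- With `Γ` the `ξ`-derivative of `h`, the derivatives of the two frame factors `Pᵀ` and `P` add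
`Γ(B - Bᵀ) + (B - Bᵀ)Γᵀ`. After antisymmetrisation this changes `-BΓᵀ` into `ΓB`, where the
direction index of the curvature is contracted with a row of `Γ`. That is the form matching the
variation of `Ξ`. -/
theorem ev_D_Db_frameTorsion (hk : IsNormalAt W ev k) (ξ η : Fin n → ℂ)
    (B N K : Matrix (Fin n) (Fin n) ℂ)
    (hB : ∀ p m, B p m = ∑ l, conj (η l) * curvAt W ev k (basisVec p) ξ m l)
    (hN : ∀ p m, N p m = ∑ a, ev.mapMatrix (mapD (W.d p) h) m a *
      ∑ l, conj (η l) * curvAt W ev k ξ ξ a l)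
    (hK : ∀ p m, K p m = ∑ l, conj (η l) *
      ev.mapMatrix (mapD (W.d p) (mapD (W.D ξ) (mapD (W.Db ξ) k))) m l) :
    ev.mapMatrix (mapD (W.D ξ) (mapD (W.Db ξ) (frameTorsion W P k η))) =
      (ev.mapMatrix (mapD (W.D ξ) h) * B - N + K)
      - (ev.mapMatrix (mapD (W.D ξ) h) * B - N + K).transpose := by
  have e1 : (ev.mapMatrix (mapD (W.D ξ) P)) = - (ev.mapMatrix (mapD (W.D ξ) h)).transpose := by
    rw [← Matrix.transpose_neg, ← hg.ev_D_P hk, Matrix.transpose_transpose]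
  simp only [frameTorsion, mapD_mul, mapD_transpose, W.Db_map_eq_zero P hg.holo,
    Matrix.transpose_zero, zero_mul, mul_zero, zero_add, add_zero, map_mul, mapMatrix_transpose,
    hg.one, Matrix.transpose_one, one_mul, mul_one, map_add, hg.ev_D_P hk, e1,
    hg.ev_Db_torsionOf hk ξ η B hB, hg.ev_D_Db_torsionOf hk ξ η B N K hB hN hK]
  simp only [Matrix.transpose_add, Matrix.transpose_sub, Matrix.transpose_neg,
    Matrix.transpose_mul, Matrix.transpose_transpose]
  noncomm_ring

end IsGauge

end TorsionTrace

/-! ### The second derivatives of the quadratic torsion term -/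

section TorsionTraceDeriv

variable {n : ℕ} {R : Type*} [CommRing R] [StarRing R] [Algebra ℂ R] [StarModule ℂ R]
  {W : WirtingerRing n R} {ev : R →ₐ[ℂ] ℂ} {k h P : Matrix (Fin n) (Fin n) R}

theorem trace_mul_conjTranspose_eq (M N : Matrix (Fin n) (Fin n) ℂ) :
    (M * N.conjTranspose).trace = ∑ p, ∑ q, M p q * conj (N p q) := by
  simp [Matrix.trace, Matrix.mul_apply]

/-- Against an antisymmetric matrix the two halves of `U - Uᵀ` contribute equally. The factor two
compensates the `½` in the definition of `Q`. -/
theorem trace_antisymm (U s : Matrix (Fin n) (Fin n) ℂ) (hs : s.transpose = - s) :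
    ((U - U.transpose) * s.conjTranspose).trace = 2 * ∑ p, ∑ q, U p q * conj (s p q) := by
  have h1 : ∀ p q, s q p = - s p q := fun p q => congrFun (congrFun hs p) q
  rw [trace_mul_conjTranspose_eq]
  simp only [Matrix.sub_apply, Matrix.transpose_apply, sub_mul, Finset.sum_sub_distrib]
  have e : ∑ p, ∑ q, U q p * conj (s p q) = - ∑ p, ∑ q, U p q * conj (s p q) := by
    rw [Finset.sum_comm, ← Finset.sum_neg_distrib]
    refine Finset.sum_congr rfl fun p _ => ?_
    rw [← Finset.sum_neg_distrib]
    refine Finset.sum_congr rfl fun q _ => ?_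
    rw [h1 p q, map_neg, mul_neg]
  rw [e]
  ring

theorem con_eq_sum_rightCon (b η : Fin n → ℂ) (M : Matrix (Fin n) (Fin n) ℂ) :
    con b η M = ∑ m, b m * ∑ l, conj (η l) * M m l := by
  simp only [con_apply, smul_eq_mul, Finset.mul_sum, mul_assoc]

/-- The square of the torsion, contracted with `η, η̄`. -/
def torsionTrace (W : WirtingerRing n R) (P k : Matrix (Fin n) (Fin n) R) (η : Fin n → ℂ) : R :=
  (1 / 2 : ℂ) • (k⁻¹ * frameTorsion W P k η * k⁻¹.transpose *
    (frameTorsion W P k η).conjTranspose).trace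

/-- Here the torsion `s` enters only through the vectors `b m`, and the terms in the sum over `m`
are precisely those produced by the variations `∂_mΞ = a m` and `∂̄_m H = b m` in the Laplacian of
`Ω(Ξ,H)`. The `∂̄`-derivative of the torsion contributes the square of `B - Bᵀ` by the Bianchi
identity, its `∂`-derivative a further square, and the derivative of the frame the terms with `N`.
-/
theorem IsGauge.torsionTrace_deriv (hg : IsGauge W ev h P k) (hk : IsNormalAt W ev k)
    (ξ η : Fin n → ℂ) (B N s : Matrix (Fin n) (Fin n) ℂ) (a b : Fin n → Fin n → ℂ)
    (hB : ∀ p m, B p m = ∑ l, conj (η l) * curvAt W ev k (basisVec p) ξ m l)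
    (hN : ∀ p m, N p m = ∑ a, ev.mapMatrix (mapD (W.d p) h) m a *
      ∑ l, conj (η l) * curvAt W ev k ξ ξ a l)
    (hs : s = ev.mapMatrix (frameTorsion W P k η))
    (ha : ∀ m i, a m i = - ev.mapMatrix (mapD (W.D ξ) h) m i)
    (hb : ∀ m i, b m i = - conj (s m i)) :
    ev (W.D ξ (W.Db ξ (torsionTrace W P k η))) =
      ∑ m, (con (b m) η (curvAt W ev k (a m) ξ) + con η (b m) (curvAt W ev k ξ (a m))
        - con (b m) η (ev.mapMatrix (mapD (W.d m) (mapD (W.D ξ) (mapD (W.Db ξ) k))))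
        - con η (b m) (ev.mapMatrix (mapD (W.db m) (mapD (W.D ξ) (mapD (W.Db ξ) k))))
        + con (b m) (b m) (curvAt W ev k ξ ξ))
      + (1 / 2) * ∑ p, ∑ q, (B p q - B q p) * conj (B p q - B q p)
      + (1 / 2) * ∑ p, ∑ q, ev.mapMatrix (mapD (W.D ξ) (frameTorsion W P k η)) p q *
          conj (ev.mapMatrix (mapD (W.D ξ) (frameTorsion W P k η)) p q)
      - ∑ p, ∑ q, N p q * conj (s p q) - conj (∑ p, ∑ q, N p q * conj (s p q)) := by
  set K : Matrix (Fin n) (Fin n) ℂ := Matrix.of fun p m => ∑ l, conj (η l) *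
      ev.mapMatrix (mapD (W.d p) (mapD (W.D ξ) (mapD (W.Db ξ) k))) m l with hK
  set U := ev.mapMatrix (mapD (W.D ξ) h) * B - N + K with hU
  have hsT : s.transpose = - s := by
    rw [hs, ← mapMatrix_transpose, frameTorsion_transpose, map_neg]
  have hsT' : ∀ p q, s q p = - s p q := fun p q => congrFun (congrFun hsT p) q
  have h2 := hg.ev_D_Db_frameTorsion hk ξ η B N K hB hN (fun p m => rfl)
  rw [← hU] at h2
  have h1 := hg.ev_Db_frameTorsion hk ξ η B hB
  have t1 : (curvAt W ev k ξ ξ * s * s.conjTranspose).trace =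
      ∑ m, con (b m) (b m) (curvAt W ev k ξ ξ) := by
    simp only [trace_mul_conjTranspose_eq, Matrix.mul_apply, con_apply, hb, map_neg,
      Complex.conj_conj, smul_eq_mul, Finset.sum_mul]
    rw [Finset.sum_comm]
    refine Finset.sum_congr rfl fun m _ => Finset.sum_congr rfl fun i _ =>
      Finset.sum_congr rfl fun l _ => ?_
    rw [hsT' m l, hsT' m i, map_neg]
    ring
  -- By antisymmetry of `s` both of its indices give the same curvature term, so the two copies and
  -- the `½` leave exactly one.
  have t2 : (s * (curvAt W ev k ξ ξ).transpose * s.conjTranspose).trace =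
      ∑ m, con (b m) (b m) (curvAt W ev k ξ ξ) := by
    simp only [trace_mul_conjTranspose_eq, Matrix.mul_apply, con_apply, hb, map_neg,
      Complex.conj_conj, smul_eq_mul, Finset.sum_mul, Matrix.transpose_apply]
    refine Finset.sum_congr rfl fun m _ => Finset.sum_congr rfl fun i _ =>
      Finset.sum_congr rfl fun l _ => ?_
    ring
  have t3 : ∑ p, ∑ q, U p q * conj (s p q) =
      ∑ m, (con (b m) η (curvAt W ev k (a m) ξ) -
        con (b m) η (ev.mapMatrix (mapD (W.d m) (mapD (W.D ξ) (mapD (W.Db ξ) k)))))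
      - ∑ p, ∑ q, N p q * conj (s p q) := by
    rw [← Finset.sum_sub_distrib]
    refine Finset.sum_congr rfl fun p _ => ?_
    have e1 : ∀ q, (ev.mapMatrix (mapD (W.D ξ) h) * B) p q =
        - ∑ l, conj (η l) * curvAt W ev k (a p) ξ q l := by
      intro q
      conv_rhs => rw [eq_sum_single (a p)]
      simp only [curvAt_sum_left, Matrix.mul_apply, Matrix.sum_apply, Matrix.smul_apply,
        smul_eq_mul, hB, Finset.mul_sum]
      rw [Finset.sum_comm, ← Finset.sum_neg_distrib]
      refine Finset.sum_congr rfl fun l _ => ?_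
      rw [← Finset.sum_neg_distrib]
      refine Finset.sum_congr rfl fun i _ => ?_
      rw [ha]
      ring
    rw [con_eq_sum_rightCon, con_eq_sum_rightCon, ← Finset.sum_sub_distrib,
      ← Finset.sum_sub_distrib]
    refine Finset.sum_congr rfl fun q _ => ?_
    rw [hU, Matrix.add_apply, Matrix.sub_apply, e1 q, hK, Matrix.of_apply, hb]
    ring
  have t4 : (s * (U - U.transpose).conjTranspose).trace =
      2 * conj (∑ p, ∑ q, U p q * conj (s p q)) := by
    have := congrArg conj (trace_antisymm U s hsT)
    rw [map_mul, Complex.conj_ofNat] at this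
    rw [← this, ← RCLike.star_def, ← Matrix.trace_conjTranspose, Matrix.conjTranspose_mul,
      Matrix.conjTranspose_conjTranspose]
  have t5 : conj (∑ p, ∑ q, U p q * conj (s p q)) =
      ∑ m, (con η (b m) (curvAt W ev k ξ (a m)) -
        con η (b m) (ev.mapMatrix (mapD (W.db m) (mapD (W.D ξ) (mapD (W.Db ξ) k)))))
      - conj (∑ p, ∑ q, N p q * conj (s p q)) := by
    rw [t3, map_sub, map_sum]
    congr 1
    refine Finset.sum_congr rfl fun m _ => ?_
    rw [map_sub, conj_con, conj_con, hk.curvAt_conjTranspose,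
      ← mapMatrix_conjTranspose hk.conj_ev, W.mapD_d_conjTranspose, W.mapD_D_conjTranspose,
      W.mapD_Db_conjTranspose, hk.herm, mapD_comm (W.D_Db ξ ξ)]
  have t6 : (-(B - B.transpose) * (-(B - B.transpose)).conjTranspose).trace =
      ∑ p, ∑ q, (B p q - B q p) * conj (B p q - B q p) := by
    rw [trace_mul_conjTranspose_eq]
    refine Finset.sum_congr rfl fun p _ => Finset.sum_congr rfl fun q _ => ?_
    rw [Matrix.neg_apply, Matrix.sub_apply, Matrix.transpose_apply, map_neg, neg_mul_neg]
  rw [torsionTrace, Derivation.map_smul, Derivation.map_smul, map_smul, hk.trace_deriv, ← hs, h2,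
    h1, t1, t2, t4, trace_antisymm U s hsT, t5, t3, t6, trace_mul_conjTranspose_eq, smul_eq_mul]
  simp only [Finset.sum_add_distrib, Finset.sum_sub_distrib]
  ring

end TorsionTraceDeriv

/-! ### The flow equation in a normal frame -/

section EvolutionIdentity

variable {n : ℕ} {R : Type*} [CommRing R] [StarRing R] [Algebra ℂ R] [StarModule ℂ R]
  {W : WirtingerRing n R} {ev : R →ₐ[ℂ] ℂ} {k h P : Matrix (Fin n) (Fin n) R}

/-- The matrix of the second Chern-Ricci curvature. -/
def secondRicciM (W : WirtingerRing n R) (h : Matrix (Fin n) (Fin n) R) :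
    Matrix (Fin n) (Fin n) R :=
  ∑ m, ∑ r, h⁻¹ r m • curvM (W.d m) (W.db r) h

/-- The torsion `T_{pm j̄}`. -/
def torsionM (W : WirtingerRing n R) (h : Matrix (Fin n) (Fin n) R) (p m j : Fin n) : R :=
  W.d p (h m j) - W.d m (h p j)

/-- The matrix of the quadratic torsion term of the flow. -/
def torsionQuadM (W : WirtingerRing n R) (h : Matrix (Fin n) (Fin n) R) :
    Matrix (Fin n) (Fin n) R :=
  Matrix.of fun i j => (1 / 2 : ℂ) • ∑ m, ∑ r, ∑ p, ∑ s, h⁻¹ r m * h⁻¹ s p *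
    torsionM W h p m j * star (torsionM W h s r i)

/-- The change of frame acts only on the last two indices of the curvature. The trace over the first
two stays in the coordinate frame, so `h⁻¹` appears together with the curvature of `k`. -/
theorem IsGauge.con_secondRicciM (hg : IsGauge W ev h P k) (η : Fin n → ℂ) :
    con η η (P.transpose * secondRicciM W h * P.map star) = ricciTrace W h⁻¹ k η := by
  have h1 : ∀ m r, P.transpose * (h⁻¹ r m • curvM (W.d m) (W.db r) h) * P.map star =
      h⁻¹ r m • curvM (W.d m) (W.db r) k := by
    intro m r
    have := hg.curvM_eq (basisVec m) (basisVec r)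
    rw [W.D_single, W.Db_single] at this
    rw [this, Matrix.mul_smul, Matrix.smul_mul]
  have h2 : ∀ m r, con η η (h⁻¹ r m • curvM (W.d m) (W.db r) k) =
      h⁻¹ r m * con η η (curvM (W.d m) (W.db r) k) := by
    intro m r
    simp only [con_apply, Matrix.smul_apply, smul_eq_mul, Finset.mul_sum, mul_smul_comm]
  simp only [secondRicciM, ricciTrace, Finset.mul_sum, Finset.sum_mul, h1, map_sum, h2]

theorem con_mul_mul_map_star (η : Fin n → ℂ) (M : Matrix (Fin n) (Fin n) R) :
    con η η (P.transpose * M * P.map star) =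
      ∑ i, ∑ j, (∑ k, η k • P i k) * M i j * star (∑ l, η l • P j l) := by
  simp only [con_apply, Matrix.mul_apply, Finset.sum_mul, Finset.mul_sum, star_sum, star_smul,
    Matrix.transpose_apply, Matrix.map_apply, Finset.smul_sum]
  have e1 : ∀ k l j i, (η k * conj (η l)) • (P i k * M i j * star (P j l)) =
      η k • P i k * M i j * star (η l) • star (P j l) := by
    intro k l j i
    rw [RCLike.star_def, mul_smul, smul_mul_assoc, smul_mul_assoc, mul_smul_comm]
  simp only [e1]
  calc _ = ∑ k, ∑ j, ∑ l, ∑ i, η k • P i k * M i j * star (η l) • star (P j l) :=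
        Finset.sum_congr rfl fun k _ => Finset.sum_comm
    _ = ∑ k, ∑ j, ∑ i, ∑ l, η k • P i k * M i j * star (η l) • star (P j l) :=
        Finset.sum_congr rfl fun k _ => Finset.sum_congr rfl fun j _ => Finset.sum_comm
    _ = ∑ k, ∑ i, ∑ j, ∑ l, η k • P i k * M i j * star (η l) • star (P j l) :=
        Finset.sum_congr rfl fun k _ => Finset.sum_comm
    _ = ∑ i, ∑ k, ∑ j, ∑ l, η k • P i k * M i j * star (η l) • star (P j l) := Finset.sum_comm
    _ = ∑ i, ∑ j, ∑ k, ∑ l, η k • P i k * M i j * star (η l) • star (P j l) :=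
        Finset.sum_congr rfl fun i _ => Finset.sum_comm
    _ = ∑ i, ∑ j, ∑ l, ∑ k, η k • P i k * M i j * star (η l) • star (P j l) :=
        Finset.sum_congr rfl fun i _ => Finset.sum_congr rfl fun j _ => Finset.sum_comm

theorem sum_sum_comm_sum (G : Fin n → Fin n → Fin n → R) :
    ∑ i, ∑ j, ∑ m, G i j m = ∑ m, ∑ i, ∑ j, G i j m := by
  rw [Finset.sum_congr rfl fun i _ => Finset.sum_comm, Finset.sum_comm]

theorem trace_quad_eq (g τ : Matrix (Fin n) (Fin n) R) :
    (g * τ * g.transpose * τ.conjTranspose).trace =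
      ∑ m, ∑ r, ∑ p, ∑ s, g r m * g s p * τ p m * star (τ s r) := by
  simp only [Matrix.trace, Matrix.diag, Matrix.mul_apply, Finset.sum_mul,
    Matrix.transpose_apply, Matrix.conjTranspose_apply]
  calc _ = ∑ s, ∑ m, ∑ r, ∑ p, g s p * τ p m * g r m * star (τ s r) :=
        Finset.sum_congr rfl fun s _ => Finset.sum_comm
    _ = ∑ m, ∑ s, ∑ r, ∑ p, g s p * τ p m * g r m * star (τ s r) := Finset.sum_comm
    _ = ∑ m, ∑ r, ∑ s, ∑ p, g s p * τ p m * g r m * star (τ s r) :=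
        Finset.sum_congr rfl fun m _ => Finset.sum_comm
    _ = ∑ m, ∑ r, ∑ p, ∑ s, g s p * τ p m * g r m * star (τ s r) :=
        Finset.sum_congr rfl fun m _ => Finset.sum_congr rfl fun r _ => Finset.sum_comm
    _ = _ := Finset.sum_congr rfl fun m _ => Finset.sum_congr rfl fun r _ =>
        Finset.sum_congr rfl fun p _ => Finset.sum_congr rfl fun s _ => by ring

/-- The potential `(Pᵀ)⁻¹ k η̄` equals `h P̄ η̄`, and `P̄ η̄` is annihilated by every `∂_p`. So the
antisymmetrised derivative falls on `h` alone. -/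
theorem IsGauge.torsionOf_eq (hg : IsGauge W ev h P k) (η : Fin n → ℂ) (p m : Fin n) :
    torsionOf W (((P.transpose)⁻¹).mulVec (rightCon η k)) p m =
      ∑ j, torsionM W h p m j * star (∑ l, η l • P j l) := by
  have hY : ∀ p j, W.d p (star (∑ l, η l • P j l)) = 0 := by
    intro p j
    have h1 : ∀ l, W.db p (P j l) = 0 := fun l => congrFun (congrFun (hg.holo p) j) l
    rw [← W.star_db, map_sum]
    simp [h1]
  have hθ : ∀ m, ((P.transpose)⁻¹).mulVec (rightCon η k) m =
      ∑ j, h m j * star (∑ l, η l • P j l) := by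
    intro m
    have e : ∀ l, ((P.transpose)⁻¹ * k) m l = (h * P.map star) m l := by
      intro l; rw [hg.inv_mul_eq]
    simp only [Matrix.mul_apply, Matrix.map_apply] at e
    simp only [Matrix.mulVec, dotProduct, rightCon, Finset.mul_sum, star_sum, star_smul,
      mul_smul_comm]
    rw [Finset.sum_comm, Finset.sum_comm (γ := Fin n) (s := Finset.univ) (t := Finset.univ)
      (f := fun j l => star (η l) • (h m j * star (P j l)))]
    refine Finset.sum_congr rfl fun l _ => ?_
    rw [← Finset.smul_sum, ← Finset.smul_sum, e l, RCLike.star_def]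
  simp only [torsionOf, Matrix.of_apply, hθ, map_sum, Derivation.leibniz, hY, smul_eq_mul, mul_zero,
    zero_add, torsionM, sub_mul, Finset.sum_sub_distrib]
  simp only [mul_comm]

theorem mul_torsionQuadM_mul (W : WirtingerRing n R) (h : Matrix (Fin n) (Fin n) R)
    (Y : Fin n → R) (i j : Fin n) :
    Y i * torsionQuadM W h i j * star (Y j) = (1 / 2 : ℂ) • ∑ m, ∑ r, ∑ p, ∑ s,
      h⁻¹ r m * h⁻¹ s p * (torsionM W h p m j * star (Y j)) *
        star (torsionM W h s r i * star (Y i)) := by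
  simp only [torsionQuadM, Matrix.of_apply, mul_smul_comm, smul_mul_assoc, Finset.mul_sum,
    Finset.sum_mul, star_mul', star_star]
  have aux : ∀ a b c d e f : R, e * (a * b * c * d) * f = a * b * (c * f) * (d * e) := by
    intros; ring
  refine congrArg (fun x => (1 / 2 : ℂ) • x) ?_
  exact Finset.sum_congr rfl fun m _ => Finset.sum_congr rfl fun r _ =>
    Finset.sum_congr rfl fun p _ => Finset.sum_congr rfl fun s _ => aux _ _ _ _ _ _

/-- Unlike for the Ricci term, the traced indices here are also moved to the frame `P`: with `h⁻¹ =
P̄ k⁻¹ Pᵀ`, cyclicity of the trace turns the coordinate expression into that of `frameTorsion`. The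
inverse of the normal metric `k` has simpler jets than `h⁻¹`. -/
theorem IsGauge.con_torsionQuadM (hg : IsGauge W ev h P k) (η : Fin n → ℂ) :
    con η η (P.transpose * torsionQuadM W h * P.map star) = torsionTrace W P k η := by
  set τ := torsionOf W (((P.transpose)⁻¹).mulVec (rightCon η k)) with hτ
  have hinv : h⁻¹ = P.map star * k⁻¹ * P.transpose := by
    have h1 : (P.map star)⁻¹ * h⁻¹ * (P.transpose)⁻¹ = k⁻¹ := by
      rw [hg.eq, Matrix.mul_inv_rev, Matrix.mul_inv_rev, mul_assoc]
    rw [← h1, ← mul_assoc, ← mul_assoc, Matrix.mul_nonsing_inv _ hg.unit_star, one_mul, mul_assoc,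
      Matrix.nonsing_inv_mul _ hg.unit_transpose, mul_one]
  have e1 : torsionTrace W P k η = (1 / 2 : ℂ) • (h⁻¹ * τ * h⁻¹.transpose * τ.conjTranspose).trace := by
    rw [torsionTrace, hinv, frameTorsion, ← hτ]
    have e2 : P.map star * k⁻¹ * P.transpose * τ * (P.map star * k⁻¹ * P.transpose).transpose *
        τ.conjTranspose = P.map star * (k⁻¹ * P.transpose * τ * P * k⁻¹.transpose *
          P.conjTranspose * τ.conjTranspose) := by
      simp only [Matrix.transpose_mul, Matrix.transpose_transpose, Matrix.mul_assoc]
      rfl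
    rw [e2, Matrix.trace_mul_comm (P.map star)]
    simp only [Matrix.conjTranspose_mul, Matrix.mul_assoc]
    rfl
  rw [e1, trace_quad_eq, con_mul_mul_map_star]
  have e3 : ∀ m r p s, h⁻¹ r m * h⁻¹ s p * τ p m * star (τ s r) = ∑ i, ∑ j,
      h⁻¹ r m * h⁻¹ s p * (torsionM W h p m j * star (∑ l, η l • P j l)) *
        star (torsionM W h s r i * star (∑ l, η l • P i l)) := by
    intro m r p s
    rw [hτ, hg.torsionOf_eq, hg.torsionOf_eq, star_sum, mul_assoc, Finset.sum_mul_sum,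
      Finset.mul_sum, Finset.sum_comm]
    refine Finset.sum_congr rfl fun i _ => ?_
    rw [Finset.mul_sum]
    refine Finset.sum_congr rfl fun j _ => ?_
    simp only [mul_assoc]
  simp only [e3]
  refine (Finset.sum_congr rfl fun i _ => Finset.sum_congr rfl fun j _ =>
    mul_torsionQuadM_mul W h (fun i => ∑ l, η l • P i l) i j).trans ?_
  simp only [← Finset.smul_sum]
  refine congrArg (fun x => (1 / 2 : ℂ) • x) ?_
  rw [sum_sum_comm_sum]
  refine Finset.sum_congr rfl fun m _ => ?_
  rw [sum_sum_comm_sum]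
  refine Finset.sum_congr rfl fun r _ => ?_
  rw [sum_sum_comm_sum]
  refine Finset.sum_congr rfl fun p _ => ?_
  rw [sum_sum_comm_sum]

/-- The evolution of the curvature in a normal frame, before the commutation of derivatives. -/
theorem IsGauge.ev_dt_curvature (hg : IsGauge W ev h P k) (hk : IsNormalAt W ev k)
    (hflow : mapD W.dt h = - secondRicciM W h - torsionQuadM W h) (hP : mapD W.dt P = 0)
    (hPs : mapD W.dt (P.map star) = 0) (ξ η : Fin n → ℂ) :
    ev (W.dt (con η η (curvM (W.D ξ) (W.Db ξ) k))) =
      ev (W.D ξ (W.Db ξ (ricciTrace W h⁻¹ k η))) + ev (W.D ξ (W.Db ξ (torsionTrace W P k η))) := by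
  have e1 : mapD W.dt k = - (P.transpose * secondRicciM W h * P.map star)
      - P.transpose * torsionQuadM W h * P.map star := by
    rw [hg.eq, mapD_mul, mapD_mul, mapD_transpose, hP, hPs, hflow, Matrix.transpose_zero]
    noncomm_ring
  have e2 : mapD W.dt (mapD (W.D ξ) (mapD (W.Db ξ) k)) =
      mapD (W.D ξ) (mapD (W.Db ξ) (mapD W.dt k)) := by
    rw [mapD_comm (W.dt_D ξ), mapD_comm (W.dt_Db ξ)]
  rw [derivation_con, ev_con, hk.ev_deriv_curvM, e2, e1, ← hg.con_secondRicciM,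
    ← hg.con_torsionQuadM]
  simp only [derivation_con, ev_con, map_sub, map_neg]
  ring

end EvolutionIdentity

/-! ### The Laplacian of the test function and the evolution formula -/

section TestFunction

variable {n : ℕ} {R : Type*} [CommRing R] [StarRing R] [Algebra ℂ R] [StarModule ℂ R]
  {W : WirtingerRing n R} {ev : R →ₐ[ℂ] ℂ} {k h P : Matrix (Fin n) (Fin n) R}

/-- The function `Ω(Ξ, Ξ̄, H, H̄)` for fields `Ξ, H` of vectors. -/
def curvFn (W : WirtingerRing n R) (k : Matrix (Fin n) (Fin n) R) (Ξ H : Fin n → R) : R :=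
  ∑ i, ∑ j, ∑ c, ∑ d, curvM (W.d i) (W.db j) k c d * Ξ i * star (Ξ j) * H c * star (H d)

theorem curvM_D_Db (W : WirtingerRing n R) (k : Matrix (Fin n) (Fin n) R) (u v : Fin n → ℂ) :
    curvM (W.D u) (W.Db v) k =
      ∑ i, ∑ j, (u i * conj (v j)) • curvM (W.d i) (W.db j) k := by
  have h1 : ∀ X : Derivation ℂ R R, curvM X (W.Db v) k = ∑ j, conj (v j) • curvM X (W.db j) k := by
    intro X
    simp only [curvM, W.mapD_Db_apply, map_sum, map_smul, Finset.mul_sum, mul_smul_comm, smul_add,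
      Finset.sum_add_distrib, smul_neg, Finset.sum_neg_distrib]
  simp only [h1]
  rw [Finset.sum_comm]
  refine Finset.sum_congr rfl fun j _ => ?_
  simp only [curvM, W.mapD_D_apply, Finset.sum_mul, smul_mul_assoc, mul_smul, smul_add,
    Finset.sum_add_distrib, smul_neg, Finset.sum_neg_distrib, Finset.smul_sum, smul_comm (conj (v j))]

/-- The form `∑ T_{i j̄ c d̄} u^i v̄^j w^c y̅^d`. -/
def quadForm (T : Fin n → Fin n → Fin n → Fin n → ℂ) (u v w y : Fin n → ℂ) : ℂ :=
  ∑ i, ∑ j, ∑ c, ∑ d, T i j c d * u i * conj (v j) * w c * conj (y d)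

theorem con_map_curvM (φ : R →ₗ[ℂ] ℂ) (u v w y : Fin n → ℂ) :
    con w y ((curvM (W.D u) (W.Db v) k).map φ) =
      quadForm (fun i j c d => φ (curvM (W.d i) (W.db j) k c d)) u v w y := by
  rw [curvM_D_Db, con_apply, quadForm]
  simp only [Matrix.map_apply, Matrix.sum_apply, Matrix.smul_apply, map_sum, map_smul, smul_eq_mul,
    Finset.mul_sum]
  symm
  rw [sum_sum_comm_sum]
  refine Finset.sum_congr rfl fun c _ => ?_
  rw [sum_sum_comm_sum]
  refine Finset.sum_congr rfl fun d _ => Finset.sum_congr rfl fun i _ =>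
    Finset.sum_congr rfl fun j _ => ?_
  ring

/-- `X` kills `x'` and `y`, `Y` kills `x` and `y'`, and the other first derivatives are constants.
Nine Leibniz terms survive. -/
theorem ev_deriv_deriv_mul (X Y : Derivation ℂ R R) (f x x' y y' : R) (a a' b b' : ℂ)
    (hXx : X x = algebraMap ℂ R a) (hYx : Y x = 0) (hXx' : X x' = 0)
    (hYx' : Y x' = algebraMap ℂ R a') (hXy : X y = 0) (hYy : Y y = algebraMap ℂ R b)
    (hXy' : X y' = algebraMap ℂ R b') (hYy' : Y y' = 0) :
    ev (X (Y (f * x * x' * y * y'))) =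
      ev (X (Y f)) * ev x * ev x' * ev y * ev y' + ev (X f) * ev x * a' * ev y * ev y'
      + ev (X f) * ev x * ev x' * b * ev y' + ev (Y f) * a * ev x' * ev y * ev y'
      + ev (Y f) * ev x * ev x' * ev y * b' + ev f * a * a' * ev y * ev y'
      + ev f * a * ev x' * b * ev y' + ev f * ev x * a' * ev y * b'
      + ev f * ev x * ev x' * b * b' := by
  simp only [Derivation.leibniz, smul_eq_mul, hXx, hYx, hXx', hYx', hXy, hYy, hXy', hYy', map_add,
    map_mul, map_zero, mul_zero, zero_mul, add_zero, zero_add, Derivation.map_algebraMap,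
    AlgHom.commutes, Algebra.algebraMap_self, RingHom.id_apply]
  ring

/-- The field `Ξ` is holomorphic and `H` antiholomorphic, so a derivative `∂_m` of the curvature
pairs with the variation of `Ξ̄` and of `H`, and `∂̄_m` with that of `Ξ` and of `H̄`. These are the
pairings that occur in the derivatives of the Ricci trace and of the torsion trace. -/
theorem IsNormalAt.ev_curvFn_deriv (hk : IsNormalAt W ev k) (ξ η : Fin n → ℂ)
    (a b : Fin n → Fin n → ℂ) (Ξ H : Fin n → R)
    (hΞ : ∀ m i, W.d m (Ξ i) = algebraMap ℂ R (a m i)) (hΞb : ∀ m i, W.db m (Ξ i) = 0)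
    (hΞe : ∀ i, ev (Ξ i) = ξ i) (hH : ∀ m i, W.d m (H i) = 0)
    (hHb : ∀ m i, W.db m (H i) = algebraMap ℂ R (b m i)) (hHe : ∀ i, ev (H i) = η i) (m : Fin n) :
    ev (W.d m (W.db m (curvFn W k Ξ H))) =
      con η η (- ev.mapMatrix (mapD (W.d m) (mapD (W.db m) (mapD (W.D ξ) (mapD (W.Db ξ) k)))) +
        curvAt W ev k ξ (basisVec m) * curvAt W ev k (basisVec m) ξ)
      - con η η (ev.mapMatrix (mapD (W.d m) (mapD (W.D ξ) (mapD (W.Db (a m)) k))))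
      - con (b m) η (ev.mapMatrix (mapD (W.d m) (mapD (W.D ξ) (mapD (W.Db ξ) k))))
      - con η η (ev.mapMatrix (mapD (W.db m) (mapD (W.D (a m)) (mapD (W.Db ξ) k))))
      - con η (b m) (ev.mapMatrix (mapD (W.db m) (mapD (W.D ξ) (mapD (W.Db ξ) k))))
      + con η η (curvAt W ev k (a m) (a m))
      + con (b m) η (curvAt W ev k (a m) ξ) + con η (b m) (curvAt W ev k ξ (a m))
      + con (b m) (b m) (curvAt W ev k ξ ξ) := by
  have hs : ∀ c, algebraMap ℂ R (conj c) = star (algebraMap ℂ R c) := fun c => by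
    exact algebraMap_star_comm c
  have hterm := fun i j c d =>
    ev_deriv_deriv_mul (ev := ev) (W.d m) (W.db m) (curvM (W.d i) (W.db j) k c d)
      (Ξ i) (star (Ξ j)) (H c) (star (H d)) (a m i)
      (conj (a m j)) (b m c) (conj (b m d)) (hΞ m i) (hΞb m i)
      (by rw [← W.star_db, hΞb, star_zero]) (by rw [← W.star_d, hΞ, hs]) (hH m c) (hHb m c)
      (by rw [← W.star_db, hHb, hs]) (by rw [← W.star_d, hH, star_zero])
  simp only [curvFn, map_sum, hterm, hk.conj_ev, hΞe, hHe, Finset.sum_add_distrib]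
  have h2 := hk.ev_deriv_deriv_curvM (basisVec m) (basisVec m) ξ ξ
  rw [W.D_single, W.Db_single] at h2
  have f1 := con_map_curvM (W := W) (k := k)
    (ev.toLinearMap ∘ₗ (W.d m).toLinearMap ∘ₗ (W.db m).toLinearMap) ξ ξ η η
  have f2 := con_map_curvM (W := W) (k := k) (ev.toLinearMap ∘ₗ (W.d m).toLinearMap) ξ (a m) η η
  have f3 := con_map_curvM (W := W) (k := k) (ev.toLinearMap ∘ₗ (W.d m).toLinearMap) ξ ξ (b m) η
  have f4 := con_map_curvM (W := W) (k := k) (ev.toLinearMap ∘ₗ (W.db m).toLinearMap) (a m) ξ η η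
  have f5 := con_map_curvM (W := W) (k := k) (ev.toLinearMap ∘ₗ (W.db m).toLinearMap) ξ ξ η (b m)
  have f6 := con_map_curvM (W := W) (k := k) ev.toLinearMap (a m) (a m) η η
  have f7 := con_map_curvM (W := W) (k := k) ev.toLinearMap (a m) ξ (b m) η
  have f8 := con_map_curvM (W := W) (k := k) ev.toLinearMap ξ (a m) η (b m)
  have f9 := con_map_curvM (W := W) (k := k) ev.toLinearMap ξ ξ (b m) (b m)
  have r1 : ∀ M : Matrix (Fin n) (Fin n) R,
      M.map (ev.toLinearMap ∘ₗ (W.d m).toLinearMap ∘ₗ (W.db m).toLinearMap) =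
        ev.mapMatrix (mapD (W.d m) (mapD (W.db m) M)) := fun M => rfl
  have r2 : ∀ (X : Derivation ℂ R R) (M : Matrix (Fin n) (Fin n) R),
      M.map (ev.toLinearMap ∘ₗ X.toLinearMap) = ev.mapMatrix (mapD X M) := fun X M => rfl
  have r3 : ∀ M : Matrix (Fin n) (Fin n) R, M.map ev.toLinearMap = ev.mapMatrix M := fun M => rfl
  rw [r1, h2] at f1
  rw [r2, hk.ev_deriv_curvM, map_neg] at f2 f3 f4 f5
  rw [r3, hk.ev_curvM] at f6 f7 f8 f9
  rw [f1, f6, f7, f8, f9, sub_eq_add_neg, sub_eq_add_neg, sub_eq_add_neg, sub_eq_add_neg,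
    f2, f3, f4, f5]
  rfl

/-- The evolution of the curvature along the flow, in a normal frame. -/
theorem IsGauge.evolution (hg : IsGauge W ev h P k) (hk : IsNormalAt W ev k)
    (hherm : h.conjTranspose = h)
    (hflow : mapD W.dt h = - secondRicciM W h - torsionQuadM W h) (hP : mapD W.dt P = 0)
    (hPs : mapD W.dt (P.map star) = 0)
    (ξ η : Fin n → ℂ) (B N s : Matrix (Fin n) (Fin n) ℂ) (a b : Fin n → Fin n → ℂ)
    (hB : ∀ p m, B p m = ∑ l, conj (η l) * curvAt W ev k (basisVec p) ξ m l)
    (hN : ∀ p m, N p m = ∑ a, ev.mapMatrix (mapD (W.d p) h) m a *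
      ∑ l, conj (η l) * curvAt W ev k ξ ξ a l)
    (hs : s = ev.mapMatrix (frameTorsion W P k η))
    (ha : ∀ m i, a m i = - ev.mapMatrix (mapD (W.D ξ) h) m i)
    (hb : ∀ m i, b m i = - conj (s m i)) (Ξ H : Fin n → R)
    (hΞ : ∀ m i, W.d m (Ξ i) = algebraMap ℂ R (a m i)) (hΞb : ∀ m i, W.db m (Ξ i) = 0)
    (hΞe : ∀ i, ev (Ξ i) = ξ i) (hH : ∀ m i, W.d m (H i) = 0)
    (hHb : ∀ m i, W.db m (H i) = algebraMap ℂ R (b m i)) (hHe : ∀ i, ev (H i) = η i) :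
    ev (W.dt (con η η (curvM (W.D ξ) (W.Db ξ) k))) =
      ∑ m, ev (W.d m (W.db m (curvFn W k Ξ H)))
      + ∑ m, ∑ r, curvAt W ev k ξ ξ r m * con η η (curvAt W ev k (basisVec m) (basisVec r))
      - ∑ p, ∑ q, B p q * conj (B p q)
      + (1 / 2) * ∑ p, ∑ q, (B p q - B q p) * conj (B p q - B q p)
      + ∑ m, con η η (curvAt W ev k (basisVec m) ξ *
          (curvAt W ev k (basisVec m) ξ).conjTranspose)
      + (1 / 2) * ∑ p, ∑ q, ev.mapMatrix (mapD (W.D ξ) (frameTorsion W P k η)) p q *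
          conj (ev.mapMatrix (mapD (W.D ξ) (frameTorsion W P k η)) p q)
      - ∑ p, ∑ q, N p q * conj (s p q) - conj (∑ p, ∑ q, N p q * conj (s p q)) := by
  have hev := hk.conj_ev
  have hh1 : ev.mapMatrix h = 1 := by
    have := congrArg ev.mapMatrix hg.eq
    rwa [map_mul, map_mul, mapMatrix_transpose, hg.one, hg.star_one hev, hk.one,
      Matrix.transpose_one, one_mul, mul_one, eq_comm] at this
  have hgi := HermitianFlow.ev_inv h hg.unit_h hh1
  have hHb' : ev.mapMatrix (mapD (W.Db ξ) h) = (ev.mapMatrix (mapD (W.D ξ) h)).conjTranspose := by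
    rw [← mapMatrix_conjTranspose hev, W.mapD_D_conjTranspose, hherm]
  -- The curvatures of `h` and `k` agree at the point because `P = 1` there. Since the coordinate
  -- frame is not normal, the product of first derivatives must be kept.
  have hcurv : ev.mapMatrix (mapD (W.D ξ) (mapD (W.Db ξ) h)) =
      - curvAt W ev k ξ ξ + ev.mapMatrix (mapD (W.D ξ) h) * ev.mapMatrix (mapD (W.Db ξ) h) := by
    have := congrArg ev.mapMatrix (hg.curvM_eq ξ ξ)
    rw [hk.ev_curvM, map_mul, map_mul, mapMatrix_transpose, hg.one, hg.star_one hev,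
      Matrix.transpose_one, one_mul, mul_one] at this
    rw [this]
    simp only [curvM, map_add, map_neg, map_mul, hgi, mul_one]
    abel
  have hr := hk.ricciTrace_deriv h⁻¹ ξ η (ev.mapMatrix (mapD (W.D ξ) h)) hgi
    (by simp only [mapD_inv _ _ hg.unit_h, map_neg, map_mul, hgi, one_mul, mul_one])
    (by simp only [mapD_inv _ _ hg.unit_h, map_neg, map_mul, hgi, one_mul, mul_one, hHb'])
    (by
      simp only [mapD_inv _ _ hg.unit_h, map_neg, mapD_mul, map_add, map_mul, hgi, one_mul,
        mul_one, hcurv, hHb']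
      noncomm_ring) a ha
  have ht := hg.torsionTrace_deriv hk ξ η B N s a b hB hN hs ha hb
  -- The Ricci trace and the Laplacian of the test function contain the same two curvature factors
  -- in opposite order. The order coming from the Laplacian gives `|B|²`, which enters with a minus
  -- sign; the other order is a non-negative square.
  have hB2 : ∀ p, con η η (curvAt W ev k ξ (basisVec p) * curvAt W ev k (basisVec p) ξ) =
      ∑ q, B p q * conj (B p q) := by
    intro p
    rw [← hk.curvAt_conjTranspose ξ (basisVec p), con_mul_conjTranspose]
    refine Finset.sum_congr rfl fun q _ => ?_
    have : conj (∑ l, η l * curvAt W ev k ξ (basisVec p) l q) = B p q := by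
      rw [hB, map_sum]
      refine Finset.sum_congr rfl fun l _ => ?_
      rw [map_mul, ← hk.curvAt_conjTranspose ξ (basisVec p), Matrix.conjTranspose_apply]
      rfl
    rw [← this, Complex.conj_conj]
    ring
  rw [hg.ev_dt_curvature hk hflow hP hPs, hr, ht]
  simp only [hk.ev_curvFn_deriv ξ η a b Ξ H hΞ hΞb hΞe hH hHb hHe, map_add,
    hk.curvAt_conjTranspose, hB2, Finset.sum_add_distrib, Finset.sum_sub_distrib]
  ring

end TestFunction

/-! ### The ring of smooth functions on a space-time domain -/

/-- A product `[0, τ) × U` with `U` open in `ℂⁿ`. -/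
structure SpaceTime (n : ℕ) where
  /-- The length of the time interval. -/
  τ : ℝ
  /-- The spatial domain. -/
  U : Set (Cn n)
  τ_pos : 0 < τ
  isOpen_U : IsOpen U

namespace SpaceTime

variable {n : ℕ} (Ω : SpaceTime n)

/-- The underlying set. -/
def carrier : Set (ℝ × Cn n) := Set.Ico 0 Ω.τ ×ˢ Ω.U

theorem uniqueDiffOn : UniqueDiffOn ℝ Ω.carrier :=
  (uniqueDiffOn_Ico 0 Ω.τ).prod Ω.isOpen_U.uniqueDiffOn

/-- Symmetry of second derivatives within the domain is needed also at `t = 0`, and there it follows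
from approximation by interior points. -/
theorem subset_closure : Ω.carrier ⊆ closure (interior Ω.carrier) := by
  rw [carrier, interior_prod_eq, interior_Ico, Ω.isOpen_U.interior_eq, closure_prod_eq,
    closure_Ioo Ω.τ_pos.ne]
  exact Set.prod_mono Set.Ico_subset_Icc_self _root_.subset_closure

/-- Extension by zero of a function on the domain. -/
def ext (f : Ω.carrier → ℂ) : ℝ × Cn n → ℂ := Function.extend Subtype.val f 0

theorem ext_apply (f : Ω.carrier → ℂ) (p : Ω.carrier) : Ω.ext f p = f p :=
  Subtype.val_injective.extend_apply f 0 p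

theorem ext_eqOn {f : Ω.carrier → ℂ} {F : ℝ × Cn n → ℂ} (h : ∀ p : Ω.carrier, F p = f p) :
    Set.EqOn F (Ω.ext f) Ω.carrier := fun p hp => by
  exact (h ⟨p, hp⟩).trans (Ω.ext_apply f ⟨p, hp⟩).symm

/-- The ring of smooth complex-valued functions on the domain. -/
def Fn : StarSubalgebra ℂ (Ω.carrier → ℂ) where
  -- Elements are functions on the subtype, so equality in the ring ignores values outside the
  -- domain. The zero extension only serves to take derivatives within the domain.
  carrier := {f | ContDiffOn ℝ ∞ (Ω.ext f) Ω.carrier}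
  mul_mem' {f g} hf hg := (hf.mul hg).congr fun p hp => by
    rw [Ω.ext_apply _ ⟨p, hp⟩, Pi.mul_apply, ← Ω.ext_apply f, ← Ω.ext_apply g]
  add_mem' {f g} hf hg := (hf.add hg).congr fun p hp => by
    rw [Ω.ext_apply _ ⟨p, hp⟩, Pi.add_apply, ← Ω.ext_apply f, ← Ω.ext_apply g]
  algebraMap_mem' c := (contDiffOn_const (c := c)).congr fun p hp => by
    rw [Ω.ext_apply _ ⟨p, hp⟩]; rfl
  star_mem' {f} hf := (Complex.conjCLE.contDiff.comp_contDiffOn hf).congr fun p hp => by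
    rw [Ω.ext_apply _ ⟨p, hp⟩, Function.comp_apply, Ω.ext_apply _ ⟨p, hp⟩]; rfl

/-- A smooth function, as an element of the ring. -/
def ofFn (F : ℝ × Cn n → ℂ) (hF : ContDiffOn ℝ ∞ F Ω.carrier) : Ω.Fn :=
  ⟨fun p => F p, hF.congr fun p hp => Ω.ext_apply _ ⟨p, hp⟩⟩

theorem contDiffOn_ext (f : Ω.Fn) : ContDiffOn ℝ ∞ (Ω.ext f.1) Ω.carrier := f.2

theorem contDiffOn_of_eq {f : Ω.Fn} {F : ℝ × Cn n → ℂ} (h : ∀ p : Ω.carrier, F p = f.1 p) :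
    ContDiffOn ℝ ∞ F Ω.carrier := f.2.congr (Ω.ext_eqOn h)

theorem differentiableWithinAt_ext (f : Ω.Fn) (p : Ω.carrier) :
    DifferentiableWithinAt ℝ (Ω.ext f.1) Ω.carrier p :=
  (Ω.contDiffOn_ext f).differentiableOn (by simp) p p.2

/-- The directional derivative of a smooth function. -/
def dirDerivFn (v : ℝ × Cn n) (f : Ω.Fn) : Ω.Fn :=
  Ω.ofFn (fun p => fderivWithin ℝ (Ω.ext f.1) Ω.carrier p v)
    (((Ω.contDiffOn_ext f).fderivWithin Ω.uniqueDiffOn (by simp)).clm_apply contDiffOn_const)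

theorem dirDerivFn_apply (v : ℝ × Cn n) (f : Ω.Fn) {F : ℝ × Cn n → ℂ}
    (h : ∀ p : Ω.carrier, F p = f.1 p) (p : Ω.carrier) :
    (Ω.dirDerivFn v f).1 p = fderivWithin ℝ F Ω.carrier p v := by
  change fderivWithin ℝ (Ω.ext f.1) Ω.carrier p v = _
  rw [fderivWithin_congr (Ω.ext_eqOn h) (Ω.ext_eqOn h p.2)]

/-- The directional derivative, as a derivation. -/
def dirDeriv (v : ℝ × Cn n) : Derivation ℂ Ω.Fn Ω.Fn :=
  Derivation.mk'
    { toFun := Ω.dirDerivFn v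
      map_add' := fun f g => Subtype.ext <| funext fun p => by
        rw [Ω.dirDerivFn_apply v (f + g) (F := Ω.ext f.1 + Ω.ext g.1)
          (fun q => by rw [Pi.add_apply, Ω.ext_apply, Ω.ext_apply]; rfl),
          fderivWithin_add (Ω.uniqueDiffOn p p.2) (Ω.differentiableWithinAt_ext f p)
          (Ω.differentiableWithinAt_ext g p)]
        rfl
      map_smul' := fun c f => Subtype.ext <| funext fun p => by
        rw [Ω.dirDerivFn_apply v (c • f) (F := c • Ω.ext f.1)
          (fun q => by rw [Pi.smul_apply, Ω.ext_apply]; rfl),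
          fderivWithin_const_smul (Ω.uniqueDiffOn p p.2) (Ω.differentiableWithinAt_ext f p)]
        rfl }
    fun f g => Subtype.ext <| funext fun p => by
      change (Ω.dirDerivFn v (f * g)).1 p = _
      rw [Ω.dirDerivFn_apply v (f * g) (F := Ω.ext f.1 * Ω.ext g.1)
          (fun q => by rw [Pi.mul_apply, Ω.ext_apply, Ω.ext_apply]; rfl),
          fderivWithin_mul (Ω.uniqueDiffOn p p.2) (Ω.differentiableWithinAt_ext f p)
          (Ω.differentiableWithinAt_ext g p), Ω.ext_apply, Ω.ext_apply]
      rfl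

theorem dirDeriv_apply (v : ℝ × Cn n) (f : Ω.Fn) {F : ℝ × Cn n → ℂ}
    (h : ∀ p : Ω.carrier, F p = f.1 p) (p : Ω.carrier) :
    (Ω.dirDeriv v f).1 p = fderivWithin ℝ F Ω.carrier p v := Ω.dirDerivFn_apply v f h p

theorem dirDeriv_comm (v w : ℝ × Cn n) (f : Ω.Fn) :
    Ω.dirDeriv v (Ω.dirDeriv w f) = Ω.dirDeriv w (Ω.dirDeriv v f) := by
  refine Subtype.ext <| funext fun p => ?_
  rw [Ω.dirDeriv_apply v (Ω.dirDeriv w f) (F := fun q => fderivWithin ℝ (Ω.ext f.1) Ω.carrier q w)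
    (fun q => rfl), Ω.dirDeriv_apply w (Ω.dirDeriv v f)
    (F := fun q => fderivWithin ℝ (Ω.ext f.1) Ω.carrier q v) (fun q => rfl)]
  have hd : DifferentiableWithinAt ℝ (fderivWithin ℝ (Ω.ext f.1) Ω.carrier) Ω.carrier p :=
    (((Ω.contDiffOn_ext f).fderivWithin Ω.uniqueDiffOn (m := 1) (by norm_cast)).differentiableOn
      (by simp)) p p.2
  have hs : IsSymmSndFDerivWithinAt ℝ (Ω.ext f.1) Ω.carrier p :=
    ContDiffWithinAt.isSymmSndFDerivWithinAt (Ω.contDiffOn_ext f p p.2)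
      (by rw [minSmoothness_of_isRCLikeNormedField]; exact WithTop.coe_le_coe.2 le_top)
      Ω.uniqueDiffOn (Ω.subset_closure p.2) p.2
  have e : ∀ u, fderivWithin ℝ (fun q => fderivWithin ℝ (Ω.ext f.1) Ω.carrier q u) Ω.carrier p =
      (fderivWithin ℝ (fderivWithin ℝ (Ω.ext f.1) Ω.carrier) Ω.carrier p).flip u := by
    intro u
    rw [fderivWithin_clm_apply (Ω.uniqueDiffOn p p.2) hd (differentiableWithinAt_const u)]
    simp
  rw [e, e]
  exact hs v w

theorem star_dirDeriv (v : ℝ × Cn n) (f : Ω.Fn) :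
    star (Ω.dirDeriv v f) = Ω.dirDeriv v (star f) := by
  refine Subtype.ext <| funext fun p => ?_
  rw [Ω.dirDeriv_apply v (star f) (F := fun q => Complex.conjCLE (Ω.ext f.1 q))
    (fun q => by rw [Ω.ext_apply]; rfl)]
  have := (Complex.conjCLE.toContinuousLinearMap.hasFDerivAt (x := Ω.ext f.1 p)).comp_hasFDerivWithinAt p.1
    (Ω.differentiableWithinAt_ext f p).hasFDerivWithinAt
  have h2 := this.fderivWithin (Ω.uniqueDiffOn p p.2)
  have h3 : fderivWithin ℝ (fun q => Complex.conjCLE (Ω.ext f.1 q)) Ω.carrier p = _ := h2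
  rw [h3]
  rfl

/-- The Wirtinger derivations. -/
def wirt : WirtingerRing n Ω.Fn where
  d i := (1 / 2 : ℂ) • (Ω.dirDeriv (0, Pi.single i 1) -
    Complex.I • Ω.dirDeriv (0, Pi.single i Complex.I))
  db i := (1 / 2 : ℂ) • (Ω.dirDeriv (0, Pi.single i 1) +
    Complex.I • Ω.dirDeriv (0, Pi.single i Complex.I))
  dt := Ω.dirDeriv (1, 0)
  d_comm i j f := by
    simp only [Derivation.smul_apply, Derivation.sub_apply, Derivation.map_smul, map_sub]
    rw [Ω.dirDeriv_comm (0, Pi.single i 1) (0, Pi.single j 1),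
      Ω.dirDeriv_comm (0, Pi.single i 1) (0, Pi.single j Complex.I),
      Ω.dirDeriv_comm (0, Pi.single i Complex.I) (0, Pi.single j 1),
      Ω.dirDeriv_comm (0, Pi.single i Complex.I) (0, Pi.single j Complex.I)]
    module
  d_db i j f := by
    simp only [Derivation.smul_apply, Derivation.sub_apply, Derivation.map_smul, map_sub,
      Derivation.add_apply, map_add]
    rw [Ω.dirDeriv_comm (0, Pi.single i 1) (0, Pi.single j 1),
      Ω.dirDeriv_comm (0, Pi.single i 1) (0, Pi.single j Complex.I),
      Ω.dirDeriv_comm (0, Pi.single i Complex.I) (0, Pi.single j 1),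
      Ω.dirDeriv_comm (0, Pi.single i Complex.I) (0, Pi.single j Complex.I)]
    module
  dt_d i f := by
    simp only [Derivation.smul_apply, Derivation.sub_apply, Derivation.map_smul, map_sub]
    rw [Ω.dirDeriv_comm (1, 0), Ω.dirDeriv_comm (1, 0)]
  dt_db i f := by
    simp only [Derivation.smul_apply, Derivation.add_apply, Derivation.map_smul, map_add]
    rw [Ω.dirDeriv_comm (1, 0), Ω.dirDeriv_comm (1, 0)]
  star_d i f := by
    simp only [Derivation.smul_apply, Derivation.add_apply, Derivation.sub_apply, star_smul,
      star_sub, star_dirDeriv]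
    simp

/-- Evaluation at a point. -/
def ev (p : Ω.carrier) : Ω.Fn →ₐ[ℂ] ℂ :=
  (Pi.evalAlgHom ℂ (fun _ : Ω.carrier => ℂ) p).comp Ω.Fn.subtype.toAlgHom

theorem ev_star (p : Ω.carrier) (f : Ω.Fn) : Ω.ev p (star f) = conj (Ω.ev p f) := rfl

theorem ext_of_ev {f g : Ω.Fn} (h : ∀ p, Ω.ev p f = Ω.ev p g) : f = g :=
  Subtype.ext <| funext h

/-- The spatial domain is open, so a spatial derivative within space-time is an ordinary derivative
on the time slice, also at `t = 0`. This links the derivations of the ring with `dz` and `dzbar`. -/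
theorem fderiv_slice {F : ℝ × Cn n → ℂ} {p : ℝ × Cn n} (hp : p ∈ Ω.carrier)
    (hF : DifferentiableWithinAt ℝ F Ω.carrier p) (v : Cn n) :
    fderiv ℝ (fun w => F (p.1, w)) p.2 v = fderivWithin ℝ F Ω.carrier p (0, v) := by
  have h1 : HasFDerivWithinAt (fun w : Cn n => (p.1, w)) (ContinuousLinearMap.inr ℝ ℝ (Cn n))
      Ω.U p.2 := (hasFDerivAt_prodMk_right p.1 p.2).hasFDerivWithinAt
  have h2 := HasFDerivWithinAt.comp p.2 (t := Ω.carrier) (g := F)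
    hF.hasFDerivWithinAt h1 (fun w hw => ⟨hp.1, hw⟩)
  have h3 := h2.hasFDerivAt (Ω.isOpen_U.mem_nhds hp.2)
  have h4 : fderiv ℝ (fun w => F (p.1, w)) p.2 = _ := h3.fderiv
  rw [h4]
  rfl

theorem ev_d (i : Fin n) (f : Ω.Fn) {F : ℝ → Cn n → ℂ}
    (h : ∀ p : Ω.carrier, F p.1.1 p.1.2 = Ω.ev p f) (p : Ω.carrier) :
    Ω.ev p (Ω.wirt.d i f) = dz i (F p.1.1) p.1.2 := by
  have hF := (Ω.contDiffOn_of_eq (f := f) (F := fun q => F q.1 q.2) h).differentiableOn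
    (by simp) p p.2
  have e : ∀ v, Ω.ev p (Ω.dirDeriv v f) = fderivWithin ℝ (fun q => F q.1 q.2) Ω.carrier p v :=
    fun v => Ω.dirDeriv_apply v f (F := fun q => F q.1 q.2) h p
  simp only [wirt, Derivation.smul_apply, Derivation.sub_apply, map_smul, map_sub, e, dz,
    smul_eq_mul]
  rw [← Ω.fderiv_slice p.2 hF, ← Ω.fderiv_slice p.2 hF]
  ring

theorem ev_db (i : Fin n) (f : Ω.Fn) {F : ℝ → Cn n → ℂ}
    (h : ∀ p : Ω.carrier, F p.1.1 p.1.2 = Ω.ev p f) (p : Ω.carrier) :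
    Ω.ev p (Ω.wirt.db i f) = dzbar i (F p.1.1) p.1.2 := by
  have hF := (Ω.contDiffOn_of_eq (f := f) (F := fun q => F q.1 q.2) h).differentiableOn
    (by simp) p p.2
  have e : ∀ v, Ω.ev p (Ω.dirDeriv v f) = fderivWithin ℝ (fun q => F q.1 q.2) Ω.carrier p v :=
    fun v => Ω.dirDeriv_apply v f (F := fun q => F q.1 q.2) h p
  simp only [wirt, Derivation.smul_apply, Derivation.add_apply, map_smul, map_add, e, dzbar,
    smul_eq_mul]
  rw [← Ω.fderiv_slice p.2 hF, ← Ω.fderiv_slice p.2 hF]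
  ring

theorem hasDerivWithinAt_dt (f : Ω.Fn) {F : ℝ → Cn n → ℂ}
    (h : ∀ p : Ω.carrier, F p.1.1 p.1.2 = Ω.ev p f) (p : Ω.carrier) :
    HasDerivWithinAt (fun s => F s p.1.2) (Ω.ev p (Ω.wirt.dt f)) (Set.Ico 0 Ω.τ) p.1.1 := by
  have hF := (Ω.contDiffOn_of_eq (f := f) (F := fun q => F q.1 q.2) h).differentiableOn
    (by simp) p p.2
  have e : Ω.ev p (Ω.dirDeriv (1, 0) f) = fderivWithin ℝ (fun q => F q.1 q.2) Ω.carrier p (1, 0) :=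
    Ω.dirDeriv_apply _ f (F := fun q => F q.1 q.2) h p
  have h1 : HasFDerivWithinAt (fun s : ℝ => (s, p.1.2)) (ContinuousLinearMap.inl ℝ ℝ (Cn n))
      (Set.Ico 0 Ω.τ) p.1.1 := (hasFDerivAt_prodMk_left p.1.1 p.1.2).hasFDerivWithinAt
  have h2 := HasFDerivWithinAt.comp p.1.1 (t := Ω.carrier) (g := fun q : ℝ × Cn n => F q.1 q.2)
    hF.hasFDerivWithinAt h1 (fun w hw => ⟨hw, p.2.2⟩)
  have h3 := h2.hasDerivWithinAt
  change HasDerivWithinAt _ (Ω.ev p (Ω.dirDeriv (1, 0) f)) _ _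
  rw [e]
  exact h3

end SpaceTime

/-- Bridge to the definition of `curvature`: in this form the curvature is minus the `∂̄`-derivative
of the connection matrix `∂M M⁻¹`, with an index lowered. -/
theorem curvM_eq_neg_mapD_mul {ι R : Type*} [Fintype ι] [DecidableEq ι] [CommRing R] [Algebra ℂ R]
    {X Y : Derivation ℂ R R} (hXY : ∀ f, X (Y f) = Y (X f)) (M : Matrix ι ι R)
    (hM : IsUnit M.det) : curvM X Y M = - (mapD Y (mapD X M * M⁻¹) * M) := by
  have hi := Matrix.nonsing_inv_mul _ hM
  have hc : mapD X (mapD Y M) = mapD Y (mapD X M) := by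
    ext i j
    exact hXY _
  rw [mapD_mul, mapD_inv _ _ hM, curvM, hc, add_mul, mul_assoc _ _ M, hi, mul_one, mul_neg, neg_mul,
    mul_assoc _ _ M, mul_assoc _ _ M, hi, mul_one, ← mul_assoc]
  abel

/-! ### Metrics in a chart as matrices over the ring of smooth functions -/

namespace SpaceTime

variable {n : ℕ} (Ω : SpaceTime n)

/-- Smoothness of a time-dependent field of matrices. -/
def SmoothMetric (h : ℝ → Cn n → Matrix (Fin n) (Fin n) ℂ) : Prop :=
  ∀ i j, ContDiffOn ℝ ∞ (fun q : ℝ × Cn n => h q.1 q.2 i j) Ω.carrier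

variable {Ω} {h : ℝ → Cn n → Matrix (Fin n) (Fin n) ℂ}

/-- A smooth field of matrices as a matrix over the ring of smooth functions. -/
def toMatrix (hh : Ω.SmoothMetric h) : Matrix (Fin n) (Fin n) Ω.Fn :=
  Matrix.of fun i j => Ω.ofFn (fun q => h q.1 q.2 i j) (hh i j)

theorem ev_toMatrix_apply (hh : Ω.SmoothMetric h) (p : Ω.carrier) (i j : Fin n) :
    Ω.ev p (toMatrix hh i j) = h p.1.1 p.1.2 i j := rfl

theorem isUnit_of_ev {f : Ω.Fn} (hf : ∀ p, Ω.ev p f ≠ 0) : IsUnit f := by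
  have hs : ContDiffOn ℝ ∞ (fun q => (Ω.ext f.1 q)⁻¹) Ω.carrier :=
    (Ω.contDiffOn_ext f).inv fun q hq => by
      rw [Ω.ext_apply _ ⟨q, hq⟩]; exact hf ⟨q, hq⟩
  refine IsUnit.of_mul_eq_one (Ω.ofFn _ hs) (Ω.ext_of_ev fun p => ?_)
  rw [map_mul, map_one]
  have : Ω.ev p (Ω.ofFn _ hs) = (Ω.ev p f)⁻¹ := congrArg (·⁻¹) (Ω.ext_apply f.1 p)
  rw [this, mul_inv_cancel₀ (hf p)]

theorem ev_det (M : Matrix (Fin n) (Fin n) Ω.Fn) (p : Ω.carrier) :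
    Ω.ev p M.det = ((Ω.ev p).mapMatrix M).det := AlgHom.map_det _ _

theorem isUnit_det_of_ev {M : Matrix (Fin n) (Fin n) Ω.Fn}
    (hM : ∀ p, IsUnit ((Ω.ev p).mapMatrix M).det) : IsUnit M.det :=
  isUnit_of_ev fun p => by rw [ev_det]; exact (hM p).ne_zero

theorem ev_matrix_inv {M : Matrix (Fin n) (Fin n) Ω.Fn} (hM : IsUnit M.det) (p : Ω.carrier) :
    (Ω.ev p).mapMatrix M⁻¹ = ((Ω.ev p).mapMatrix M)⁻¹ := by
  have := congrArg (Ω.ev p).mapMatrix (Matrix.mul_nonsing_inv _ hM)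
  rw [map_mul, map_one] at this
  exact (Matrix.inv_eq_right_inv this).symm

theorem matrix_ext {M N : Matrix (Fin n) (Fin n) Ω.Fn}
    (hMN : ∀ p, (Ω.ev p).mapMatrix M = (Ω.ev p).mapMatrix N) : M = N := by
  ext i j
  exact congrFun (congrArg Subtype.val (Ω.ext_of_ev fun p => congrFun (congrFun (hMN p) i) j)) _

variable (hh : Ω.SmoothMetric h)

theorem ev_d_toMatrix (p : Ω.carrier) (m i j : Fin n) :
    Ω.ev p (Ω.wirt.d m (toMatrix hh i j)) = dz m (fun w => h p.1.1 w i j) p.1.2 :=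
  Ω.ev_d m (toMatrix hh i j) (F := fun t w => h t w i j) (fun _ => rfl) p

theorem ev_db_toMatrix (p : Ω.carrier) (m i j : Fin n) :
    Ω.ev p (Ω.wirt.db m (toMatrix hh i j)) = dzbar m (fun w => h p.1.1 w i j) p.1.2 :=
  Ω.ev_db m (toMatrix hh i j) (F := fun t w => h t w i j) (fun _ => rfl) p

variable (hu : ∀ p ∈ Ω.carrier, IsUnit (h p.1 p.2).det)
include hu

theorem isUnit_toMatrix : IsUnit (toMatrix hh).det :=
  isUnit_det_of_ev fun p => hu p p.2

theorem ev_inv_toMatrix (p : Ω.carrier) (i j : Fin n) :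
    Ω.ev p ((toMatrix hh)⁻¹ i j) = (h p.1.1 p.1.2)⁻¹ i j :=
  congrFun (congrFun (ev_matrix_inv (isUnit_toMatrix hh hu) p) i) j

theorem ev_christoffel (p : Ω.carrier) (i k l : Fin n) :
    Ω.ev p ((mapD (Ω.wirt.d i) (toMatrix hh) * (toMatrix hh)⁻¹) k l) =
      christoffel (h p.1.1) i k l p.1.2 := by
  simp only [Matrix.mul_apply, map_sum, map_mul, mapD_apply, ev_d_toMatrix, ev_inv_toMatrix hh hu,
    christoffel, invMetric, Matrix.transpose_apply]
  exact Finset.sum_congr rfl fun q _ => mul_comm _ _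

omit hu in
theorem nabla_coordField (g : Cn n → Matrix (Fin n) (Fin n) ℂ) (i k : Fin n) (z : Cn n)
    (p : Fin n) : nabla g i (coordField k) z p = christoffel g i k p z := by
  have h1 : dz i (fun w => coordField k w p) z = 0 := by
    simp [dz, coordField]
  rw [nabla, h1, zero_add, Finset.sum_eq_single k]
  · simp [coordField]
  · intro b _ hb
    simp [coordField, hb]
  · simp

omit hu in
theorem nablaBar_coordField (j k : Fin n) :
    nablaBar j (coordField k) = fun (_ : Cn n) (_ : Fin n) => (0 : ℂ) := by
  funext z p
  simp [nablaBar, dzbar, coordField]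

omit hu in
theorem curvature_eq (g : Cn n → Matrix (Fin n) (Fin n) ℂ) (i j k l : Fin n) (z : Cn n) :
    curvature g i j k l z = - ∑ p, dzbar j (fun w => christoffel g i k p w) z * g z p l := by
  have h1 : ∀ p, nabla g i (nablaBar j (coordField k)) z p = 0 := by
    intro p
    rw [nablaBar_coordField]
    simp [nabla, dz]
  simp only [curvature, h1, zero_sub, neg_mul, Finset.sum_neg_distrib, nablaBar]
  congr 1
  refine Finset.sum_congr rfl fun p _ => ?_
  congr 2
  funext w
  rw [nabla_coordField]

/-- The curvature of a metric, as an element of the ring of smooth functions. -/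
theorem ev_curvM (p : Ω.carrier) (i j k l : Fin n) :
    Ω.ev p (curvM (Ω.wirt.d i) (Ω.wirt.db j) (toMatrix hh) k l) =
      curvature (h p.1.1) i j k l p.1.2 := by
  have e := curvM_eq_neg_mapD_mul (Ω.wirt.d_db i j) (toMatrix hh) (isUnit_toMatrix hh hu)
  rw [e, curvature_eq]
  rw [Matrix.neg_apply, map_neg, Matrix.mul_apply, map_sum]
  congr 1
  refine Finset.sum_congr rfl fun q _ => ?_
  rw [map_mul, mapD_apply, ev_toMatrix_apply, Ω.ev_db j _ (F := fun t w => christoffel (h t) i k q w)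
    (fun p' => (ev_christoffel hh hu p' i k q).symm)]

theorem ev_secondRicciM (p : Ω.carrier) (i j : Fin n) :
    Ω.ev p (secondRicciM Ω.wirt (toMatrix hh) i j) = secondRicci (h p.1.1) i j p.1.2 := by
  simp only [secondRicciM, Matrix.sum_apply, Matrix.smul_apply, smul_eq_mul, map_sum, map_mul,
    ev_inv_toMatrix hh hu, ev_curvM hh hu, secondRicci, invMetric, Matrix.transpose_apply]

omit hu in
theorem torsionLow_eq (g : Cn n → Matrix (Fin n) (Fin n) ℂ) (z : Cn n) (hz : IsUnit (g z).det)
    (p m j : Fin n) :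
    torsionLow g p m j z = dz p (fun w => g w m j) z - dz m (fun w => g w p j) z := by
  simp only [torsionLow, torsion, sub_mul, Finset.sum_sub_distrib]
  have e : ∀ i k, ∑ x, nabla g i (coordField k) z x * g z x j = dz i (fun w => g w k j) z :=
    fun i k => by
      rw [← christoffel_metric g z hz]
      exact Finset.sum_congr rfl fun x _ => by rw [nabla_coordField]
  rw [e, e]

theorem ev_torsionM (q : Ω.carrier) (p m j : Fin n) :
    Ω.ev q (torsionM Ω.wirt (toMatrix hh) p m j) = torsionLow (h q.1.1) p m j q.1.2 := by
  rw [torsionM, map_sub, ev_d_toMatrix, ev_d_toMatrix, torsionLow_eq _ _ (hu q q.2)]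

theorem ev_torsionQuadM (p : Ω.carrier) (i j : Fin n) :
    Ω.ev p (torsionQuadM Ω.wirt (toMatrix hh) i j) = torsionQuad (h p.1.1) i j p.1.2 := by
  simp only [torsionQuadM, Matrix.of_apply, map_smul, smul_eq_mul, map_sum, map_mul,
    ev_inv_toMatrix hh hu, ev_torsionM hh hu, torsionQuad, invMetric, Matrix.transpose_apply,
    Ω.ev_star]

theorem toMatrix_flow (hflow : ∀ p ∈ Ω.carrier, ∀ i j : Fin n,
      HasDerivWithinAt (fun s => h s p.2 i j)
        (- secondRicci (h p.1) i j p.2 - torsionQuad (h p.1) i j p.2) (Set.Ico 0 Ω.τ) p.1) :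
    mapD Ω.wirt.dt (toMatrix hh) =
      - secondRicciM Ω.wirt (toMatrix hh) - torsionQuadM Ω.wirt (toMatrix hh) := by
  refine matrix_ext fun p => ?_
  ext i j
  simp only [AlgHom.mapMatrix_apply, Matrix.map_apply, mapD_apply, Matrix.sub_apply,
    Matrix.neg_apply, map_sub, map_neg, ev_secondRicciM hh hu, ev_torsionQuadM hh hu]
  exact (uniqueDiffOn_Ico 0 Ω.τ p.1.1 p.2.1).eq_deriv _
    (Ω.hasDerivWithinAt_dt (toMatrix hh i j) (F := fun t w => h t w i j) (fun _ => rfl) p)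
    (hflow p p.2 i j)

end SpaceTime

/-! ### Second derivative test -/

/-- If `c` were negative, the second derivative test would make `0` a local maximum as well as a
local minimum; then `g` would be locally constant and `c` would be zero. -/
theorem second_deriv_nonneg {g g' : ℝ → ℝ} {c : ℝ} (hg : ∀ᶠ s in nhds 0, HasDerivAt g (g' s) s)
    (hg' : HasDerivAt g' c 0) (h0 : g 0 = 0) (hpos : ∀ᶠ s in nhds 0, 0 ≤ g s) : 0 ≤ c := by
  by_contra! hc
  have hd : deriv g =ᶠ[nhds 0] g' := hg.mono fun s hs => hs.deriv
  have hdd : deriv (deriv g) 0 = c := by rw [hd.deriv_eq, hg'.deriv]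
  have hmin : IsLocalMin g 0 := hpos.mono fun s hs => by rwa [h0]
  have hmax : IsLocalMax g 0 :=
    isLocalMax_of_deriv_deriv_neg (by rwa [hdd]) hmin.deriv_eq_zero hg.self_of_nhds.continuousAt
  have hz : g =ᶠ[nhds 0] fun _ => 0 := by
    filter_upwards [hmax, hpos] with s h1 h2
    exact le_antisymm (by rwa [h0] at h1) h2
  have h1 : deriv g =ᶠ[nhds 0] fun _ => 0 := by
    have := hz.deriv
    simpa using this
  have : deriv (deriv g) 0 = 0 := by
    rw [h1.deriv_eq]; simp
  rw [hdd] at this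
  exact hc.ne this

/-! ### The Laplacian at a spatial minimum -/

namespace SpaceTime

variable {n : ℕ} {Ω : SpaceTime n}

theorem hasDerivAt_dirDeriv (f : Ω.Fn) (t : ℝ) (z u : Cn n) (s : ℝ)
    (hs : (t, z + s • u) ∈ Ω.carrier) :
    HasDerivAt (fun r : ℝ => (Ω.ext f.1 (t, z + r • u)).re)
      (Ω.ext (Ω.dirDeriv (0, u) f).1 (t, z + s • u)).re s := by
  have h1 : HasFDerivWithinAt (Ω.ext f.1) (fderivWithin ℝ (Ω.ext f.1) Ω.carrier (t, z + s • u))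
      Ω.carrier (t, z + s • u) := (Ω.differentiableWithinAt_ext f ⟨_, hs⟩).hasFDerivWithinAt
  have hc : HasDerivAt (fun r : ℝ => (t, z + r • u)) ((0 : ℝ), u) s := by
    have := ((hasDerivAt_id s).smul_const u).const_add z
    rw [one_smul] at this
    exact (hasDerivAt_const s t).prodMk this
  have hO : IsOpen ((fun r : ℝ => z + r • u) ⁻¹' Ω.U) :=
    Ω.isOpen_U.preimage (by fun_prop)
  have hm : Set.MapsTo (fun r : ℝ => (t, z + r • u)) ((fun r : ℝ => z + r • u) ⁻¹' Ω.U)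
      Ω.carrier := fun r hr => ⟨hs.1, hr⟩
  have h2 := h1.comp_hasDerivWithinAt s hc.hasDerivWithinAt hm
  have h3 := h2.hasDerivAt (hO.mem_nhds hs.2)
  have h4 := Complex.reCLM.hasFDerivAt.comp_hasDerivAt s h3
  have h5 : Ω.ext (Ω.dirDeriv (0, u) f).1 (t, z + s • u) =
      fderivWithin ℝ (Ω.ext f.1) Ω.carrier (t, z + s • u) (0, u) :=
    (Ω.ext_apply _ ⟨_, hs⟩).trans
      (Ω.dirDeriv_apply (0, u) f (fun q => Ω.ext_apply f.1 q) ⟨_, hs⟩)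
  rw [h5]
  exact h4

theorem dirDeriv_dirDeriv_nonneg (f : Ω.Fn) (p : Ω.carrier) (u : Cn n)
    (hpos : ∀ q : Ω.carrier, q.1.1 = p.1.1 → 0 ≤ (Ω.ev q f).re) (h0 : (Ω.ev p f).re = 0) :
    0 ≤ (Ω.ev p (Ω.dirDeriv (0, u) (Ω.dirDeriv (0, u) f))).re := by
  have hO : IsOpen ((fun r : ℝ => p.1.2 + r • u) ⁻¹' Ω.U) :=
    Ω.isOpen_U.preimage (by fun_prop)
  have hmem : ∀ᶠ s : ℝ in nhds 0, (p.1.1, p.1.2 + s • u) ∈ Ω.carrier := by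
    filter_upwards [hO.mem_nhds (x := 0) (by simpa using p.2.2)] with s hs
    exact ⟨p.2.1, hs⟩
  have hp : (p.1.1, p.1.2 + (0 : ℝ) • u) = p.1 := by simp
  have e0 : ∀ g : Ω.Fn, Ω.ext g.1 (p.1.1, p.1.2 + (0 : ℝ) • u) = Ω.ev p g := fun g => by
    rw [hp]; exact Ω.ext_apply g.1 p
  have h2 := hasDerivAt_dirDeriv (Ω.dirDeriv (0, u) f) p.1.1 p.1.2 u 0 (by rw [hp]; exact p.2)
  rw [e0] at h2
  refine second_deriv_nonneg (g := fun r : ℝ => (Ω.ext f.1 (p.1.1, p.1.2 + r • u)).re) ?_ h2 ?_ ?_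
  · filter_upwards [hmem] with s hs
    exact hasDerivAt_dirDeriv f p.1.1 p.1.2 u s hs
  · rw [e0, h0]
  · filter_upwards [hmem] with s hs
    rw [Ω.ext_apply f.1 ⟨_, hs⟩]
    exact hpos ⟨_, hs⟩ rfl

/-- `∂_m∂̄_m` is a quarter of the real Laplacian in the `m`-th complex line. Only the time slice
through `p` matters. -/
theorem d_db_nonneg (f : Ω.Fn) (p : Ω.carrier) (m : Fin n)
    (hpos : ∀ q : Ω.carrier, q.1.1 = p.1.1 → 0 ≤ (Ω.ev q f).re) (h0 : (Ω.ev p f).re = 0) :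
    0 ≤ (Ω.ev p (Ω.wirt.d m (Ω.wirt.db m f))).re := by
  have h1 := dirDeriv_dirDeriv_nonneg f p (Pi.single m 1) hpos h0
  have h2 := dirDeriv_dirDeriv_nonneg f p (Pi.single m Complex.I) hpos h0
  have e : Ω.wirt.d m (Ω.wirt.db m f) = (1 / 4 : ℂ) •
      (Ω.dirDeriv (0, Pi.single m 1) (Ω.dirDeriv (0, Pi.single m 1) f) +
        Ω.dirDeriv (0, Pi.single m Complex.I) (Ω.dirDeriv (0, Pi.single m Complex.I) f)) := by
    simp only [wirt, Derivation.smul_apply, Derivation.sub_apply, Derivation.map_smul,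
      Derivation.add_apply, map_add]
    rw [Ω.dirDeriv_comm (0, Pi.single m 1) (0, Pi.single m Complex.I)]
    have hI : Complex.I • Complex.I • Ω.dirDeriv (0, Pi.single m Complex.I)
        (Ω.dirDeriv (0, Pi.single m Complex.I) f) = - Ω.dirDeriv (0, Pi.single m Complex.I)
        (Ω.dirDeriv (0, Pi.single m Complex.I) f) := by
      rw [smul_smul, Complex.I_mul_I, neg_one_smul]
    simp only [smul_add, smul_sub, hI, smul_comm Complex.I (1 / 2 : ℂ)]
    module
  rw [e, map_smul, map_add, smul_eq_mul, show (1 / 4 : ℂ) = ((1 / 4 : ℝ) : ℂ) by norm_num,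
    Complex.re_ofReal_mul, Complex.add_re]
  positivity

end SpaceTime

/-! ### Non-negative forms with a null pair -/

section QuadForm

variable {n : ℕ} (T : Fin n → Fin n → Fin n → Fin n → ℂ)

theorem quadForm_add₁ (u u' v w y : Fin n → ℂ) :
    quadForm T (u + u') v w y = quadForm T u v w y + quadForm T u' v w y := by
  simp only [quadForm, Pi.add_apply, mul_add, add_mul, Finset.sum_add_distrib]

theorem quadForm_add₂ (u v v' w y : Fin n → ℂ) :
    quadForm T u (v + v') w y = quadForm T u v w y + quadForm T u v' w y := by
  simp only [quadForm, Pi.add_apply, map_add, mul_add, add_mul, Finset.sum_add_distrib]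

theorem quadForm_add₃ (u v w w' y : Fin n → ℂ) :
    quadForm T u v (w + w') y = quadForm T u v w y + quadForm T u v w' y := by
  simp only [quadForm, Pi.add_apply, mul_add, add_mul, Finset.sum_add_distrib]

theorem quadForm_add₄ (u v w y y' : Fin n → ℂ) :
    quadForm T u v w (y + y') = quadForm T u v w y + quadForm T u v w y' := by
  simp only [quadForm, Pi.add_apply, map_add, mul_add, add_mul, Finset.sum_add_distrib]

theorem quadForm_smul₁ (c : ℂ) (u v w y : Fin n → ℂ) :
    quadForm T (c • u) v w y = c * quadForm T u v w y := by
  simp only [quadForm, Pi.smul_apply, smul_eq_mul, Finset.mul_sum]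
  refine Finset.sum_congr rfl fun i _ => Finset.sum_congr rfl fun j _ =>
    Finset.sum_congr rfl fun k _ => Finset.sum_congr rfl fun l _ => by ring

theorem quadForm_smul₂ (c : ℂ) (u v w y : Fin n → ℂ) :
    quadForm T u (c • v) w y = conj c * quadForm T u v w y := by
  simp only [quadForm, Pi.smul_apply, smul_eq_mul, Finset.mul_sum, map_mul]
  refine Finset.sum_congr rfl fun i _ => Finset.sum_congr rfl fun j _ =>
    Finset.sum_congr rfl fun k _ => Finset.sum_congr rfl fun l _ => by ring

theorem quadForm_smul₃ (c : ℂ) (u v w y : Fin n → ℂ) :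
    quadForm T u v (c • w) y = c * quadForm T u v w y := by
  simp only [quadForm, Pi.smul_apply, smul_eq_mul, Finset.mul_sum]
  refine Finset.sum_congr rfl fun i _ => Finset.sum_congr rfl fun j _ =>
    Finset.sum_congr rfl fun k _ => Finset.sum_congr rfl fun l _ => by ring

theorem quadForm_smul₄ (c : ℂ) (u v w y : Fin n → ℂ) :
    quadForm T u v w (c • y) = conj c * quadForm T u v w y := by
  simp only [quadForm, Pi.smul_apply, smul_eq_mul, Finset.mul_sum, map_mul]
  refine Finset.sum_congr rfl fun i _ => Finset.sum_congr rfl fun j _ =>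
    Finset.sum_congr rfl fun k _ => Finset.sum_congr rfl fun l _ => by ring

variable {T}

theorem conj_quadForm (hT : ∀ i j k l, conj (T i j k l) = T j i l k) (u v w y : Fin n → ℂ) :
    conj (quadForm T u v w y) = quadForm T v u y w := by
  simp only [quadForm, map_sum, map_mul, hT, Complex.conj_conj]
  rw [Finset.sum_comm]
  refine Finset.sum_congr rfl fun i _ => Finset.sum_congr rfl fun j _ => ?_
  rw [Finset.sum_comm]
  exact Finset.sum_congr rfl fun k _ => Finset.sum_congr rfl fun l _ => by ring

theorem nonneg_of_quadratic {x y : ℝ} (h : ∀ s : ℝ, 0 < s → 0 ≤ s * x + s ^ 2 * y) : 0 ≤ x := by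
  by_contra! hx
  -- For this step size the quadratic term is at most half of the negative linear term.
  have h1 := h (-x / (2 * (|y| + 1))) (by have := abs_nonneg y; apply div_pos <;> linarith)
  have hy := abs_nonneg y
  have hy2 := le_abs_self y
  set s := -x / (2 * (|y| + 1)) with hs
  have hs0 : 0 < s := by apply div_pos <;> linarith
  have h2 : s * (2 * (|y| + 1)) = -x := by rw [hs]; field_simp
  nlinarith [mul_pos hs0 hs0]

variable {ξ η : Fin n → ℂ}
  (hpos : ∀ u w : Fin n → ℂ, 0 ≤ (quadForm T u u w w).re)
  (h0 : (quadForm T ξ ξ η η).re = 0)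
include hpos h0

/-- First variation in `η`: along `η + s y` the form starts at zero and stays non-negative, so the
coefficient of `s` is non-negative. -/
theorem quadForm_re_eq_zero_of_null (hT : ∀ i j k l, conj (T i j k l) = T j i l k)
    (y : Fin n → ℂ) : 0 ≤ (quadForm T ξ ξ y η).re := by
  have h1 : ∀ s : ℝ, 0 < s →
      0 ≤ s * (2 * (quadForm T ξ ξ y η).re) + s ^ 2 * (quadForm T ξ ξ y y).re := by
    intro s _
    have := hpos ξ (η + (s : ℂ) • y)
    rw [quadForm_add₃, quadForm_add₄, quadForm_add₄, quadForm_smul₃, quadForm_smul₃,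
      quadForm_smul₄, quadForm_smul₄, ← conj_quadForm hT ξ ξ y η] at this
    simp only [Complex.add_re, Complex.conj_ofReal, Complex.re_ofReal_mul, Complex.conj_re, h0]
      at this
    linarith
  linarith [nonneg_of_quadratic h1]

/-- Apply the first variation to `y`, `-y`, `iy` and `-iy`. -/
theorem quadForm_eq_zero_of_null (hT : ∀ i j k l, conj (T i j k l) = T j i l k)
    (y : Fin n → ℂ) : quadForm T ξ ξ y η = 0 := by
  have h := quadForm_re_eq_zero_of_null hpos h0 hT
  have h1 := h y
  have h2 := h ((-1 : ℂ) • y)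
  have h3 := h (Complex.I • y)
  have h4 := h ((-Complex.I) • y)
  rw [quadForm_smul₃] at h2 h3 h4
  simp at h2 h3 h4
  apply Complex.ext <;> simp <;> linarith

/-- Second variation at the null pair, moving both vectors at once: `ξ + √s w a` and `η + √s w̄ b`,
summed over the four fourth roots of unity `w`. The sum kills the terms of odd order and those with
a factor `w²` or `w̄²`, which leaves the four stated terms at order `s`. -/
theorem quadForm_mixed_nonneg (a b : Fin n → ℂ) :
    0 ≤ (quadForm T a a η η + quadForm T ξ ξ b b + quadForm T a ξ b η +
      quadForm T ξ a η b).re := by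
  have key : ∀ s : ℝ, 0 < s → 0 ≤ s * (4 * (quadForm T a a η η + quadForm T ξ ξ b b +
      quadForm T a ξ b η + quadForm T ξ a η b).re) + s ^ 2 * (4 * (quadForm T a a b b).re) := by
    intro s hs
    have e : ∀ w : ℂ, (w = 1 ∨ w = -1 ∨ w = Complex.I ∨ w = -Complex.I) → 0 ≤ 
        (quadForm T (ξ + (√s * w) • a) (ξ + (√s * w) • a)
          (η + (√s * conj w) • b) (η + (√s * conj w) • b)).re := fun w _ => hpos _ _
    have h1 := e 1 (by simp)
    have h2 := e (-1) (by simp)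
    have h3 := e Complex.I (by simp)
    have h4 := e (-Complex.I) (by simp)
    have hss : √s * √s = s := Real.mul_self_sqrt hs.le
    set r := √s
    simp only [quadForm_add₁, quadForm_add₂, quadForm_add₃, quadForm_add₄, quadForm_smul₁,
      quadForm_smul₂, quadForm_smul₃, quadForm_smul₄, map_mul, map_neg, Complex.conj_ofReal,
      Complex.conj_conj, Complex.conj_I, map_one] at h1 h2 h3 h4
    simp only [← mul_add, mul_neg, neg_mul, mul_one, one_mul] at h1 h2 h3 h4
    generalize quadForm T ξ ξ η η = x0 at *
    generalize quadForm T a ξ η η = x1 at *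
    generalize quadForm T ξ a η η = x2 at *
    generalize quadForm T ξ ξ b η = x3 at *
    generalize quadForm T ξ ξ η b = x4 at *
    generalize quadForm T a a η η = x5 at *
    generalize quadForm T a ξ b η = x6 at *
    generalize quadForm T a ξ η b = x7 at *
    generalize quadForm T ξ a b η = x8 at *
    generalize quadForm T ξ a η b = x9 at *
    generalize quadForm T ξ ξ b b = x10 at *
    generalize quadForm T a a b η = x11 at *
    generalize quadForm T a a η b = x12 at *
    generalize quadForm T a ξ b b = x13 at *
    generalize quadForm T ξ a b b = x14 at *
    generalize quadForm T a a b b = x15 at *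
    simp only [Complex.add_re, Complex.mul_re, Complex.ofReal_re, Complex.ofReal_im, Complex.I_re,
      Complex.I_im, Complex.neg_re, Complex.neg_im, Complex.one_re, Complex.one_im, h0,
      Complex.mul_im, Complex.add_im] at h1 h2 h3 h4
    simp only [Complex.add_re]
    rw [← hss]
    linarith [h1, h2, h3, h4]
  linarith [nonneg_of_quadratic key]

end QuadForm

/-! ### A trace inequality -/

section Trace

open Matrix
open scoped ComplexOrder MatrixOrder

variable {m : Type*} [Fintype m] [DecidableEq m]

theorem posSemidef_trace_mul_nonneg {M N : Matrix m m ℂ} (hM : M.PosSemidef)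
    (hN : N.PosSemidef) : 0 ≤ (M * N).trace := by
  obtain ⟨X, rfl⟩ := CStarAlgebra.nonneg_iff_eq_star_mul_self.1 hM.nonneg
  rw [star_eq_conjTranspose]
  rw [Matrix.mul_assoc, Matrix.trace_mul_comm]
  exact (hN.mul_mul_conjTranspose_same X).trace_nonneg

theorem trace_blocks {m : Type*} [Fintype m] (A B C D : Matrix m m ℂ) :
    (fromBlocks A B C D).trace = A.trace + D.trace := by
  simp [Matrix.trace]

/-- If the block matrix `[[A, B], [Bᴴ, Cᵀ]]` is positive semidefinite then
`tr (B B̄) ≤ tr (A C)`. -/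
theorem trace_mul_sub_nonneg {A B C : Matrix m m ℂ}
    (h : (fromBlocks A B Bᴴ Cᵀ).PosSemidef) :
    0 ≤ ((A * C).trace - (B * Bᵀᴴ).trace).re := by
  -- Transpose the block matrix and conjugate it by the symplectic matrix. The trace of the product
  -- of the original matrix with this one is non-negative and equals twice the real part in
  -- question.
  have hN : (fromBlocks C (-Bᵀ) (-Bᴴᵀ) Aᵀ).PosSemidef := by
    have := h.transpose.mul_mul_conjTranspose_same (fromBlocks 0 1 (-1) 0 : Matrix (m ⊕ m) (m ⊕ m) ℂ)
    simpa [fromBlocks_transpose, fromBlocks_conjTranspose, fromBlocks_multiply] using this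
  have h2 := (Complex.le_def.1 (posSemidef_trace_mul_nonneg h hN)).1
  rw [fromBlocks_multiply, trace_blocks, trace_add, trace_add] at h2
  have e1 : (B * -Bᴴᵀ).trace = -(B * Bᵀᴴ).trace := by
    rw [Matrix.mul_neg, trace_neg]; rfl
  have e2 : (Bᴴ * -Bᵀ).trace = -conj (B * Bᵀᴴ).trace := by
    rw [Matrix.mul_neg, trace_neg, trace_mul_comm, ← Complex.star_def, ← trace_conjTranspose,
      conjTranspose_mul, conjTranspose_conjTranspose]
  have e3 : (Cᵀ * Aᵀ).trace = (A * C).trace := by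
    rw [← transpose_mul, trace_transpose]
  rw [e1, e2, e3] at h2
  simp at h2
  simp
  linarith

variable {n : ℕ} {T : Fin n → Fin n → Fin n → Fin n → ℂ} {ξ η : Fin n → ℂ}

theorem quadForm_eq_sum₁₂ (a b w y : Fin n → ℂ) : quadForm T a b w y =
    ∑ p, ∑ q, quadForm T (basisVec p) (basisVec q) w y * a p * conj (b q) := by
  simp only [quadForm, basisVec, Pi.single_apply, Finset.sum_mul]
  simp
  refine Finset.sum_congr rfl fun i _ => Finset.sum_congr rfl fun j _ =>
    Finset.sum_congr rfl fun k _ => Finset.sum_congr rfl fun l _ => by ring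

theorem quadForm_swap (u v w y : Fin n → ℂ) : quadForm (fun i j k l => T k l i j) u v w y =
    quadForm T w y u v := by
  have e : ∀ F : Fin n → Fin n → Fin n → Fin n → ℂ, ∑ i, ∑ j, ∑ k, ∑ l, F i j k l =
      ∑ k, ∑ l, ∑ i, ∑ j, F i j k l := fun F => by
    simp only [← Finset.sum_product']
    exact (Finset.sum_bij' (fun x _ => ((x.2.2.1, x.2.2.2, x.1, x.2.1) : _ × _ × _ × _))
      (fun x _ => (x.2.2.1, x.2.2.2, x.1, x.2.1)) (by simp) (by simp) (by simp) (by simp)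
      (by simp))
  simp only [quadForm]
  rw [e]
  refine Finset.sum_congr rfl fun i _ => Finset.sum_congr rfl fun j _ =>
    Finset.sum_congr rfl fun k _ => Finset.sum_congr rfl fun l _ => by ring

theorem quadForm_eq_sum₃₄ (a b w y : Fin n → ℂ) : quadForm T a b w y =
    ∑ p, ∑ q, quadForm T a b (basisVec p) (basisVec q) * w p * conj (y q) := by
  rw [← quadForm_swap, quadForm_eq_sum₁₂]
  simp only [quadForm_swap]

theorem quadForm_eq_sum₁₃ (a b w y : Fin n → ℂ) : quadForm T a b w y =
    ∑ p, ∑ q, quadForm T (basisVec p) b (basisVec q) y * a p * w q := by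
  simp only [quadForm, basisVec, Pi.single_apply, Finset.sum_mul]
  simp
  refine Finset.sum_congr rfl fun i _ => ?_
  rw [Finset.sum_comm]
  refine Finset.sum_congr rfl fun j _ =>
    Finset.sum_congr rfl fun k _ => Finset.sum_congr rfl fun l _ => by ring

/-- The second-order inequality at a null pair of a non-negative Hermitian form. -/
theorem null_trace_nonneg (hT : ∀ i j k l, conj (T i j k l) = T j i l k)
    (hpos : ∀ u w : Fin n → ℂ, 0 ≤ (quadForm T u u w w).re)
    (h0 : (quadForm T ξ ξ η η).re = 0) :
    0 ≤ (∑ p, ∑ q, quadForm T (basisVec p) (basisVec q) η η *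
        quadForm T ξ ξ (basisVec q) (basisVec p) -
      ∑ p, ∑ q, quadForm T (basisVec p) ξ (basisVec q) η *
        conj (quadForm T (basisVec q) ξ (basisVec p) η)).re := by
  set A : Matrix (Fin n) (Fin n) ℂ := of fun p q => quadForm T (basisVec p) (basisVec q) η η with hA
  set B : Matrix (Fin n) (Fin n) ℂ := of fun p q => quadForm T (basisVec p) ξ (basisVec q) η with hB
  set C : Matrix (Fin n) (Fin n) ℂ := of fun p q => quadForm T ξ ξ (basisVec p) (basisVec q) with hC
  have hAh : A.IsHermitian := by
    ext p q; exact conj_quadForm hT _ _ _ _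
  have hCh : Cᵀ.IsHermitian := by
    ext p q; exact conj_quadForm hT _ _ _ _
  have hH : (fromBlocks A B Bᴴ Cᵀ).IsHermitian := by
    rw [IsHermitian, fromBlocks_conjTranspose, conjTranspose_conjTranspose, hAh.eq, hCh.eq]
  -- The quadratic form of this block matrix at `x` is the second variation at the null pair, with
  -- `a` the conjugate of the first half of `x` and `b` the second half.
  have hM : (fromBlocks A B Bᴴ Cᵀ).PosSemidef := by
    refine PosSemidef.of_dotProduct_mulVec_nonneg hH fun x => ?_
    have him := hH.im_star_dotProduct_mulVec_self x
    have e : star x ⬝ᵥ (fromBlocks A B Bᴴ Cᵀ *ᵥ x) =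
        quadForm T (fun p => conj (x (Sum.inl p))) (fun p => conj (x (Sum.inl p))) η η +
        quadForm T ξ ξ (fun p => x (Sum.inr p)) (fun p => x (Sum.inr p)) +
        quadForm T (fun p => conj (x (Sum.inl p))) ξ (fun p => x (Sum.inr p)) η +
        quadForm T ξ (fun p => conj (x (Sum.inl p))) η (fun p => x (Sum.inr p)) := by
      rw [← conj_quadForm hT (fun p => conj (x (Sum.inl p))) ξ (fun p => x (Sum.inr p)) η,
        quadForm_eq_sum₁₂ (T := T) _ _ η η, quadForm_eq_sum₃₄ (T := T) ξ ξ,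
        quadForm_eq_sum₁₃ (T := T) _ ξ _ η]
      simp only [dotProduct, mulVec, Fintype.sum_sum_type, fromBlocks_apply₁₁, fromBlocks_apply₁₂,
        fromBlocks_apply₂₁, fromBlocks_apply₂₂, mul_add, Finset.sum_add_distrib, Finset.mul_sum,
        hA, hB, hC, of_apply, transpose_apply, conjTranspose_apply, Pi.star_apply, map_sum, map_mul,
        Complex.star_def, Complex.conj_conj]
      have : ∀ a b c d a' b' c' d' : ℂ, a = a' → b = b' → c = c' → d = d' → 
        a + b + (c + d) = a' + d' + c' + b' := by rintro a b c d _ _ _ _ rfl rfl rfl rfl; ring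
      apply this
      · exact Finset.sum_congr rfl fun i _ => Finset.sum_congr rfl fun j _ => by ring
      · rw [Finset.sum_comm]
        exact Finset.sum_congr rfl fun i _ => Finset.sum_congr rfl fun j _ => by ring
      · exact Finset.sum_congr rfl fun i _ => Finset.sum_congr rfl fun j _ => by ring
      · rw [Finset.sum_comm]
        exact Finset.sum_congr rfl fun i _ => Finset.sum_congr rfl fun j _ => by ring
    rw [Complex.le_def]
    refine ⟨?_, him.symm⟩
    rw [e]
    exact quadForm_mixed_nonneg hpos h0 _ _
  have := trace_mul_sub_nonneg hM
  simpa only [hA, hB, hC, Matrix.trace, Matrix.mul_apply, diag_apply, of_apply,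
    conjTranspose_apply, transpose_apply, Complex.star_def] using this

end Trace

/-! ### Null pairs of the perturbed form, with errors of order `|c|` -/

section Perturbed

variable {n : ℕ} {T : Fin n → Fin n → Fin n → Fin n → ℂ} {ξ η : Fin n → ℂ} {c β : ℝ}

theorem norm_sum_fin_le {f : Fin n → ℂ} {b : ℝ} (h : ∀ i, ‖f i‖ ≤ b) : ‖∑ i, f i‖ ≤ n * b := by
  refine (norm_sum_le_of_le _ fun i _ => h i).trans ?_
  simp

theorem norm_mul_le_of_le' {x y : ℂ} {a b : ℝ} (hx : ‖x‖ ≤ a) (hy : ‖y‖ ≤ b) : ‖x * y‖ ≤ a * b := by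
  rw [norm_mul]
  exact mul_le_mul hx hy (norm_nonneg _) ((norm_nonneg _).trans hx)

theorem norm_quadForm_le {u v w y : Fin n → ℂ} (hT : ∀ i j k l, ‖T i j k l‖ ≤ β)
    (hu : ∀ i, ‖u i‖ ≤ 1) (hv : ∀ i, ‖v i‖ ≤ 1) (hw : ∀ i, ‖w i‖ ≤ 1) (hy : ∀ i, ‖y i‖ ≤ 1) :
    ‖quadForm T u v w y‖ ≤ n * (n * (n * (n * β))) := by
  refine norm_sum_fin_le fun i => norm_sum_fin_le fun j => norm_sum_fin_le fun k =>
    norm_sum_fin_le fun l => ?_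
  have := norm_mul_le_of_le' (norm_mul_le_of_le' (norm_mul_le_of_le' (norm_mul_le_of_le'
    (hT i j k l) (hu i)) (((RCLike.norm_conj (v j)).le).trans (hv j))) (hw k))
    (((RCLike.norm_conj (y l)).le).trans (hy l))
  simpa using this

theorem norm_basisVec_le (p i : Fin n) : ‖basisVec p i‖ ≤ 1 := by
  by_cases h : i = p
  · subst h; simp [basisVec]
  · simp [basisVec, h]

/-- The form `T` with a multiple of the product of the standard Hermitian forms added. -/
def perturb (T : Fin n → Fin n → Fin n → Fin n → ℂ) (c : ℝ) : Fin n → Fin n → Fin n → Fin n → ℂ :=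
  fun i j k l => T i j k l + c * ((if i = j then 1 else 0) * (if k = l then 1 else 0))

theorem quadForm_perturb (u v w y : Fin n → ℂ) : quadForm (perturb T c) u v w y =
    quadForm T u v w y + c * ((∑ i, u i * conj (v i)) * ∑ k, w k * conj (y k)) := by
  simp only [quadForm, perturb, add_mul, Finset.sum_add_distrib]
  congr 1
  simp only [Finset.sum_mul, Finset.mul_sum, mul_ite, ite_mul, mul_one, mul_zero, zero_mul,
    Finset.sum_ite_eq, Finset.mem_univ, if_true]
  simp only [Finset.sum_ite_irrel, Finset.sum_const_zero, Finset.sum_ite_eq, Finset.mem_univ,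
    if_true]
  rw [Finset.sum_comm]
  refine Finset.sum_congr rfl fun i _ => Finset.sum_congr rfl fun j _ => by ring

theorem perturb_conj (hT : ∀ i j k l, conj (T i j k l) = T j i l k) (i j k l : Fin n) :
    conj (perturb T c i j k l) = perturb T c j i l k := by
  simp only [perturb, map_add, hT, map_mul, Complex.conj_ofReal, eq_comm (a := i),
    eq_comm (a := k)]
  split_ifs <;> simp

theorem sum_basisVec_mul (p : Fin n) (v : Fin n → ℂ) : ∑ i, basisVec p i * v i = v p := by
  simp [basisVec, Pi.single_apply]

section

variable (hT : ∀ i j k l, conj (T i j k l) = T j i l k) (hc : |c| ≤ 1)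
  (hξ : ∑ i, ξ i * conj (ξ i) = 1) (hη : ∑ i, η i * conj (η i) = 1)
  (hpos : ∀ u w : Fin n → ℂ, 0 ≤ (quadForm (perturb T c) u u w w).re)
  (h0 : (quadForm (perturb T c) ξ ξ η η).re = 0)

-- The first variation holds for the perturbed form. Removing the perturbation leaves an explicit
-- remainder of order `c`, which makes the `N`-terms of the evolution formula small.
include hT hpos h0 hξ in
theorem quadForm_null_perturb (a : Fin n) :
    quadForm T ξ ξ (basisVec a) η = - (c * conj (η a)) := by
  have := quadForm_eq_zero_of_null hpos h0 (perturb_conj hT) (basisVec a)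
  rw [quadForm_perturb, hξ, sum_basisVec_mul a (fun i => conj (η i)), one_mul] at this
  exact eq_neg_of_add_eq_zero_left this

theorem norm_le_one_of_sum {ξ : Fin n → ℂ} (hξ : ∑ i, ξ i * conj (ξ i) = 1) (i : Fin n) :
    ‖ξ i‖ ≤ 1 := by
  have h1 : ∑ i, ‖ξ i‖ ^ 2 = 1 := by
    have : ((∑ i, ‖ξ i‖ ^ 2 : ℝ) : ℂ) = 1 := by
      rw [← hξ]; push_cast
      exact Finset.sum_congr rfl fun i _ => (RCLike.mul_conj (ξ i)).symm
    exact_mod_cast this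
  have h2 : ‖ξ i‖ ^ 2 ≤ 1 := by
    rw [← h1]
    exact Finset.single_le_sum (f := fun i => ‖ξ i‖ ^ 2) (fun _ _ => by positivity)
      (Finset.mem_univ i)
  exact (sq_le_one_iff₀ (norm_nonneg _)).1 h2

-- The trace inequality holds for the perturbed form; expanding it in `c` leaves a linear term,
-- controlled by the bound on `T`, and a quadratic one, absorbed by `|c| ≤ 1`. The factor `4`
-- collects two mixed products from each of the two traces.
include hT hpos h0 hξ hη hc in
theorem null_trace_perturb (hβ : ∀ i j k l, ‖T i j k l‖ ≤ β) :
    - (|c| * (4 * (n * (n * (n * (n * (n * (n * β)))))) + n ^ 2 + n)) ≤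
    (∑ p, ∑ q, quadForm T (basisVec p) (basisVec q) η η *
        quadForm T ξ ξ (basisVec q) (basisVec p) -
      ∑ p, ∑ q, quadForm T (basisVec p) ξ (basisVec q) η *
        conj (quadForm T (basisVec q) ξ (basisVec p) η)).re := by
  have key := null_trace_nonneg (perturb_conj hT) hpos h0
  have hξ1 := norm_le_one_of_sum hξ
  have hη1 := norm_le_one_of_sum hη
  have hcc : |c| ^ 2 ≤ |c| := by nlinarith [abs_nonneg c]
  have hcn : ‖(c : ℂ)‖ = |c| := by simp
  have d : ∀ p q : Fin n, ∑ i, basisVec p i * conj (basisVec q i) = if p = q then 1 else 0 := by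
    intro p q
    rw [sum_basisVec_mul p (fun i => conj (basisVec q i))]
    simp only [basisVec, Pi.single_apply]
    split_ifs <;> simp
  have e1 : ∑ p, ∑ q, quadForm (perturb T c) (basisVec p) (basisVec q) η η *
        quadForm (perturb T c) ξ ξ (basisVec q) (basisVec p) =
      ∑ p, ∑ q, quadForm T (basisVec p) (basisVec q) η η *
        quadForm T ξ ξ (basisVec q) (basisVec p) +
      (c * ∑ p, (quadForm T (basisVec p) (basisVec p) η η +
        quadForm T ξ ξ (basisVec p) (basisVec p)) + c * c * n) := by
    simp only [quadForm_perturb, hξ, hη, d, mul_one, one_mul]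
    have : ∀ p q, (quadForm T (basisVec p) (basisVec q) η η + c * (if p = q then 1 else 0)) *
        (quadForm T ξ ξ (basisVec q) (basisVec p) + c * (if q = p then 1 else 0)) =
        quadForm T (basisVec p) (basisVec q) η η * quadForm T ξ ξ (basisVec q) (basisVec p) +
        (if p = q then c * (quadForm T (basisVec p) (basisVec p) η η +
          quadForm T ξ ξ (basisVec p) (basisVec p)) + c * c else 0) := by
      intro p q
      by_cases h : p = q
      · subst h; simp; ring
      · simp [h, Ne.symm h]
    simp only [this, Finset.sum_add_distrib, Finset.sum_ite_eq, Finset.mem_univ, if_true,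
      Finset.mul_sum, mul_add]
    simp
    ring
  have e2 : ∑ p, ∑ q, quadForm (perturb T c) (basisVec p) ξ (basisVec q) η *
        conj (quadForm (perturb T c) (basisVec q) ξ (basisVec p) η) =
      ∑ p, ∑ q, quadForm T (basisVec p) ξ (basisVec q) η *
        conj (quadForm T (basisVec q) ξ (basisVec p) η) +
      (c * ∑ p, ∑ q, (quadForm T (basisVec p) ξ (basisVec q) η * (ξ q * η p) +
        conj (ξ p) * conj (η q) * conj (quadForm T (basisVec q) ξ (basisVec p) η)) +
        c * c * ∑ p, ∑ q, conj (ξ p) * conj (η q) * (ξ q * η p)) := by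
    have g : ∀ (p : Fin n) (v : Fin n → ℂ), ∑ i, basisVec p i * conj (v i) = conj (v p) :=
      fun p v => sum_basisVec_mul p (fun i => conj (v i))
    simp only [quadForm_perturb, g, Finset.mul_sum, ← Finset.sum_add_distrib]
    refine Finset.sum_congr rfl fun p _ => Finset.sum_congr rfl fun q _ => ?_
    simp only [map_add, map_mul, Complex.conj_conj, Complex.conj_ofReal]
    ring
  rw [e1, e2] at key
  set Q := (n : ℝ) * (n * (n * (n * β)))
  have b := fun {u v w y : Fin n → ℂ} => norm_quadForm_le (u := u) (v := v) (w := w) (y := y) hβ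
  have cj : ∀ {x : ℂ} {r : ℝ}, ‖x‖ ≤ r → ‖conj x‖ ≤ r := fun h => by rwa [RCLike.norm_conj]
  have n1 : ‖∑ p, (quadForm T (basisVec p) (basisVec p) η η +
        quadForm T ξ ξ (basisVec p) (basisVec p))‖ ≤ n * (Q + Q) :=
    norm_sum_fin_le fun p => norm_add_le_of_le
      (b (norm_basisVec_le p) (norm_basisVec_le p) hη1 hη1)
      (b hξ1 hξ1 (norm_basisVec_le p) (norm_basisVec_le p))
  have n2 : ‖∑ p, ∑ q, (quadForm T (basisVec p) ξ (basisVec q) η * (ξ q * η p) +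
        conj (ξ p) * conj (η q) * conj (quadForm T (basisVec q) ξ (basisVec p) η))‖ ≤
      n * (n * (Q * (1 * 1) + 1 * 1 * Q)) :=
    norm_sum_fin_le fun p => norm_sum_fin_le fun q => norm_add_le_of_le
      (norm_mul_le_of_le' (b (norm_basisVec_le p) hξ1 (norm_basisVec_le q) hη1)
        (norm_mul_le_of_le' (hξ1 q) (hη1 p)))
      (norm_mul_le_of_le' (norm_mul_le_of_le' (cj (hξ1 p)) (cj (hη1 q)))
        (cj (b (norm_basisVec_le q) hξ1 (norm_basisVec_le p) hη1)))
  have n3 : ‖∑ p, ∑ q, conj (ξ p) * conj (η q) * (ξ q * η p)‖ ≤ n * (n * (1 * 1 * (1 * 1))) :=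
    norm_sum_fin_le fun p => norm_sum_fin_le fun q => 
      (norm_mul_le_of_le' (norm_mul_le_of_le' (cj (hξ1 p)) (cj (hη1 q)))
        (norm_mul_le_of_le' (hξ1 q) (hη1 p)))
  generalize (∑ p, (quadForm T (basisVec p) (basisVec p) η η +
        quadForm T ξ ξ (basisVec p) (basisVec p))) = x1 at *
  generalize (∑ p, ∑ q, (quadForm T (basisVec p) ξ (basisVec q) η * (ξ q * η p) +
        conj (ξ p) * conj (η q) * conj (quadForm T (basisVec q) ξ (basisVec p) η))) = x2 at *
  generalize (∑ p, ∑ q, conj (ξ p) * conj (η q) * (ξ q * η p)) = x3 at *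
  generalize (∑ p, ∑ q, quadForm T (basisVec p) (basisVec q) η η *
        quadForm T ξ ξ (basisVec q) (basisVec p)) = y1 at *
  generalize (∑ p, ∑ q, quadForm T (basisVec p) ξ (basisVec q) η *
        conj (quadForm T (basisVec q) ξ (basisVec p) η)) = y2 at *
  -- In dimension zero there is no index from which to deduce `0 ≤ β`, so that case is separate.
  have hQ : 0 ≤ n * (n * Q) ∧ n * Q ≤ n * (n * Q) := by
    rcases Nat.eq_zero_or_pos n with rfl | hn
    · simp
    · have hβ0 : 0 ≤ β := (norm_nonneg _).trans (hβ ⟨0, hn⟩ ⟨0, hn⟩ ⟨0, hn⟩ ⟨0, hn⟩)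
      have : (1 : ℝ) ≤ n := by exact_mod_cast hn
      have : 0 ≤ n * Q := by positivity
      constructor <;> nlinarith
  have hfin : ‖(c * x1 + c * c * n) - (c * x2 + c * c * x3)‖ ≤
      |c| * (4 * (n * (n * Q)) + n ^ 2 + n) := by
    have t1 := norm_mul_le_of_le' hcn.le n1
    have t2 := norm_mul_le_of_le' hcn.le n2
    have t3 := norm_mul_le_of_le' (norm_mul_le_of_le' hcn.le hcn.le) n3
    have t4 := norm_mul_le_of_le' (norm_mul_le_of_le' hcn.le hcn.le) 
      (by simp : ‖(n : ℂ)‖ ≤ n)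
    have t5 : |c| * |c| * n ≤ |c| * n := by
      rw [← sq]; exact mul_le_mul_of_nonneg_right hcc (Nat.cast_nonneg n)
    have t6 : |c| * |c| * (n * (n * (1 * 1 * (1 * 1)))) ≤ |c| * n ^ 2 := by
      rw [← sq]; ring_nf; 
      exact mul_le_mul_of_nonneg_right hcc (by positivity)
    have t7 := mul_le_mul_of_nonneg_left hQ.2 (abs_nonneg c)
    refine (norm_sub_le_of_le (norm_add_le_of_le t1 t4) (norm_add_le_of_le t2 t3)).trans ?_
    nlinarith
  have := (Complex.abs_re_le_norm _).trans hfin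
  have := (abs_le.1 this).2
  simp only [Complex.sub_re, Complex.add_re] at this key ⊢
  linarith

end

end Perturbed

/-! ### Bounds for jets at a point -/

section JetBound

variable {n : ℕ} {R : Type*} [CommRing R] [StarRing R] [Algebra ℂ R] [StarModule ℂ R]
  {W : WirtingerRing n R} {ev : R →ₐ[ℂ] ℂ} {k h P : Matrix (Fin n) (Fin n) R}

/-- Bounds for a function and its derivatives `∂_m`, `∂̄_m`, `∂_m ∂̄_m` at a point. -/
structure JetBound (W : WirtingerRing n R) (ev : R →ₐ[ℂ] ℂ) (m : Fin n) (f : R) (b : ℝ) :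
    Prop where
  val : ‖ev f‖ ≤ b
  d : ‖ev (W.d m f)‖ ≤ b
  db : ‖ev (W.db m f)‖ ≤ b
  ddb : ‖ev (W.d m (W.db m f))‖ ≤ b

namespace JetBound

variable {m : Fin n} {f g : R} {b b' : ℝ}

theorem mono (hf : JetBound W ev m f b) (hb : b ≤ b') : JetBound W ev m f b' :=
  ⟨hf.val.trans hb, hf.d.trans hb, hf.db.trans hb, hf.ddb.trans hb⟩

theorem nonneg (hf : JetBound W ev m f b) : 0 ≤ b := (norm_nonneg _).trans hf.val

theorem star (hev : ∀ x, ev (star x) = conj (ev x)) (hf : JetBound W ev m f b) :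
    JetBound W ev m (Star.star f) b := by
  refine ⟨?_, ?_, ?_, ?_⟩
  · rw [hev, RCLike.norm_conj]; exact hf.val
  · rw [← W.star_db, hev, RCLike.norm_conj]; exact hf.db
  · rw [← W.star_d, hev, RCLike.norm_conj]; exact hf.d
  · rw [W.d_db, ← W.star_db, ← W.star_d, hev, RCLike.norm_conj]; exact hf.ddb

/-- The factor `4` is the number of terms of `∂∂̄` applied to a product. -/
theorem mul (hf : JetBound W ev m f b) (hg : JetBound W ev m g b') :
    JetBound W ev m (f * g) (4 * (b * b')) := by
  have hb := mul_nonneg hf.nonneg hg.nonneg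
  have sw : b' * b = b * b' := mul_comm _ _
  refine ⟨?_, ?_, ?_, ?_⟩
  · rw [map_mul]
    linarith [norm_mul_le_of_le' hf.val hg.val]
  · rw [Derivation.leibniz, smul_eq_mul, smul_eq_mul, map_add, map_mul, map_mul]
    linarith [norm_add_le_of_le (norm_mul_le_of_le' hf.val hg.d) (norm_mul_le_of_le' hg.val hf.d)]
  · rw [Derivation.leibniz, smul_eq_mul, smul_eq_mul, map_add, map_mul, map_mul]
    linarith [norm_add_le_of_le (norm_mul_le_of_le' hf.val hg.db) (norm_mul_le_of_le' hg.val hf.db)]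
  · simp only [Derivation.leibniz, smul_eq_mul, map_add, map_mul]
    linarith [norm_add_le_of_le
      (norm_add_le_of_le (norm_mul_le_of_le' hf.val hg.ddb) (norm_mul_le_of_le' hg.db hf.d))
      (norm_add_le_of_le (norm_mul_le_of_le' hg.val hf.ddb) (norm_mul_le_of_le' hf.db hg.d))]

theorem sum {f : Fin n → R} (hf : ∀ i, JetBound W ev m (f i) b) :
    JetBound W ev m (∑ i, f i) (n * b) := by
  refine ⟨?_, ?_, ?_, ?_⟩ <;> simp only [map_sum] <;> refine norm_sum_fin_le fun i => ?_
  exacts [(hf i).val, (hf i).d, (hf i).db, (hf i).ddb]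

end JetBound

/-- The function `∑ h_{i j̄} Ξ^i Ξ̄^j`. -/
def metricFn (h : Matrix (Fin n) (Fin n) R) (Ξ : Fin n → R) : R :=
  ∑ i, ∑ j, h i j * Ξ i * star (Ξ j)

theorem JetBound.metricFn (hev : ∀ x, ev (Star.star x) = conj (ev x)) {m : Fin n} {Ξ : Fin n → R}
    {b b' : ℝ} (hh : ∀ i j, JetBound W ev m (h i j) b) (hΞ : ∀ i, JetBound W ev m (Ξ i) b') :
    JetBound W ev m (metricFn h Ξ) (n * (n * (4 * (4 * (b * b') * b')))) :=
  .sum fun i => .sum fun j => ((hh i j).mul (hΞ i)).mul ((hΞ j).star hev)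

theorem curvAt_eq_sum (u v : Fin n → ℂ) : curvAt W ev k u v =
    ∑ i, ∑ j, (u i * conj (v j)) • curvAt W ev k (basisVec i) (basisVec j) := by
  conv_lhs => rw [eq_sum_single u, curvAt_sum_left]
  refine Finset.sum_congr rfl fun i _ => ?_
  conv_lhs => rw [eq_sum_single v, curvAt_sum_right]
  simp only [Finset.smul_sum, smul_smul]

theorem con_curvAt (u v w y : Fin n → ℂ) : con w y (curvAt W ev k u v) =
    quadForm (fun i j c d => curvAt W ev k (basisVec i) (basisVec j) c d) u v w y := by
  rw [curvAt_eq_sum, con_apply, quadForm]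
  simp only [Matrix.sum_apply, Matrix.smul_apply, smul_eq_mul, Finset.mul_sum]
  symm
  rw [sum_sum_comm_sum]
  refine Finset.sum_congr rfl fun c _ => ?_
  rw [sum_sum_comm_sum]
  refine Finset.sum_congr rfl fun d _ => Finset.sum_congr rfl fun i _ =>
    Finset.sum_congr rfl fun j _ => ?_
  ring

theorem con_basisVec_left (p : Fin n) (v : Fin n → ℂ) (M : Matrix (Fin n) (Fin n) ℂ) :
    con (basisVec p) v M = ∑ l, conj (v l) * M p l := by
  rw [con_apply, Finset.sum_eq_single p]
  · simp [basisVec]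
  · intro b _ hb
    simp [basisVec, hb]
  · simp

theorem con_basisVec (p q : Fin n) (M : Matrix (Fin n) (Fin n) ℂ) :
    con (basisVec p) (basisVec q) M = M p q := by
  rw [con_basisVec_left, Finset.sum_eq_single q]
  · simp [basisVec]
  · intro b _ hb
    simp [basisVec, hb]
  · simp

theorem norm_con_le {u v : Fin n → ℂ} {M : Matrix (Fin n) (Fin n) ℂ} {b : ℝ}
    (hu : ∀ i, ‖u i‖ ≤ 1) (hv : ∀ i, ‖v i‖ ≤ 1) (hM : ∀ i j, ‖M i j‖ ≤ b) :
    ‖con u v M‖ ≤ n * (n * b) := by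
  rw [con_apply]
  refine norm_sum_fin_le fun i => norm_sum_fin_le fun j => ?_
  have := norm_mul_le_of_le' (norm_mul_le_of_le' (hu i) (((RCLike.norm_conj (v j)).le).trans (hv j)))
    (hM i j)
  simpa using this

theorem norm_one_apply_le (i j : Fin n) : ‖(1 : Matrix (Fin n) (Fin n) ℂ) i j‖ ≤ 1 := by
  rw [Matrix.one_apply]; split_ifs <;> simp

theorem re_sum_mul_conj_nonneg {ι : Type*} (s : Finset ι) (f : ι → ℂ) :
    0 ≤ (∑ i ∈ s, f i * conj (f i)).re := by
  rw [Complex.re_sum]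
  refine Finset.sum_nonneg fun i _ => ?_
  rw [Complex.mul_conj, Complex.ofReal_re]
  exact Complex.normSq_nonneg _

/-- The decisive role of the coefficient `½` in `Q`: its contribution cancels the bad term `-|B|²`
of the evolution formula and leaves the twisted product that the trace inequality controls. -/
theorem half_sum_sub_mul_conj (B : Matrix (Fin n) (Fin n) ℂ) :
    (1 / 2) * ∑ p, ∑ q, (B p q - B q p) * conj (B p q - B q p) =
      ∑ p, ∑ q, B p q * conj (B p q) - ∑ p, ∑ q, B p q * conj (B q p) := by
  have e1 : ∑ p, ∑ q, B q p * conj (B q p) = ∑ p, ∑ q, B p q * conj (B p q) := Finset.sum_comm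
  have e2 : ∑ p, ∑ q, B q p * conj (B p q) = ∑ p, ∑ q, B p q * conj (B q p) := Finset.sum_comm
  have e : ∀ p q, (B p q - B q p) * conj (B p q - B q p) = B p q * conj (B p q) +
      B q p * conj (B q p) - B p q * conj (B q p) - B q p * conj (B p q) := fun p q => by
    rw [map_sub]; ring
  simp only [e, Finset.sum_add_distrib, Finset.sum_sub_distrib, e1, e2]
  ring

end JetBound

/-! ### The lower bound for the time derivative at a null pair -/

section LowerBound

variable {n : ℕ} {R : Type*} [CommRing R] [StarRing R] [Algebra ℂ R] [StarModule ℂ R]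
  {W : WirtingerRing n R} {ev : R →ₐ[ℂ] ℂ} {k h P : Matrix (Fin n) (Fin n) R}
  {β : ℝ}

section

variable (hg : IsGauge W ev h P k) (hk : IsNormalAt W ev k) (hherm : h.conjTranspose = h)
  (hβ : 1 ≤ β) (hΓ : ∀ m i j, ‖ev (W.d m (h i j))‖ ≤ β)
  (hO : ∀ i j c d, ‖curvAt W ev k (basisVec i) (basisVec j) c d‖ ≤ β)
include hg hk

theorem IsGauge.ev_h : ev.mapMatrix h = 1 := by
  have := congrArg ev.mapMatrix hg.eq
  rwa [map_mul, map_mul, mapMatrix_transpose, hg.one, hg.star_one hk.conj_ev, hk.one,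
    Matrix.transpose_one, one_mul, mul_one, eq_comm] at this

theorem IsGauge.ev_curvM (u v : Fin n → ℂ) :
    ev.mapMatrix (curvM (W.D u) (W.Db v) h) = curvAt W ev k u v := by
  have := congrArg ev.mapMatrix (hg.curvM_eq u v)
  rwa [hk.ev_curvM, map_mul, map_mul, mapMatrix_transpose, hg.one, hg.star_one hk.conj_ev,
    Matrix.transpose_one, one_mul, mul_one, eq_comm] at this

-- In the coordinate frame the mixed second derivative of the metric is `-Ω + ∂h ∂̄h`, whence the
-- additional `n β²`.
include hherm hβ hΓ hO in
theorem IsGauge.jetBound_h (m i j : Fin n) : JetBound W ev m (h i j) (β + n * (β * β)) := by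
  have hn : 0 ≤ (n : ℝ) * (β * β) := by positivity
  have hdb : ∀ i j, ‖ev (W.db m (h i j))‖ ≤ β := by
    intro i j
    have : h i j = star (h j i) := (congrFun (congrFun hherm i) j).symm
    rw [this, ← W.star_d, hk.conj_ev, RCLike.norm_conj]
    exact hΓ _ _ _
  refine ⟨?_, ?_, ?_, ?_⟩
  · have : ev (h i j) = (1 : Matrix (Fin n) (Fin n) ℂ) i j := congrFun (congrFun (hg.ev_h hk) i) j
    rw [this]
    linarith [norm_one_apply_le i j]
  · linarith [hΓ m i j]
  · linarith [hdb i j]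
  · have h1 := congrFun (congrFun (hg.ev_curvM hk (basisVec m) (basisVec m)) i) j
    rw [W.D_single, W.Db_single] at h1
    have h2 : ev.mapMatrix (mapD (W.d m) (mapD (W.db m) h)) =
        - ev.mapMatrix (curvM (W.d m) (W.db m) h) +
          ev.mapMatrix (mapD (W.d m) h) * ev.mapMatrix (mapD (W.db m) h) := by
      simp only [curvM, map_add, map_neg, map_mul, HermitianFlow.ev_inv h hg.unit_h (hg.ev_h hk),
        mul_one]
      abel
    have h3 := congrFun (congrFun h2 i) j
    have h4 : ev (W.d m (W.db m (h i j))) = - curvAt W ev k (basisVec m) (basisVec m) i j +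
        ∑ a, ev (W.d m (h i a)) * ev (W.db m (h a j)) := by
      rw [← h1, ← Matrix.neg_apply]
      refine h3.trans ?_
      rw [Matrix.add_apply, Matrix.mul_apply]
      rfl
    rw [h4]
    refine norm_add_le_of_le ?_ (norm_sum_fin_le fun a => norm_mul_le_of_le' (hΓ _ _ _) (hdb _ _))
    rw [norm_neg]; exact hO _ _ _ _

include hβ hO in
theorem IsNormalAt.jetBound_k (m i j : Fin n) : JetBound W ev m (k i j) β := by
  refine ⟨?_, ?_, ?_, ?_⟩
  · have : ev (k i j) = (1 : Matrix (Fin n) (Fin n) ℂ) i j := congrFun (congrFun hk.one i) j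
    rw [this]
    exact (norm_one_apply_le i j).trans hβ
  · have : ev (W.d m (k i j)) = 0 := congrFun (congrFun (hk.ev_d m) i) j
    rw [this, norm_zero]; linarith
  · have h1 := hk.ev_Db (basisVec m)
    rw [W.Db_single] at h1
    have : ev (W.db m (k i j)) = 0 := congrFun (congrFun h1 i) j
    rw [this, norm_zero]; linarith
  · have h1 := hk.ev_DDb (basisVec m) (basisVec m)
    rw [W.D_single, W.Db_single] at h1
    have : ev (W.d m (W.db m (k i j))) = - curvAt W ev k (basisVec m) (basisVec m) i j :=
      congrFun (congrFun h1 i) j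
    rw [this, norm_neg]; exact hO _ _ _ _

include hΓ hO in
theorem IsGauge.norm_ev_dt_h_le
    (hflow : mapD W.dt h = - secondRicciM W h - torsionQuadM W h) (i j : Fin n) :
    ‖ev (W.dt (h i j))‖ ≤ n * (n * (1 * β)) +
      1 / 2 * (n * (n * (n * (n * (1 * 1 * (β + β) * (β + β)))))) := by
  have h0 : ev (W.dt (h i j)) = - ev (secondRicciM W h i j) - ev (torsionQuadM W h i j) := by
    have : W.dt (h i j) = - secondRicciM W h i j - torsionQuadM W h i j :=
      congrFun (congrFun hflow i) j
    rw [this, map_sub, map_neg]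
  have hi : ∀ a b, ‖ev (h⁻¹ a b)‖ ≤ 1 := by
    intro a b
    have : ev (h⁻¹ a b) = (1 : Matrix (Fin n) (Fin n) ℂ) a b :=
      congrFun (congrFun (HermitianFlow.ev_inv h hg.unit_h (hg.ev_h hk)) a) b
    rw [this]; exact norm_one_apply_le a b
  have ht : ∀ p m j, ‖ev (torsionM W h p m j)‖ ≤ β + β := by
    intro p m j
    rw [torsionM, map_sub]
    exact norm_sub_le_of_le (hΓ _ _ _) (hΓ _ _ _)
  have hc : ∀ m r i j, ‖ev (curvM (W.d m) (W.db r) h i j)‖ ≤ β := by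
    intro m r i j
    have h1 := congrFun (congrFun (hg.ev_curvM hk (basisVec m) (basisVec r)) i) j
    rw [W.D_single, W.Db_single] at h1
    have : ev (curvM (W.d m) (W.db r) h i j) = _ := h1
    rw [this]; exact hO _ _ _ _
  rw [h0]
  refine norm_sub_le_of_le ?_ ?_
  · rw [norm_neg, secondRicciM]
    simp only [Matrix.sum_apply, Matrix.smul_apply, smul_eq_mul, map_sum, map_mul]
    exact norm_sum_fin_le fun m => norm_sum_fin_le fun r => norm_mul_le_of_le' (hi _ _) (hc _ _ _ _)
  · simp only [torsionQuadM, Matrix.of_apply, map_smul, smul_eq_mul, map_sum, map_mul]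
    refine norm_mul_le_of_le' (by simp) ?_
    refine norm_sum_fin_le fun m => norm_sum_fin_le fun r => norm_sum_fin_le fun p =>
      norm_sum_fin_le fun s => ?_
    refine norm_mul_le_of_le' (norm_mul_le_of_le' (norm_mul_le_of_le' (hi _ _) (hi _ _))
      (ht _ _ _)) ?_
    rw [hk.conj_ev, RCLike.norm_conj]; exact ht _ _ _

end

/-- The constant in the lower bound for the time derivative. -/
def evolutionConst (n : ℕ) (β : ℝ) : ℝ :=
  n * (4 * ((n * (n * (4 * (4 * ((β + n * (β * β)) * (1 + n * (β + β))) * (1 + n * (β + β)))))) *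
    (n * (n * (4 * (4 * ((β + n * (β * β)) * (1 + n * (β + β))) * (1 + n * (β + β))))))))
  + (4 * (n * (n * (n * (n * (n * (n * β)))))) + n ^ 2 + n)
  + 2 * (n * (n * (n * β * (n * (β + β)))))
  + 2 * (n * (n * (n * (n * (1 * β)) +
      1 / 2 * (n * (n * (n * (n * (1 * 1 * (β + β) * (β + β)))))))))

/-- At a null pair of the perturbed curvature, the time derivative of the curvature is bounded
below by the size of the perturbation. -/
theorem IsGauge.evolution_lower_bound (hg : IsGauge W ev h P k) (hk : IsNormalAt W ev k)
    (hherm : h.conjTranspose = h)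
    (hflow : mapD W.dt h = - secondRicciM W h - torsionQuadM W h) (hP : mapD W.dt P = 0)
    (hPs : mapD W.dt (P.map star) = 0)
    (hlin : ∀ (x : ℂ) (a : Fin n → ℂ), ∃ f : R, ev f = x ∧
      (∀ m, W.d m f = algebraMap ℂ R (a m)) ∧ ∀ m, W.db m f = 0)
    (hβ : 1 ≤ β) (hΓ : ∀ m i j, ‖ev (W.d m (h i j))‖ ≤ β)
    (hO : ∀ i j c d, ‖curvAt W ev k (basisVec i) (basisVec j) c d‖ ≤ β)
    {ξ η : Fin n → ℂ} {c : ℝ} (hc : |c| ≤ 1)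
    (hξ : ∑ i, ξ i * conj (ξ i) = 1) (hη : ∑ i, η i * conj (η i) = 1)
    (hpos : ∀ u w : Fin n → ℂ, 0 ≤ (con w w (curvAt W ev k u u) +
      c * ((∑ i, u i * conj (u i)) * ∑ i, w i * conj (w i))).re)
    (h0 : (con η η (curvAt W ev k ξ ξ)).re + c = 0)
    (htest : ∀ Ξ H : Fin n → R, (∀ m i, W.db m (Ξ i) = 0) → (∀ m i, W.d m (H i) = 0) →
      (∀ i, ev (Ξ i) = ξ i) → (∀ i, ev (H i) = η i) → ∀ m,
      0 ≤ (ev (W.d m (W.db m (curvFn W k Ξ H + (c : ℂ) • (metricFn h Ξ * metricFn k H))))).re) :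
    - (evolutionConst n β * |c|) ≤ (ev (W.dt (con η η (curvM (W.D ξ) (W.Db ξ) k)))).re +
      c * (ev (W.dt (con ξ ξ h * con η η h))).re := by
  set T : Fin n → Fin n → Fin n → Fin n → ℂ :=
    fun i j c d => curvAt W ev k (basisVec i) (basisVec j) c d with hTdef
  have hT : ∀ i j k l, conj (T i j k l) = T j i l k := fun i j a b =>
    congrFun (congrFun (hk.curvAt_conjTranspose (basisVec i) (basisVec j)) b) a
  have hpos' : ∀ u w : Fin n → ℂ, 0 ≤ (quadForm (perturb T c) u u w w).re := by
    intro u w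
    rw [quadForm_perturb, ← con_curvAt]
    exact hpos u w
  have h0' : (quadForm (perturb T c) ξ ξ η η).re = 0 := by
    rw [quadForm_perturb, ← con_curvAt, hξ, hη, Complex.add_re]
    simpa using h0
  have hξ1 := norm_le_one_of_sum hξ
  have hη1 := norm_le_one_of_sum hη
  have hβ0 : 0 ≤ β := by linarith
  have hcn : ‖(c : ℂ)‖ = |c| := by simp
  -- the data of the evolution equation
  set s : Matrix (Fin n) (Fin n) ℂ := ev.mapMatrix (frameTorsion W P k η) with hs
  have hs1 : ∀ p m, ‖s p m‖ ≤ n * (β + β) := by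
    intro p m
    have : s p m = ∑ j, (ev (W.d p (h m j)) - ev (W.d m (h p j))) * conj (η j) := by
      have h1 : s p m = ev (torsionOf W (((P.transpose)⁻¹).mulVec (rightCon η k)) p m) :=
        congrFun (congrFun (hg.ev_frameTorsion (η := η)) p) m
      rw [h1, hg.torsionOf_eq, map_sum]
      refine Finset.sum_congr rfl fun j _ => ?_
      have h2 : ev (∑ l, η l • P j l) = η j := by
        have h3 : ∀ l, ev (P j l) = (1 : Matrix (Fin n) (Fin n) ℂ) j l :=
          fun l => congrFun (congrFun hg.one j) l
        simp [map_sum, h3, Matrix.one_apply]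
      rw [map_mul, hk.conj_ev, h2, torsionM, map_sub]
    rw [this]
    refine norm_sum_fin_le fun j => ?_
    have := norm_mul_le_of_le' (norm_sub_le_of_le (hΓ p m j) (hΓ m p j))
      ((RCLike.norm_conj (η j)).le.trans (hη1 j))
    simpa using this
  set a : Fin n → Fin n → ℂ := fun m i => - ev.mapMatrix (mapD (W.D ξ) h) m i with ha
  have ha1 : ∀ m i, ‖a m i‖ ≤ n * (β + β) := by
    intro m i
    have : ev.mapMatrix (mapD (W.D ξ) h) m i = ∑ p, ξ p * ev (W.d p (h m i)) := by
      have : ev.mapMatrix (mapD (W.D ξ) h) m i = ev (W.D ξ (h m i)) := rfl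
      rw [this, W.D_apply]
      simp [map_sum]
    simp only [ha]
    rw [norm_neg, this]
    refine norm_sum_fin_le fun p => ?_
    have := norm_mul_le_of_le' (hξ1 p) (hΓ p m i)
    linarith
  set b : Fin n → Fin n → ℂ := fun m i => - conj (s m i) with hb
  set B : Matrix (Fin n) (Fin n) ℂ :=
    Matrix.of fun p m => ∑ l, conj (η l) * curvAt W ev k (basisVec p) ξ m l with hB
  set N : Matrix (Fin n) (Fin n) ℂ := Matrix.of fun p m =>
    ∑ a, ev.mapMatrix (mapD (W.d p) h) m a * ∑ l, conj (η l) * curvAt W ev k ξ ξ a l with hN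
  have hBT : ∀ p q, B p q = quadForm T (basisVec p) ξ (basisVec q) η := by
    intro p q
    rw [← con_curvAt, con_basisVec_left]
    rfl
  -- The terms with `N` have no sign. They are tolerable only because the first variation makes this
  -- factor of order `c`.
  have hnull : ∀ a, ∑ l, conj (η l) * curvAt W ev k ξ ξ a l = - (c * conj (η a)) := by
    intro a
    rw [← con_basisVec_left, con_curvAt]
    exact quadForm_null_perturb hT hξ hpos' h0' a
  have hN1 : ∀ p m, ‖N p m‖ ≤ n * (β * (|c| * 1)) := by
    intro p m
    simp only [hN, Matrix.of_apply, hnull]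
    refine norm_sum_fin_le fun a => norm_mul_le_of_le' (hΓ p m a) ?_
    rw [norm_neg]
    exact norm_mul_le_of_le' hcn.le ((RCLike.norm_conj (η a)).le.trans (hη1 a))
  -- the fields
  choose Ξ hΞe hΞ hΞb using fun i => hlin (ξ i) (fun m => a m i)
  -- The available affine functions are holomorphic; the antiholomorphic `H` is the conjugate of one
  -- with conjugated data.
  choose H' hHe' hH' hHb' using fun i => hlin (conj (η i)) (fun m => conj (b m i))
  set H : Fin n → R := fun i => star (H' i) with hH
  have hHe : ∀ i, ev (H i) = η i := fun i => by rw [hH, hk.conj_ev, hHe', Complex.conj_conj]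
  have hHd : ∀ m i, W.d m (H i) = 0 := fun m i => by rw [hH, ← W.star_db, hHb', star_zero]
  have hHb : ∀ m i, W.db m (H i) = algebraMap ℂ R (b m i) := fun m i => by
    rw [hH, ← W.star_d, hH', ← algebraMap_star_comm, RCLike.star_def, Complex.conj_conj]
  have key := hg.evolution hk hherm hflow hP hPs ξ η B N s a b (fun p m => rfl) (fun p m => rfl)
    hs (fun m i => rfl) (fun m i => rfl) Ξ H (fun m i => hΞ i m) (fun m i => hΞb i m) hΞe hHd hHb hHe
  -- the Laplacian term
  set b1 := 1 + (n : ℝ) * (β + β) with hb1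
  have hb1n : 0 ≤ (n : ℝ) * (β + β) := by positivity
  have jΞ : ∀ m i, JetBound W ev m (Ξ i) b1 := by
    intro m i
    refine ⟨?_, ?_, ?_, ?_⟩
    · rw [hΞe]; linarith [hξ1 i]
    · rw [hΞ, AlgHom.commutes]; simp only [Algebra.algebraMap_self, RingHom.id_apply]
      linarith [ha1 m i]
    · rw [hΞb, map_zero, norm_zero]; linarith
    · rw [hΞb, map_zero, map_zero, norm_zero]; linarith
  have jH : ∀ m i, JetBound W ev m (H i) b1 := by
    intro m i
    refine ⟨?_, ?_, ?_, ?_⟩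
    · rw [hHe]; linarith [hη1 i]
    · rw [hHd, map_zero, norm_zero]; linarith
    · rw [hHb, AlgHom.commutes]; simp only [Algebra.algebraMap_self, RingHom.id_apply, hb]
      rw [norm_neg, RCLike.norm_conj]
      linarith [hs1 m i]
    · rw [hHb, Derivation.map_algebraMap, map_zero, norm_zero]; linarith
  -- Non-negativity is known for the perturbed test function only. Subtracting the Laplacian of `c
  -- |Ξ|² |H|²` costs `|c|` times a jet bound of the product of the two norms.
  have hE1 : ∀ m, - (|c| * (4 * ((n * (n * (4 * (4 * ((β + n * (β * β)) * b1) * b1)))) *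
      (n * (n * (4 * (4 * ((β + n * (β * β)) * b1) * b1)))))))
      ≤ (ev (W.d m (W.db m (curvFn W k Ξ H)))).re := by
    intro m
    have h1 := htest Ξ H (fun m i => hΞb i m) hHd hΞe hHe m
    rw [map_add, map_add, map_add, Derivation.map_smul, Derivation.map_smul, map_smul,
      smul_eq_mul, Complex.add_re] at h1
    have h2 := ((JetBound.metricFn hk.conj_ev (fun i j => hg.jetBound_h hk hherm hβ hΓ hO m i j)
      (jΞ m)).mul (JetBound.metricFn hk.conj_ev (fun i j =>
        (hk.jetBound_k hg hβ hO m i j).mono (b' := β + n * (β * β))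
          (le_add_of_nonneg_right (by positivity))) (jH m))).ddb
    have h3 := (Complex.abs_re_le_norm _).trans (norm_mul_le_of_le' hcn.le h2)
    linarith [(abs_le.1 h3).2]
  have hE1' : - (n * (|c| * (4 * ((n * (n * (4 * (4 * ((β + n * (β * β)) * b1) * b1)))) *
      (n * (n * (4 * (4 * ((β + n * (β * β)) * b1) * b1))))))))
      ≤ (∑ m, ev (W.d m (W.db m (curvFn W k Ξ H)))).re := by
    rw [Complex.re_sum]
    refine le_trans (le_of_eq ?_) (Finset.sum_le_sum fun m _ => hE1 m)
    simp
  -- the reaction terms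
  have hE2 : ∑ m, ∑ r, curvAt W ev k ξ ξ r m * con η η (curvAt W ev k (basisVec m) (basisVec r)) =
      ∑ p, ∑ q, quadForm T (basisVec p) (basisVec q) η η *
        quadForm T ξ ξ (basisVec q) (basisVec p) := by
    refine Finset.sum_congr rfl fun p _ => Finset.sum_congr rfl fun q _ => ?_
    rw [← con_curvAt, ← con_curvAt, con_basisVec, mul_comm]
  have hE2' := null_trace_perturb hT hc hξ hη hpos' h0' hO
  simp only [← hBT] at hE2'
  have hE3 : 0 ≤ (∑ m, con η η (curvAt W ev k (basisVec m) ξ *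
          (curvAt W ev k (basisVec m) ξ).conjTranspose)).re := by
    rw [Complex.re_sum]
    refine Finset.sum_nonneg fun m _ => ?_
    rw [con_mul_conjTranspose]
    exact re_sum_mul_conj_nonneg _ _
  have hE4 : 0 ≤ ((1 / 2) * ∑ p, ∑ q, ev.mapMatrix (mapD (W.D ξ) (frameTorsion W P k η)) p q *
          conj (ev.mapMatrix (mapD (W.D ξ) (frameTorsion W P k η)) p q)).re := by
    rw [show (1 / 2 : ℂ) = ((1 / 2 : ℝ) : ℂ) by norm_num, Complex.re_ofReal_mul, Complex.re_sum]
    have := Finset.sum_nonneg fun p (_ : p ∈ (Finset.univ : Finset (Fin n))) =>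
      re_sum_mul_conj_nonneg Finset.univ
        (fun q => ev.mapMatrix (mapD (W.D ξ) (frameTorsion W P k η)) p q)
    positivity
  have hE5 : (∑ p, ∑ q, N p q * conj (s p q)).re ≤
      n * (n * (n * (β * (|c| * 1)) * (n * (β + β)))) := by
    refine (Complex.re_le_norm _).trans ?_
    refine norm_sum_fin_le fun p => norm_sum_fin_le fun q => norm_mul_le_of_le' (hN1 p q) ?_
    rw [RCLike.norm_conj]; exact hs1 p q
  -- the derivative of the perturbation
  have hone : ∀ u : Fin n → ℂ, ∑ i, u i * conj (u i) = 1 → ev (con u u h) = 1 := by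
    intro u hu
    rw [ev_con, hg.ev_h hk, con_apply, ← hu]
    simp [Matrix.one_apply]
  set Kt : ℝ := n * (n * (1 * β)) + 1 / 2 * (n * (n * (n * (n * (1 * 1 * (β + β) * (β + β))))))
    with hKt
  have hcon : ∀ u : Fin n → ℂ, (∀ i, ‖u i‖ ≤ 1) → ‖ev (W.dt (con u u h))‖ ≤ n * (n * Kt) := by
    intro u hu
    rw [derivation_con, ev_con]
    exact norm_con_le hu hu fun i j => hg.norm_ev_dt_h_le hk hΓ hO hflow i j
  have hE6 : |c * (ev (W.dt (con ξ ξ h * con η η h))).re| ≤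
      |c| * (n * (n * Kt) + n * (n * Kt)) := by
    rw [abs_mul]
    refine mul_le_mul_of_nonneg_left ((Complex.abs_re_le_norm _).trans ?_) (abs_nonneg c)
    rw [Derivation.leibniz, smul_eq_mul, smul_eq_mul, map_add, map_mul, map_mul, hone ξ hξ,
      hone η hη, one_mul, one_mul]
    exact norm_add_le_of_le (hcon η hη1) (hcon ξ hξ1)
  rw [key, hE2, half_sum_sub_mul_conj]
  simp only [Complex.sub_re, Complex.add_re, Complex.conj_re] at hE2' ⊢
  have h6 := (abs_le.1 hE6).1
  -- The four errors are the Laplacian of the perturbation, the defect in the trace inequality, the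
  -- two `N`-terms, and the time derivative of the norms of `ξ` and `η`.
  have hK : evolutionConst n β * |c| =
      n * (|c| * (4 * ((n * (n * (4 * (4 * ((β + n * (β * β)) * b1) * b1)))) *
      (n * (n * (4 * (4 * ((β + n * (β * β)) * b1) * b1))))))) +
      |c| * (4 * (n * (n * (n * (n * (n * (n * β)))))) + n ^ 2 + n) +
      2 * (n * (n * (n * (β * (|c| * 1)) * (n * (β + β))))) +
      |c| * (n * (n * Kt) + n * (n * Kt)) := by
    rw [evolutionConst, hKt, hb1]; ring
  rw [hK]
  linarith

end LowerBound

/-! ### Construction of the normal frame -/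

section GaugeMatrix

variable {n : ℕ} {R : Type*} [CommRing R] [StarRing R] [Algebra ℂ R] [StarModule ℂ R]
  {W : WirtingerRing n R} {ev : R →ₐ[ℂ] ℂ} {k h P : Matrix (Fin n) (Fin n) R}

theorem curvM_gauge_eq (hg : IsGauge W ev h P k) (i j : Fin n) : curvM (W.d i) (W.db j) k =
    P.transpose * curvM (W.d i) (W.db j) h * P.map star := by
  have := hg.curvM_eq (basisVec i) (basisVec j)
  rwa [W.D_single, W.Db_single] at this

theorem metricFn_gauge (h P : Matrix (Fin n) (Fin n) R) (H : Fin n → R) :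
    metricFn (P.transpose * h * P.map star) H = metricFn h (P.mulVec H) := by
  have e1 : ∀ M : Matrix (Fin n) (Fin n) R, metricFn M H =
      dotProduct H (M.mulVec (fun i => star (H i))) := by
    intro M
    simp only [metricFn, dotProduct, Matrix.mulVec, Finset.mul_sum]
    exact Finset.sum_congr rfl fun i _ => Finset.sum_congr rfl fun j _ => by ring
  have e2 : metricFn h (P.mulVec H) =
      dotProduct (P.mulVec H) (h.mulVec (fun i => star (P.mulVec H i))) := by
    simp only [metricFn, dotProduct, Matrix.mulVec]
    refine Finset.sum_congr rfl fun i _ => ?_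
    rw [Finset.mul_sum]
    exact Finset.sum_congr rfl fun j _ => by ring
  have e3 : (P.map star).mulVec (fun i => star (H i)) = fun i => star (P.mulVec H i) := by
    funext i
    simp only [Matrix.mulVec, dotProduct, star_sum, star_mul', Matrix.map_apply]
  rw [e1, e2, ← Matrix.mulVec_mulVec, ← Matrix.mulVec_mulVec, e3, Matrix.dotProduct_mulVec,
    Matrix.vecMul_transpose]

theorem curvFn_eq_metricFn (W : WirtingerRing n R) (k : Matrix (Fin n) (Fin n) R)
    (Ξ H : Fin n → R) :
    curvFn W k Ξ H = ∑ i, ∑ j, Ξ i * star (Ξ j) * metricFn (curvM (W.d i) (W.db j) k) H := by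
  simp only [curvFn, metricFn, Finset.mul_sum]
  exact Finset.sum_congr rfl fun i _ => Finset.sum_congr rfl fun j _ =>
    Finset.sum_congr rfl fun c _ => Finset.sum_congr rfl fun d _ => by ring

/-- In coordinates the second field becomes `P H`, while `Ξ` is unchanged because the base
directions keep their frame. So non-negativity known in the chart applies to the test function built
from `k`. -/
theorem IsGauge.curvFn_eq (hg : IsGauge W ev h P k) (Ξ H : Fin n → R) :
    curvFn W k Ξ H = curvFn W h Ξ (P.mulVec H) := by
  simp only [curvFn_eq_metricFn, curvM_gauge_eq hg, metricFn_gauge]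

/-- Since `P̄` is antiholomorphic, the `(1,0)`-derivatives of `k = Pᵀ h P̄` see only `Pᵀ h`. The
equations `∂k = 0` and `∂∂k = 0` at the point are then solved by a 2-jet of `P`, namely `h1` and
`h2`. -/
theorem IsGauge.isNormalAt (hg : IsGauge W ev h P k) (hherm : h.conjTranspose = h)
    (hev : ∀ x, ev (star x) = conj (ev x)) (hh : ev.mapMatrix h = 1)
    (h1 : ∀ i, (ev.mapMatrix (mapD (W.d i) P)).transpose = - ev.mapMatrix (mapD (W.d i) h))
    (h2 : ∀ i j, (ev.mapMatrix (mapD (W.d i) (mapD (W.d j) P))).transpose =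
      - ev.mapMatrix (mapD (W.d i) (mapD (W.d j) h)) +
        ev.mapMatrix (mapD (W.d i) h) * ev.mapMatrix (mapD (W.d j) h) +
        ev.mapMatrix (mapD (W.d j) h) * ev.mapMatrix (mapD (W.d i) h)) :
    IsNormalAt W ev k where
  isUnit := by
    rw [hg.eq, Matrix.det_mul, Matrix.det_mul]
    exact (hg.unit_transpose.mul hg.unit_h).mul hg.unit_star
  herm := by
    rw [hg.eq, Matrix.conjTranspose_mul, Matrix.conjTranspose_mul, hherm, mul_assoc]
    have : (P.map star).conjTranspose = P.transpose := by
      ext i j; exact star_star _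
    rw [this]; rfl
  conj_ev := hev
  one := by
    rw [hg.eq, map_mul, map_mul, mapMatrix_transpose, hg.one, hg.star_one hev, hh]
    simp
  ev_d i := by
    rw [hg.eq]
    simp only [mapD_mul, W.d_map_star P hg.holo, mul_zero, zero_add, add_zero, map_mul, map_add,
      mapD_transpose, mapMatrix_transpose, h1, hg.one, hg.star_one hev, hh, Matrix.transpose_one,
      mul_one, one_mul]
    simp
  ev_dd i j := by
    rw [hg.eq]
    simp only [mapD_mul, W.d_map_star P hg.holo, mul_zero, zero_add, add_zero, map_mul, map_add,
      mapD_transpose, mapMatrix_transpose, h1, h2, hg.one, hg.star_one hev, hh,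
      Matrix.transpose_one, mul_one, one_mul, map_zero]
    noncomm_ring

/-- A system of holomorphic coordinate functions, vanishing at the point of evaluation. -/
structure IsCoord (W : WirtingerRing n R) (ev : R →ₐ[ℂ] ℂ) (Z : Fin n → R) : Prop where
  d : ∀ m i, W.d m (Z i) = if m = i then 1 else 0
  db : ∀ m i, W.db m (Z i) = 0
  dt : ∀ i, W.dt (Z i) = 0
  ev : ∀ i, ev (Z i) = 0

/-- The matrix `1 + ∑ Z_a P1_a + ∑ Z_a Z_b P2_ab`. -/
def gaugeMatrix (Z : Fin n → R) (P1 : Fin n → Matrix (Fin n) (Fin n) ℂ)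
    (P2 : Fin n → Fin n → Matrix (Fin n) (Fin n) ℂ) : Matrix (Fin n) (Fin n) R :=
  Matrix.of fun i j => algebraMap ℂ R ((1 : Matrix (Fin n) (Fin n) ℂ) i j) +
    ∑ a, Z a * algebraMap ℂ R (P1 a i j) + ∑ a, ∑ b, Z a * Z b * algebraMap ℂ R (P2 a b i j)

namespace IsCoord

variable {Z : Fin n → R} (hZ : IsCoord W ev Z) (P1 : Fin n → Matrix (Fin n) (Fin n) ℂ)
    (P2 : Fin n → Fin n → Matrix (Fin n) (Fin n) ℂ)
include hZ

/-- These are the components of the test fields: holomorphic, with constant derivatives prescribed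
everywhere and not just at the point. -/
theorem exists_affine (x : ℂ) (a : Fin n → ℂ) : ∃ f : R, ev f = x ∧
    (∀ m, W.d m f = algebraMap ℂ R (a m)) ∧ ∀ m, W.db m f = 0 := by
  refine ⟨algebraMap ℂ R x + ∑ i, Z i * algebraMap ℂ R (a i), ?_, fun m => ?_, fun m => ?_⟩
  · simp [hZ.ev]
  · simp [Derivation.leibniz, hZ.d]
  · simp [Derivation.leibniz, hZ.db]

theorem gaugeMatrix_ev : ev.mapMatrix (gaugeMatrix Z P1 P2) = 1 := by
  ext i j
  simp only [AlgHom.mapMatrix_apply, Matrix.map_apply, gaugeMatrix, Matrix.of_apply, map_add,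
    map_sum, map_mul, hZ.ev, zero_mul, Finset.sum_const_zero, add_zero, AlgHom.commutes]
  rfl

theorem gaugeMatrix_db (m : Fin n) : mapD (W.db m) (gaugeMatrix Z P1 P2) = 0 := by
  ext i j
  simp [gaugeMatrix, Derivation.leibniz, hZ.db]

theorem gaugeMatrix_dt : mapD W.dt (gaugeMatrix Z P1 P2) = 0 := by
  ext i j
  simp [gaugeMatrix, Derivation.leibniz, hZ.dt]

theorem gaugeMatrix_d_apply (m i j : Fin n) : W.d m (gaugeMatrix Z P1 P2 i j) =
    algebraMap ℂ R (P1 m i j) + ∑ b, Z b * algebraMap ℂ R (P2 m b i j + P2 b m i j) := by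
  simp only [gaugeMatrix, Matrix.of_apply, map_add, Derivation.map_algebraMap, map_sum,
    Derivation.leibniz, smul_eq_mul, hZ.d, mul_zero, zero_add, mul_add, mul_ite, mul_one,
    Finset.sum_add_distrib, Finset.sum_ite_eq, Finset.mem_univ, if_true]
  refine congrArg (fun x => _ + x) ?_
  simp only [Finset.sum_ite_irrel, Finset.sum_const_zero, Finset.sum_ite_eq, Finset.mem_univ,
    if_true, mul_comm (Z _)]
  exact add_comm _ _

theorem gaugeMatrix_ev_d (m : Fin n) :
    ev.mapMatrix (mapD (W.d m) (gaugeMatrix Z P1 P2)) = P1 m := by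
  ext i j
  simp only [AlgHom.mapMatrix_apply, Matrix.map_apply, mapD_apply, hZ.gaugeMatrix_d_apply, map_add,
    map_sum, map_mul, hZ.ev, zero_mul, Finset.sum_const_zero, add_zero, AlgHom.commutes]
  rfl

theorem gaugeMatrix_ev_d_d (l m : Fin n) :
    ev.mapMatrix (mapD (W.d l) (mapD (W.d m) (gaugeMatrix Z P1 P2))) = P2 m l + P2 l m := by
  ext i j
  simp only [AlgHom.mapMatrix_apply, Matrix.map_apply, mapD_apply, hZ.gaugeMatrix_d_apply, map_add,
    map_sum, map_mul, Derivation.map_algebraMap, Derivation.leibniz, smul_eq_mul, hZ.d, mul_zero,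
    zero_add, mul_ite, mul_one, hZ.ev, zero_mul, add_zero, apply_ite ev, map_zero,
    Finset.sum_ite_eq, Finset.mem_univ, if_true, AlgHom.commutes]
  simp

/-- The coefficients of a gauge transformation making the frame normal. -/
def _root_.HermitianFlow.gaugeLin (W : WirtingerRing n R) (ev : R →ₐ[ℂ] ℂ)
    (h : Matrix (Fin n) (Fin n) R) (i : Fin n) : Matrix (Fin n) (Fin n) ℂ :=
  - (ev.mapMatrix (mapD (W.d i) h)).transpose

/-- The coefficients of a gauge transformation making the frame normal. -/
def _root_.HermitianFlow.gaugeQuad (W : WirtingerRing n R) (ev : R →ₐ[ℂ] ℂ)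
    (h : Matrix (Fin n) (Fin n) R) (i j : Fin n) : Matrix (Fin n) (Fin n) ℂ :=
  (1 / 2 : ℂ) • (- ev.mapMatrix (mapD (W.d i) (mapD (W.d j) h)) +
        ev.mapMatrix (mapD (W.d i) h) * ev.mapMatrix (mapD (W.d j) h) +
        ev.mapMatrix (mapD (W.d j) h) * ev.mapMatrix (mapD (W.d i) h)).transpose

theorem isGauge (hu : IsUnit h.det)
    (hP : IsUnit (gaugeMatrix Z (gaugeLin W ev h) (gaugeQuad W ev h)).det) :
    IsGauge W ev h (gaugeMatrix Z (gaugeLin W ev h) (gaugeQuad W ev h))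
      ((gaugeMatrix Z (gaugeLin W ev h) (gaugeQuad W ev h)).transpose * h *
        (gaugeMatrix Z (gaugeLin W ev h) (gaugeQuad W ev h)).map star) where
  unit_h := hu
  unit_P := hP
  holo := hZ.gaugeMatrix_db _ _
  one := hZ.gaugeMatrix_ev _ _
  eq := rfl

theorem isNormalAt (hu : IsUnit h.det)
    (hP : IsUnit (gaugeMatrix Z (gaugeLin W ev h) (gaugeQuad W ev h)).det)
    (hherm : h.conjTranspose = h)
    (hev : ∀ x, ev (star x) = conj (ev x)) (hh : ev.mapMatrix h = 1) :
    IsNormalAt W ev ((gaugeMatrix Z (gaugeLin W ev h) (gaugeQuad W ev h)).transpose * h *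
        (gaugeMatrix Z (gaugeLin W ev h) (gaugeQuad W ev h)).map star) := by
  refine (hZ.isGauge hu hP).isNormalAt hherm hev hh (fun i => ?_) fun i j => ?_
  · rw [hZ.gaugeMatrix_ev_d, gaugeLin, Matrix.transpose_neg, Matrix.transpose_transpose]
  -- The second derivative of the quadratic part symmetrises its coefficients. They are symmetric
  -- already, and the factor `½` in `gaugeQuad` accounts for the two equal halves.
  · have hc : mapD (W.d i) (mapD (W.d j) h) = mapD (W.d j) (mapD (W.d i) h) :=
      mapD_comm (W.d_comm i j) h
    rw [hZ.gaugeMatrix_ev_d_d, gaugeQuad, gaugeQuad, hc, Matrix.transpose_add,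
      Matrix.transpose_smul, Matrix.transpose_smul, Matrix.transpose_transpose,
      Matrix.transpose_transpose]
    module

end IsCoord

/-- The frame does not depend on time and is the identity at the point, so the time derivative
computed in it is that of the coordinate expression. -/
theorem IsGauge.ev_dt_con_curvM (hg : IsGauge W ev h P k) (hev : ∀ x, ev (star x) = conj (ev x))
    (hP : mapD W.dt P = 0) (hPs : mapD W.dt (P.map star) = 0) (ξ η : Fin n → ℂ) :
    ev (W.dt (con η η (curvM (W.D ξ) (W.Db ξ) k))) =
      ev (W.dt (con η η (curvM (W.D ξ) (W.Db ξ) h))) := by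
  rw [derivation_con, derivation_con, ev_con, ev_con, hg.curvM_eq]
  congr 1
  simp only [mapD_mul, mapD_transpose, hP, hPs, map_add, map_mul, mapMatrix_transpose, hg.one,
    hg.star_one hev, map_zero, Matrix.transpose_zero, zero_mul, mul_zero, add_zero, zero_add,
    Matrix.transpose_one, one_mul, mul_one]

end GaugeMatrix

/-! ### The derivative estimate for a solution in a chart -/

namespace SpaceTime

variable {n : ℕ} {Ω : SpaceTime n} {h : ℝ → Cn n → Matrix (Fin n) (Fin n) ℂ}

/-- A solution of the Hermitian curvature flow on a space-time domain. -/
structure IsFlow (Ω : SpaceTime n) (h : ℝ → Cn n → Matrix (Fin n) (Fin n) ℂ) : Prop where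
  smooth : Ω.SmoothMetric h
  herm : ∀ p ∈ Ω.carrier, (h p.1 p.2).conjTranspose = h p.1 p.2
  unit : ∀ p ∈ Ω.carrier, IsUnit (h p.1 p.2).det
  flow : ∀ p ∈ Ω.carrier, ∀ i j : Fin n, HasDerivWithinAt (fun s => h s p.2 i j)
    (- secondRicci (h p.1) i j p.2 - torsionQuad (h p.1) i j p.2) (Set.Ico 0 Ω.τ) p.1

/-- Restriction to a smaller spatial domain. -/
def restrict (Ω : SpaceTime n) (V : Set (Cn n)) (hV : IsOpen V) : SpaceTime n :=
  ⟨Ω.τ, Ω.U ∩ V, Ω.τ_pos, Ω.isOpen_U.inter hV⟩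

theorem restrict_carrier_subset (V : Set (Cn n)) (hV : IsOpen V) :
    (Ω.restrict V hV).carrier ⊆ Ω.carrier := fun _ hp => ⟨hp.1, hp.2.1⟩

theorem IsFlow.restrict (hf : IsFlow Ω h) (V : Set (Cn n)) (hV : IsOpen V) :
    IsFlow (Ω.restrict V hV) h where
  smooth i j := (hf.smooth i j).mono (restrict_carrier_subset V hV)
  herm p hp := hf.herm p (restrict_carrier_subset V hV hp)
  unit p hp := hf.unit p (restrict_carrier_subset V hV hp)
  flow p hp := hf.flow p (restrict_carrier_subset V hV hp)

theorem contDiffOn_coord (z₀ : Cn n) (i : Fin n) :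
    ContDiffOn ℝ ∞ (fun q : ℝ × Cn n => q.2 i - z₀ i) Ω.carrier :=
  ((((ContinuousLinearMap.proj (R := ℝ) (φ := fun _ : Fin n => ℂ) i).comp
    (ContinuousLinearMap.snd ℝ ℝ (Cn n))).contDiff).sub contDiff_const).contDiffOn

/-- The coordinate functions centred at a point. -/
def coordFn (Ω : SpaceTime n) (z₀ : Cn n) (i : Fin n) : Ω.Fn :=
  Ω.ofFn (fun q => q.2 i - z₀ i) (contDiffOn_coord z₀ i)

theorem ev_coordFn (z₀ : Cn n) (i : Fin n) (q : Ω.carrier) :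
    Ω.ev q (Ω.coordFn z₀ i) = q.1.2 i - z₀ i := rfl

theorem fderiv_coord_sub (z₀ z : Cn n) (i : Fin n) :
    fderiv ℝ (fun w : Cn n => w i - z₀ i) z =
      ContinuousLinearMap.proj (R := ℝ) (φ := fun _ : Fin n => ℂ) i :=
  ((ContinuousLinearMap.proj (R := ℝ) (φ := fun _ : Fin n => ℂ) i).hasFDerivAt.sub_const _).fderiv

theorem isCoord_coordFn (p : Ω.carrier) : IsCoord Ω.wirt (Ω.ev p) (Ω.coordFn p.1.2) where
  d m i := Ω.ext_of_ev fun q => by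
    rw [Ω.ev_d m (Ω.coordFn p.1.2 i) (F := fun _ w => w i - p.1.2 i) (fun _ => rfl), dz,
      fderiv_coord_sub]
    by_cases hmi : m = i
    · subst hmi; simp
    · simp [hmi, Pi.single_apply, Ne.symm hmi]
  db m i := Ω.ext_of_ev fun q => by
    rw [Ω.ev_db m (Ω.coordFn p.1.2 i) (F := fun _ w => w i - p.1.2 i) (fun _ => rfl), dzbar,
      fderiv_coord_sub]
    by_cases hmi : m = i
    · subst hmi; simp
    · simp [Pi.single_apply, Ne.symm hmi]
  dt i := Ω.ext_of_ev fun q => by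
    rw [map_zero]
    exact (uniqueDiffOn_Ico 0 Ω.τ q.1.1 q.2.1).eq_deriv _
      (Ω.hasDerivWithinAt_dt (Ω.coordFn p.1.2 i) (F := fun _ w => w i - p.1.2 i) (fun _ => rfl) q)
      (hasDerivWithinAt_const _ _ _)
  ev i := by rw [ev_coordFn, sub_self]

theorem _root_.HermitianFlow.map_gaugeMatrix {R S : Type*} [CommRing R] [Algebra ℂ R] [CommRing S]
    [Algebra ℂ S] (φ : R →ₐ[ℂ] S) (Z : Fin n → R) (P1 : Fin n → Matrix (Fin n) (Fin n) ℂ)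
    (P2 : Fin n → Fin n → Matrix (Fin n) (Fin n) ℂ) :
    φ.mapMatrix (gaugeMatrix Z P1 P2) = gaugeMatrix (fun i => φ (Z i)) P1 P2 := by
  ext i j
  simp [gaugeMatrix]

theorem gaugeLin_eq (hh : Ω.SmoothMetric h) (p : Ω.carrier) (i : Fin n) :
    gaugeLin Ω.wirt (Ω.ev p) (toMatrix hh) i =
      - Matrix.of fun a b => dz i (fun w => h p.1.1 w b a) p.1.2 := by
  ext a b
  exact congrArg Neg.neg (ev_d_toMatrix hh p i b a)

theorem gaugeQuad_eq (hh : Ω.SmoothMetric h) (p : Ω.carrier) (i j : Fin n) :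
    gaugeQuad Ω.wirt (Ω.ev p) (toMatrix hh) i j = (1 / 2 : ℂ) •
      (- (Matrix.of fun a b => dz i (dz j (fun w => h p.1.1 w a b)) p.1.2) +
        (Matrix.of fun a b => dz i (fun w => h p.1.1 w a b) p.1.2) *
          (Matrix.of fun a b => dz j (fun w => h p.1.1 w a b) p.1.2) +
        (Matrix.of fun a b => dz j (fun w => h p.1.1 w a b) p.1.2) *
          (Matrix.of fun a b => dz i (fun w => h p.1.1 w a b) p.1.2)).transpose := by
  have e1 : ∀ i, (Ω.ev p).mapMatrix (mapD (Ω.wirt.d i) (toMatrix hh)) =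
      Matrix.of fun a b => dz i (fun w => h p.1.1 w a b) p.1.2 := fun i => by
    ext a b
    exact ev_d_toMatrix hh p i a b
  have e2 : (Ω.ev p).mapMatrix (mapD (Ω.wirt.d i) (mapD (Ω.wirt.d j) (toMatrix hh))) =
      Matrix.of fun a b => dz i (dz j (fun w => h p.1.1 w a b)) p.1.2 := by
    ext a b
    exact Ω.ev_d i _ (F := fun t => dz j (fun w => h t w a b))
      (fun q => (ev_d_toMatrix hh q j a b).symm) p
  rw [gaugeQuad, e1, e1, e2]

theorem ev_metricFn (hh : Ω.SmoothMetric h) (q : Ω.carrier) (X : Fin n → Ω.Fn) :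
    Ω.ev q (metricFn (toMatrix hh) X) =
      con (fun i => Ω.ev q (X i)) (fun i => Ω.ev q (X i)) (h q.1.1 q.1.2) := by
  simp only [metricFn, con_apply, map_sum, map_mul, Ω.ev_star, ev_toMatrix_apply, smul_eq_mul]
  exact Finset.sum_congr rfl fun i _ => Finset.sum_congr rfl fun j _ => by ring

theorem ev_curvFn (hh : Ω.SmoothMetric h) (hu : ∀ p ∈ Ω.carrier, IsUnit (h p.1 p.2).det)
    (q : Ω.carrier) (Ξ X : Fin n → Ω.Fn) :
    Ω.ev q (curvFn Ω.wirt (toMatrix hh) Ξ X) =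
      curvatureForm (h q.1.1) q.1.2 (fun i => Ω.ev q (Ξ i)) (fun i => Ω.ev q (X i)) := by
  simp only [curvFn, curvatureForm, map_sum, map_mul, Ω.ev_star, ev_curvM hh hu]

theorem ev_con_curvM (hh : Ω.SmoothMetric h) (hu : ∀ p ∈ Ω.carrier, IsUnit (h p.1 p.2).det)
    (q : Ω.carrier) (u w : Fin n → ℂ) :
    Ω.ev q (con w w (curvM (Ω.wirt.D u) (Ω.wirt.Db u) (toMatrix hh))) =
      curvatureForm (h q.1.1) q.1.2 u w := by
  have := con_map_curvM (W := Ω.wirt) (k := toMatrix hh) (Ω.ev q).toLinearMap u u w w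
  rw [ev_con]
  refine this.trans ?_
  simp only [quadForm, curvatureForm]
  refine Finset.sum_congr rfl fun i _ => Finset.sum_congr rfl fun j _ =>
    Finset.sum_congr rfl fun k _ => Finset.sum_congr rfl fun l _ => ?_
  have e := ev_curvM hh hu q i j k l
  have e' : (Ω.ev q).toLinearMap (curvM (Ω.wirt.d i) (Ω.wirt.db j) (toMatrix hh) k l) = _ := e
  rw [e']

theorem con_self_one (u : Fin n → ℂ) :
    con u u (1 : Matrix (Fin n) (Fin n) ℂ) = ∑ i, u i * conj (u i) := by
  simp [con_apply, Matrix.one_apply]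

/-- The algebraic estimate applied to the ring of smooth functions on the domain. The hypothesis
`hP` demands that the polynomial frame be invertible on the entire domain, hence a unit in the ring;
shrinking the domain removes it. -/
theorem IsFlow.deriv_lower_bound_of_gauge (hf : IsFlow Ω h) (p : Ω.carrier)
    (hP : IsUnit (gaugeMatrix (Ω.coordFn p.1.2) (gaugeLin Ω.wirt (Ω.ev p) (toMatrix hf.smooth))
      (gaugeQuad Ω.wirt (Ω.ev p) (toMatrix hf.smooth))).det)
    (h1 : h p.1.1 p.1.2 = 1) {β : ℝ} (hβ : 1 ≤ β)
    (hΓ : ∀ m i j, ‖dz m (fun w => h p.1.1 w i j) p.1.2‖ ≤ β)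
    (hO : ∀ i j k l, ‖curvature (h p.1.1) i j k l p.1.2‖ ≤ β)
    {ξ η : Cn n} {c : ℝ} (hc : |c| ≤ 1)
    (hξ : ∑ i, ξ i * conj (ξ i) = 1) (hη : ∑ i, η i * conj (η i) = 1)
    (hpos : ∀ z ∈ Ω.U, ∀ u w : Cn n, 0 ≤ (curvatureForm (h p.1.1) z u w).re +
      c * (con u u (h p.1.1 z) * con w w (h p.1.1 z)).re)
    (h0 : (curvatureForm (h p.1.1) p.1.2 ξ η).re + c = 0) :
    ∃ d, HasDerivWithinAt (fun t => (curvatureForm (h t) p.1.2 ξ η).re +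
      c * (con ξ ξ (h t p.1.2) * con η η (h t p.1.2)).re) d (Set.Ico 0 Ω.τ) p.1.1 ∧
      - (evolutionConst n β * |c|) ≤ d := by
  set hm := toMatrix hf.smooth with hhm
  have hu := hf.unit
  have hZ := isCoord_coordFn p
  have hum : IsUnit hm.det := isUnit_toMatrix hf.smooth hu
  have hherm : hm.conjTranspose = hm := matrix_ext fun q => by
    rw [mapMatrix_conjTranspose (Ω.ev_star q)]
    exact hf.herm q q.2
  have hflow := toMatrix_flow hf.smooth hu hf.flow
  have hev := Ω.ev_star p
  have hone : (Ω.ev p).mapMatrix hm = 1 := h1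
  have hg := hZ.isGauge hum hP
  have hk := hZ.isNormalAt hum hP hherm hev hone
  set P := gaugeMatrix (Ω.coordFn p.1.2) (gaugeLin Ω.wirt (Ω.ev p) hm)
    (gaugeQuad Ω.wirt (Ω.ev p) hm) with hPdef
  set k := P.transpose * hm * P.map star with hkdef
  have hPt : mapD Ω.wirt.dt P = 0 := hZ.gaugeMatrix_dt _ _
  have hPs : mapD Ω.wirt.dt (P.map star) = 0 := by
    ext i j : 1
    have hs : Ω.wirt.dt (star (P i j)) = star (Ω.wirt.dt (P i j)) :=
      (Ω.star_dirDeriv (1, 0) (P i j)).symm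
    have h0 : Ω.wirt.dt (P i j) = 0 := congrFun (congrFun hPt i) j
    rw [mapD_apply, Matrix.map_apply, hs, h0, star_zero]
    rfl
  have hcurv : ∀ u w : Fin n → ℂ, con w w (curvAt Ω.wirt (Ω.ev p) k u u) =
      curvatureForm (h p.1.1) p.1.2 u w := by
    intro u w
    rw [← hg.ev_curvM hk, ← ev_con]
    exact ev_con_curvM hf.smooth hu p u w
  have hO' : ∀ i j c d, ‖curvAt Ω.wirt (Ω.ev p) k (basisVec i) (basisVec j) c d‖ ≤ β := by
    intro i j c d
    rw [← hg.ev_curvM hk, Ω.wirt.D_single, Ω.wirt.Db_single]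
    have := ev_curvM hf.smooth hu p i j c d
    refine le_trans (le_of_eq ?_) (hO i j c d)
    exact congrArg norm this
  have key := hg.evolution_lower_bound hk hherm hflow hPt hPs hZ.exists_affine hβ
    (fun m i j => by rw [hhm, ev_d_toMatrix]; exact hΓ m i j) hO' hc hξ hη ?_ ?_ ?_
  · refine ⟨_, ?_, key⟩
    have d1 := Ω.hasDerivWithinAt_dt (con η η (curvM (Ω.wirt.D ξ) (Ω.wirt.Db ξ) hm))
      (F := fun t z => curvatureForm (h t) z ξ η)
      (fun q => (ev_con_curvM hf.smooth hu q ξ η).symm) p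
    have d2 := Ω.hasDerivWithinAt_dt (con ξ ξ hm * con η η hm)
      (F := fun t z => con ξ ξ (h t z) * con η η (h t z))
      (fun q => by rw [map_mul, ev_con, ev_con]; rfl) p
    rw [hg.ev_dt_con_curvM hev hPt hPs]
    have d1' := Complex.reCLM.hasFDerivAt.comp_hasDerivWithinAt _ d1
    have d2' := Complex.reCLM.hasFDerivAt.comp_hasDerivWithinAt _ d2
    exact d1'.add (d2'.const_mul c)
  · intro u w
    rw [Complex.add_re, hcurv, Complex.re_ofReal_mul, ← con_self_one, ← con_self_one, ← h1]
    exact hpos _ p.2.2 u w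
  · rw [hcurv]; exact h0
  · intro Ξ H _ _ hΞ hH m
    -- The test function is the perturbed curvature evaluated on the fields `Ξ` and `P H`. It is
    -- therefore non-negative on the time slice and zero at the point, where these fields equal `ξ`
    -- and `η`.
    have hval : ∀ q, (Ω.ev q (curvFn Ω.wirt k Ξ H + (c : ℂ) • (metricFn hm Ξ * metricFn k H))).re =
        (curvatureForm (h q.1.1) q.1.2 (fun i => Ω.ev q (Ξ i)) (fun i => Ω.ev q (P.mulVec H i))).re +
        c * (con (fun i => Ω.ev q (Ξ i)) (fun i => Ω.ev q (Ξ i)) (h q.1.1 q.1.2) *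
          con (fun i => Ω.ev q (P.mulVec H i)) (fun i => Ω.ev q (P.mulVec H i))
            (h q.1.1 q.1.2)).re := by
      intro q
      rw [hg.curvFn_eq, hkdef, metricFn_gauge, map_add, map_smul, map_mul, smul_eq_mul,
        Complex.add_re, Complex.re_ofReal_mul, ev_metricFn, ev_metricFn, ev_curvFn hf.smooth hu]
    refine d_db_nonneg _ p m (fun q hq => ?_) ?_
    · rw [hval, hq]
      exact hpos _ q.2.2 _ _
    · have e1 : (fun i => Ω.ev p (Ξ i)) = ξ := funext hΞ
      have e2 : (fun i => Ω.ev p (P.mulVec H i)) = η := by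
        funext i
        have hPo : ∀ j, Ω.ev p (P i j) = (1 : Matrix (Fin n) (Fin n) ℂ) i j :=
          fun j => congrFun (congrFun hg.one i) j
        simp [Matrix.mulVec, dotProduct, hPo, hH, Matrix.one_apply]
      rw [hval, e1, e2, h1, con_self_one, con_self_one, hξ, hη]
      simpa using h0

/-- At a first null pair of the perturbed curvature, in a chart which is unitary at the point. -/
theorem IsFlow.deriv_lower_bound (hf : IsFlow Ω h) (p : Ω.carrier)
    (h1 : h p.1.1 p.1.2 = 1) {β : ℝ} (hβ : 1 ≤ β)
    (hΓ : ∀ m i j, ‖dz m (fun w => h p.1.1 w i j) p.1.2‖ ≤ β)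
    (hO : ∀ i j k l, ‖curvature (h p.1.1) i j k l p.1.2‖ ≤ β)
    {ξ η : Cn n} {c : ℝ} (hc : |c| ≤ 1)
    (hξ : ∑ i, ξ i * conj (ξ i) = 1) (hη : ∑ i, η i * conj (η i) = 1)
    (hpos : ∀ z ∈ Ω.U, ∀ u w : Cn n, 0 ≤ (curvatureForm (h p.1.1) z u w).re +
      c * (con u u (h p.1.1 z) * con w w (h p.1.1 z)).re)
    (h0 : (curvatureForm (h p.1.1) p.1.2 ξ η).re + c = 0) :
    ∃ d, HasDerivWithinAt (fun t => (curvatureForm (h t) p.1.2 ξ η).re +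
      c * (con ξ ξ (h t p.1.2) * con η η (h t p.1.2)).re) d (Set.Ico 0 Ω.τ) p.1.1 ∧
      - (evolutionConst n β * |c|) ≤ d := by
  set P1 := gaugeLin Ω.wirt (Ω.ev p) (toMatrix hf.smooth) with hP1
  set P2 := gaugeQuad Ω.wirt (Ω.ev p) (toMatrix hf.smooth) with hP2
  set G : Cn n → Matrix (Fin n) (Fin n) ℂ :=
    fun z => gaugeMatrix (fun i => z i - p.1.2 i) P1 P2 with hG
  have hGc : Continuous fun z => (G z).det := by
    refine Continuous.matrix_det ?_
    refine continuous_pi fun i => continuous_pi fun j => ?_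
    simp only [hG, gaugeMatrix, Matrix.of_apply]
    fun_prop
  -- The quadratic frame is the identity at the point and invertible only near it, so the domain is
  -- cut down to this open set.
  have hV : IsOpen {z | (G z).det ≠ 0} := isOpen_ne_fun hGc continuous_const
  have hG1 : G p.1.2 = 1 := by
    ext i j
    simp [hG, gaugeMatrix]
  set Ω' := Ω.restrict _ hV
  have hp' : p.1 ∈ Ω'.carrier := ⟨p.2.1, p.2.2, by
    change (G p.1.2).det ≠ 0
    rw [hG1, Matrix.det_one]; exact one_ne_zero⟩
  have hf' := hf.restrict _ hV
  refine hf'.deriv_lower_bound_of_gauge ⟨p.1, hp'⟩ ?_ h1 hβ hΓ hO hc hξ hη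
    (fun z hz => hpos z hz.1) h0
  refine isUnit_det_of_ev fun q => ?_
  rw [map_gaugeMatrix, isUnit_iff_ne_zero]
  -- The coefficients of the frame are derivatives of `h` at the point, so restriction does not
  -- alter them.
  have e1 : gaugeLin Ω'.wirt (Ω'.ev ⟨p.1, hp'⟩) (toMatrix hf'.smooth) = P1 := by
    funext i
    rw [gaugeLin_eq, hP1, gaugeLin_eq]
  have e2 : gaugeQuad Ω'.wirt (Ω'.ev ⟨p.1, hp'⟩) (toMatrix hf'.smooth) = P2 := by
    funext i j
    rw [gaugeQuad_eq, hP2, gaugeQuad_eq]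
  rw [e1, e2]
  exact q.2.2.2

end SpaceTime

/-! ### Holomorphic changes of coordinates -/

section Pullback

variable {n : ℕ}

/-- The splitting of a real-linear form into its complex-linear and conjugate-linear parts; it
yields the chain rule for Wirtinger derivatives. -/
theorem real_linear_apply (L : Cn n →L[ℝ] ℂ) (u : Cn n) :
    L u = ∑ a, (u a * ((L (Pi.single a 1) - Complex.I * L (Pi.single a Complex.I)) / 2) +
      conj (u a) * ((L (Pi.single a 1) + Complex.I * L (Pi.single a Complex.I)) / 2)) := by
  have hu : u = ∑ a, ((u a).re • (Pi.single a 1 : Cn n) +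
      (u a).im • (Pi.single a Complex.I : Cn n)) := by
    funext b
    rw [Finset.sum_apply, Finset.sum_eq_single b]
    · simp
    · intro a _ hab
      simp [Pi.single_apply, Ne.symm hab]
    · simp
  conv_lhs => rw [hu]
  rw [map_sum]
  refine Finset.sum_congr rfl fun a _ => ?_
  rw [map_add, map_smul, map_smul, Complex.real_smul, Complex.real_smul]
  have e1 : u a = (u a).re + (u a).im * Complex.I := (Complex.re_add_im _).symm
  have e2 : conj (u a) = (u a).re - (u a).im * Complex.I :=
    Complex.ext (by simp) (by simp)
  rw [e2]
  conv_rhs => rw [e1]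
  simp only [Complex.add_re, Complex.ofReal_re, Complex.mul_re, Complex.I_re, mul_zero,
    Complex.ofReal_im, Complex.I_im, zero_mul, sub_zero, Complex.add_im, Complex.mul_im, mul_one,
    zero_add, add_zero, sub_self]
  linear_combination (((u a).im : ℂ) * L (Pi.single a Complex.I)) * Complex.I_mul_I

/-- The Jacobian matrix of a holomorphic map. -/
def jacobian (φ : Cn n → Cn n) (w : Cn n) : Matrix (Fin n) (Fin n) ℂ :=
  Matrix.of fun a i => fderiv ℂ φ w (Pi.single i 1) a

theorem fderiv_comp_real {φ : Cn n → Cn n} {F : Cn n → ℂ} {w : Cn n}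
    (hφ : DifferentiableAt ℂ φ w) (hF : DifferentiableAt ℝ F (φ w)) (v : Cn n) :
    fderiv ℝ (fun z => F (φ z)) w v = fderiv ℝ F (φ w) (fderiv ℂ φ w v) := by
  have := hF.hasFDerivAt.comp w (hφ.hasFDerivAt.restrictScalars ℝ)
  have h2 : fderiv ℝ (fun z => F (φ z)) w = _ := this.fderiv
  rw [h2]
  rfl

theorem fderiv_single_I {φ : Cn n → Cn n} {w : Cn n} (i : Fin n) :
    fderiv ℂ φ w (Pi.single i Complex.I) = Complex.I • fderiv ℂ φ w (Pi.single i 1) := by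
  rw [← map_smul]
  congr 1
  funext a
  by_cases h : a = i
  · subst h; simp
  · simp [h]

theorem dz_comp {φ : Cn n → Cn n} {F : Cn n → ℂ} {w : Cn n}
    (hφ : DifferentiableAt ℂ φ w) (hF : DifferentiableAt ℝ F (φ w)) (i : Fin n) :
    dz i (fun z => F (φ z)) w = ∑ a, jacobian φ w a i * dz a F (φ w) := by
  rw [dz, fderiv_comp_real hφ hF, fderiv_comp_real hφ hF, fderiv_single_I,
    real_linear_apply (fderiv ℝ F (φ w)) (fderiv ℂ φ w (Pi.single i 1)),
    real_linear_apply (fderiv ℝ F (φ w)) (Complex.I • fderiv ℂ φ w (Pi.single i 1)),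
    Finset.mul_sum, ← Finset.sum_sub_distrib, Finset.sum_div]
  refine Finset.sum_congr rfl fun a _ => ?_
  simp only [Pi.smul_apply, smul_eq_mul, map_mul, Complex.conj_I, jacobian, Matrix.of_apply, dz]
  linear_combination (-(fderiv ℂ φ w (Pi.single i 1) a *
    ((fderiv ℝ F (φ w) (Pi.single a 1) - Complex.I * fderiv ℝ F (φ w) (Pi.single a Complex.I)) / 4))
    + conj (fderiv ℂ φ w (Pi.single i 1) a) *
    ((fderiv ℝ F (φ w) (Pi.single a 1) + Complex.I * fderiv ℝ F (φ w) (Pi.single a Complex.I)) / 4))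
    * Complex.I_mul_I

theorem dzbar_comp {φ : Cn n → Cn n} {F : Cn n → ℂ} {w : Cn n}
    (hφ : DifferentiableAt ℂ φ w) (hF : DifferentiableAt ℝ F (φ w)) (i : Fin n) :
    dzbar i (fun z => F (φ z)) w = ∑ a, conj (jacobian φ w a i) * dzbar a F (φ w) := by
  rw [dzbar, fderiv_comp_real hφ hF, fderiv_comp_real hφ hF, fderiv_single_I,
    real_linear_apply (fderiv ℝ F (φ w)) (fderiv ℂ φ w (Pi.single i 1)),
    real_linear_apply (fderiv ℝ F (φ w)) (Complex.I • fderiv ℂ φ w (Pi.single i 1)),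
    Finset.mul_sum, ← Finset.sum_add_distrib, Finset.sum_div]
  refine Finset.sum_congr rfl fun a _ => ?_
  simp only [Pi.smul_apply, smul_eq_mul, map_mul, Complex.conj_I, jacobian, Matrix.of_apply, dzbar]
  linear_combination ((fderiv ℂ φ w (Pi.single i 1) a *
    ((fderiv ℝ F (φ w) (Pi.single a 1) - Complex.I * fderiv ℝ F (φ w) (Pi.single a Complex.I)) / 4))
    - conj (fderiv ℂ φ w (Pi.single i 1) a) *
    ((fderiv ℝ F (φ w) (Pi.single a 1) + Complex.I * fderiv ℝ F (φ w) (Pi.single a Complex.I)) / 4))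
    * Complex.I_mul_I

theorem dzbar_eq_zero {f : Cn n → ℂ} {w : Cn n} (hf : DifferentiableAt ℂ f w) (i : Fin n) :
    dzbar i f w = 0 := by
  have h1 : fderiv ℝ f w = (fderiv ℂ f w).restrictScalars ℝ := hf.fderiv_restrictScalars ℝ
  have h2 : (Pi.single i Complex.I : Cn n) = Complex.I • Pi.single i 1 := by
    funext a
    by_cases h : a = i
    · subst h; simp
    · simp [h]
  rw [dzbar, h1, ContinuousLinearMap.coe_restrictScalars', h2, map_smul, smul_eq_mul]
  linear_combination (fderiv ℂ f w (Pi.single i 1) / 2) * Complex.I_mul_I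

/-- A time-independent domain. -/
def staticDomain (U : Set (Cn n)) (hU : IsOpen U) : SpaceTime n := ⟨1, U, one_pos, hU⟩

section

variable {T : Fin n → Fin n → Fin n → Fin n → ℂ}

theorem quadForm_sum₁ (c : Fin n → ℂ) (U : Fin n → Fin n → ℂ) (v w y : Fin n → ℂ) :
    quadForm T (∑ i, c i • U i) v w y = ∑ i, c i * quadForm T (U i) v w y := by
  let L : (Fin n → ℂ) →ₗ[ℂ] ℂ :=
    { toFun := fun u => quadForm T u v w y
      map_add' := fun u u' => quadForm_add₁ T u u' v w y
      map_smul' := fun c u => quadForm_smul₁ T c u v w y }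
  refine (map_sum L _ _).trans (Finset.sum_congr rfl fun i _ => ?_)
  exact L.map_smul _ _

theorem quadForm_sum₂ (c : Fin n → ℂ) (U : Fin n → Fin n → ℂ) (v w y : Fin n → ℂ) :
    quadForm T v (∑ i, c i • U i) w y = ∑ i, conj (c i) * quadForm T v (U i) w y := by
  let L : (Fin n → ℂ) →ₛₗ[starRingEnd ℂ] ℂ :=
    { toFun := fun u => quadForm T v u w y
      map_add' := fun u u' => quadForm_add₂ T v u u' w y
      map_smul' := fun c u => quadForm_smul₂ T c v u w y }
  refine (map_sum L _ _).trans (Finset.sum_congr rfl fun i _ => ?_)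
  exact L.map_smulₛₗ _ _

theorem quadForm_sum₃ (c : Fin n → ℂ) (U : Fin n → Fin n → ℂ) (v w y : Fin n → ℂ) :
    quadForm T v w (∑ i, c i • U i) y = ∑ i, c i * quadForm T v w (U i) y := by
  let L : (Fin n → ℂ) →ₗ[ℂ] ℂ :=
    { toFun := fun u => quadForm T v w u y
      map_add' := fun u u' => quadForm_add₃ T v w u u' y
      map_smul' := fun c u => quadForm_smul₃ T c v w u y }
  refine (map_sum L _ _).trans (Finset.sum_congr rfl fun i _ => ?_)
  exact L.map_smul _ _

theorem quadForm_sum₄ (c : Fin n → ℂ) (U : Fin n → Fin n → ℂ) (v w y : Fin n → ℂ) :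
    quadForm T v w y (∑ i, c i • U i) = ∑ i, conj (c i) * quadForm T v w y (U i) := by
  let L : (Fin n → ℂ) →ₛₗ[starRingEnd ℂ] ℂ :=
    { toFun := fun u => quadForm T v w y u
      map_add' := fun u u' => quadForm_add₄ T v w y u u'
      map_smul' := fun c u => quadForm_smul₄ T c v w y u }
  refine (map_sum L _ _).trans (Finset.sum_congr rfl fun i _ => ?_)
  exact L.map_smulₛₗ _ _

end

variable {U V : Set (Cn n)} {h h' : Cn n → Matrix (Fin n) (Fin n) ℂ}

theorem smoothMetric_static (hU : IsOpen U) (hh : ∀ i j, ContDiffOn ℝ ∞ (fun z => h z i j) U) :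
    (staticDomain U hU).SmoothMetric (fun _ => h) := fun i j =>
  (hh i j).comp contDiff_snd.contDiffOn fun _ hq => hq.2

-- Time is a dummy variable here: the identity is read off from the ring of functions on a static
-- domain.
open SpaceTime in
theorem curvature_formula (hU : IsOpen U) (hh : ∀ i j, ContDiffOn ℝ ∞ (fun z => h z i j) U)
    (hu : ∀ z ∈ U, IsUnit (h z).det) {z : Cn n} (hz : z ∈ U) (i j k l : Fin n) :
    curvature h i j k l z = - dz i (dzbar j (fun w => h w k l)) z +
      ∑ q, (∑ p, dz i (fun w => h w k p) z * (h z)⁻¹ p q) * dzbar j (fun w => h w q l) z := by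
  set Ω := staticDomain U hU
  have hs := smoothMetric_static hU hh
  let p : Ω.carrier := ⟨(0, z), ⟨le_rfl, one_pos⟩, hz⟩
  have hu' : ∀ p ∈ Ω.carrier, IsUnit (h p.2).det := fun p hp => hu _ hp.2
  have := ev_curvM hs hu' p i j k l
  rw [← this, curvM, Matrix.add_apply, Matrix.neg_apply, map_add, map_neg, Matrix.mul_apply,
    map_sum, mapD_apply, Ω.ev_d i (mapD (Ω.wirt.db j) (toMatrix hs) k l)
      (F := fun _ => dzbar j (fun w => h w k l)) (fun q => (ev_db_toMatrix hs q j k l).symm)]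
  refine congrArg₂ (· + ·) rfl ?_
  refine Finset.sum_congr rfl fun q _ => ?_
  rw [Matrix.mul_apply, map_mul, map_sum, mapD_apply, ev_db_toMatrix]
  refine congrArg (fun x => x * _) ?_
  refine Finset.sum_congr rfl fun r _ => ?_
  rw [map_mul, mapD_apply, ev_d_toMatrix, ev_inv_toMatrix hs hu']

variable {φ : Cn n → Cn n}

theorem differentiableAt_dzbar (hU : IsOpen U) {F : Cn n → ℂ} (hF : ContDiffOn ℝ ∞ F U) {z : Cn n}
    (hz : z ∈ U) (j : Fin n) : DifferentiableAt ℝ (dzbar j F) z := by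
  have h1 : DifferentiableAt ℝ (fderiv ℝ F) z :=
    ((hF.fderiv_of_isOpen hU (m := 1) (by norm_cast)).differentiableOn (by simp)).differentiableAt
      (hU.mem_nhds hz)
  unfold dzbar
  have e : ∀ v, DifferentiableAt ℝ (fun z => fderiv ℝ F z v) z := fun v =>
    h1.clm_apply (differentiableAt_const v)
  simp only [div_eq_mul_inv]
  exact ((e _).fun_add ((e _).const_mul Complex.I)).mul_const _

theorem contDiffOn_jacobian (hV : IsOpen V) (hφ : ContDiffOn ℂ ∞ φ V) (a i : Fin n) :
    ContDiffOn ℂ ∞ (fun w => jacobian φ w a i) V := by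
  have h1 : ContDiffOn ℂ ∞ (fderiv ℂ φ) V := hφ.fderiv_of_isOpen hV (by simp)
  have h2 : ContDiffOn ℂ ∞ (fun w => fderiv ℂ φ w (Pi.single i 1)) V :=
    h1.clm_apply contDiffOn_const
  exact (contDiffOn_pi.1 h2) a

theorem dz_conj_of_holomorphic {f : Cn n → ℂ} {w : Cn n} (hf : DifferentiableAt ℂ f w)
    (i : Fin n) : dz i (fun z => conj (f z)) w = 0 := by
  have h0 := dzbar_eq_zero hf i
  have h1 : fderiv ℝ (fun z => conj (f z)) w =
      Complex.conjCLE.toContinuousLinearMap.comp (fderiv ℝ f w) :=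
    (Complex.conjCLE.toContinuousLinearMap.hasFDerivAt.comp w
      (hf.restrictScalars ℝ).hasFDerivAt).fderiv
  rw [dz, h1]
  have h2 := congrArg conj h0
  rw [dzbar] at h2
  simp only [map_div₀, map_add, map_mul, Complex.conj_I, map_zero, map_ofNat] at h2
  rw [← h2]
  simp [sub_eq_add_neg]

theorem dz_congr {f g : Cn n → ℂ} {w : Cn n} (hfg : f =ᶠ[nhds w] g) (i : Fin n) :
    dz i f w = dz i g w := by
  rw [dz, dz, hfg.fderiv_eq]

/-- First half of tensoriality. Substituting `φ` into the matrix entries affects only the indices of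
differentiation, through the chain rule, since the Jacobian is holomorphic and `∂_i` does not see
its conjugate. The last two indices are handled separately as a holomorphic change of frame by the
Jacobian. -/
theorem curvature_comp (hU : IsOpen U) (hV : IsOpen V) (hφ : ContDiffOn ℂ ∞ φ V)
    (hm : Set.MapsTo φ V U) (hh : ∀ i j, ContDiffOn ℝ ∞ (fun z => h z i j) U)
    (hu : ∀ z ∈ U, IsUnit (h z).det) {w : Cn n} (hw : w ∈ V) (i j k l : Fin n) :
    curvature (fun z => h (φ z)) i j k l w =
      ∑ a, ∑ b, jacobian φ w a i * conj (jacobian φ w b j) * curvature h a b k l (φ w) := by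
  have hd : ∀ z ∈ V, DifferentiableAt ℂ φ z := fun z hz =>
    (hφ.differentiableOn (by simp)).differentiableAt (hV.mem_nhds hz)
  have hhd : ∀ k l, ∀ z ∈ U, DifferentiableAt ℝ (fun z => h z k l) z := fun k l z hz =>
    ((hh k l).differentiableOn (by simp)).differentiableAt (hU.mem_nhds hz)
  have hs : ∀ i j, ContDiffOn ℝ ∞ (fun z => h (φ z) i j) V := fun i j =>
    (hh i j).comp (hφ.restrict_scalars ℝ) hm
  rw [curvature_formula hV hs (fun z hz => hu _ (hm hz)) hw]
  simp only [curvature_formula hU hh hu (hm hw)]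
  have hJ : ∀ a i, DifferentiableAt ℂ (fun w => jacobian φ w a i) w := fun a i =>
    ((contDiffOn_jacobian hV hφ a i).differentiableOn (by simp)).differentiableAt (hV.mem_nhds hw)
  have e1 : dz i (dzbar j (fun z => h (φ z) k l)) w = ∑ a, ∑ b, jacobian φ w a i *
      conj (jacobian φ w b j) * dz a (dzbar b (fun z => h z k l)) (φ w) := by
    have e : dzbar j (fun z => h (φ z) k l) =ᶠ[nhds w] fun z => ∑ b, conj (jacobian φ z b j) *
        dzbar b (fun z => h z k l) (φ z) := by
      filter_upwards [hV.mem_nhds hw] with z hz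
      exact dzbar_comp (F := fun z => h z k l) (hd z hz) (hhd k l _ (hm hz)) j
    rw [dz_congr e]
    have hc : ∀ b, DifferentiableAt ℝ (fun z => conj (jacobian φ z b j)) w := fun b =>
      Complex.conjCLE.differentiableAt.comp w ((hJ b j).restrictScalars ℝ)
    have hD : ∀ b, DifferentiableAt ℝ (fun z => dzbar b (fun z => h z k l) (φ z)) w := fun b =>
      (differentiableAt_dzbar hU (hh k l) (hm hw) b).comp w ((hd w hw).restrictScalars ℝ)
    have hsum : dz i (fun z => ∑ b, conj (jacobian φ z b j) * dzbar b (fun z => h z k l) (φ z)) w =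
        ∑ b, conj (jacobian φ w b j) * dz i (fun z => dzbar b (fun z => h z k l) (φ z)) w := by
      have h1 : ∀ v, fderiv ℝ (fun z => ∑ b, conj (jacobian φ z b j) *
          dzbar b (fun z => h z k l) (φ z)) w v = ∑ b, (conj (jacobian φ w b j) *
          fderiv ℝ (fun z => dzbar b (fun z => h z k l) (φ z)) w v +
          dzbar b (fun z => h z k l) (φ w) * fderiv ℝ (fun z => conj (jacobian φ z b j)) w v) := by
        intro v
        rw [fderiv_fun_sum fun b _ => (hc b).fun_mul (hD b), sum_apply]
        refine Finset.sum_congr rfl fun b _ => ?_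
        rw [fderiv_fun_mul (hc b) (hD b)]
        rfl
      have h2 := fun b => dz_conj_of_holomorphic (hJ b j) i
      rw [dz, h1, h1, Finset.mul_sum, ← Finset.sum_sub_distrib, Finset.sum_div]
      refine Finset.sum_congr rfl fun b _ => ?_
      have h3 := h2 b
      rw [dz] at h3
      rw [dz]
      linear_combination (dzbar b (fun z => h z k l) (φ w)) * h3
    rw [hsum, Finset.sum_comm]
    refine Finset.sum_congr rfl fun b _ => ?_
    rw [dz_comp (hd w hw) (differentiableAt_dzbar hU (hh k l) (hm hw) b), Finset.mul_sum]
    exact Finset.sum_congr rfl fun a _ => by ring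
  have e2 : ∀ k p, dz i (fun z => h (φ z) k p) w =
      ∑ a, jacobian φ w a i * dz a (fun z => h z k p) (φ w) := fun k p =>
    dz_comp (F := fun z => h z k p) (hd w hw) (hhd k p _ (hm hw)) i
  have e3 : ∀ q l, dzbar j (fun z => h (φ z) q l) w =
      ∑ b, conj (jacobian φ w b j) * dzbar b (fun z => h z q l) (φ w) := fun q l =>
    dzbar_comp (F := fun z => h z q l) (hd w hw) (hhd q l _ (hm hw)) j
  rw [e1]
  simp only [e2, e3, mul_add, Finset.sum_add_distrib, mul_neg, Finset.sum_neg_distrib]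
  refine congrArg₂ (· + ·) rfl ?_
  have e4 : ∀ q, ∑ p, (∑ a, jacobian φ w a i * dz a (fun z => h z k p) (φ w)) * (h (φ w))⁻¹ p q =
      ∑ a, jacobian φ w a i * ∑ p, dz a (fun z => h z k p) (φ w) * (h (φ w))⁻¹ p q := by
    intro q
    simp only [Finset.sum_mul, Finset.mul_sum, mul_assoc]
    exact Finset.sum_comm
  simp only [e4, Finset.sum_mul_sum]
  rw [← sum_sum_comm_sum]
  refine Finset.sum_congr rfl fun a _ => Finset.sum_congr rfl fun b _ => ?_
  rw [Finset.mul_sum]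
  exact Finset.sum_congr rfl fun q _ => by ring

theorem sum_mul_sum_eq_quadForm (J : Matrix (Fin n) (Fin n) ℂ)
    (T : Fin n → Fin n → Fin n → Fin n → ℂ) (i j k l : Fin n) :
    ∑ d, (∑ c, J c k * ∑ a, ∑ b, J a i * conj (J b j) * T a b c d) * conj (J d l) =
      quadForm T (fun a => J a i) (fun a => J a j) (fun a => J a k) (fun a => J a l) := by
  simp only [quadForm, Finset.sum_mul, Finset.mul_sum]
  let G : Fin n → Fin n → Fin n → Fin n → ℂ :=
    fun a b c d => J c k * (J a i * conj (J b j) * T a b c d) * conj (J d l)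
  calc _ = ∑ d, ∑ a, ∑ b, ∑ c, G a b c d := Finset.sum_congr rfl fun d _ =>
        (sum_sum_comm_sum fun a b c => G a b c d).symm
    _ = ∑ a, ∑ b, ∑ d, ∑ c, G a b c d := (sum_sum_comm_sum fun a b d => ∑ c, G a b c d).symm
    _ = ∑ a, ∑ b, ∑ c, ∑ d, G a b c d := Finset.sum_congr rfl fun a _ =>
        Finset.sum_congr rfl fun b _ => Finset.sum_comm
    _ = _ := Finset.sum_congr rfl fun a _ => Finset.sum_congr rfl fun b _ =>
        Finset.sum_congr rfl fun c _ => Finset.sum_congr rfl fun d _ => by simp only [G]; ring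

open SpaceTime in
/-- The components of the curvature in other coordinates. -/
theorem curvature_pullback (hU : IsOpen U) (hV : IsOpen V) (hφ : ContDiffOn ℂ ∞ φ V)
    (hm : Set.MapsTo φ V U) (hh : ∀ i j, ContDiffOn ℝ ∞ (fun z => h z i j) U)
    (hu : ∀ z ∈ U, IsUnit (h z).det) (hJ : ∀ z ∈ V, IsUnit (jacobian φ z).det)
    (hh' : ∀ z ∈ V, h' z = (jacobian φ z).transpose * h (φ z) * (jacobian φ z).map conj)
    {w : Cn n} (hw : w ∈ V) (i j k l : Fin n) :
    curvature h' i j k l w = quadForm (fun a b c d => curvature h a b c d (φ w))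
      (fun a => jacobian φ w a i) (fun a => jacobian φ w a j) (fun a => jacobian φ w a k)
      (fun a => jacobian φ w a l) := by
  set Ω := staticDomain V hV
  have hJs : ∀ a i, ContDiffOn ℝ ∞ (fun w => jacobian φ w a i) V := fun a i =>
    (contDiffOn_jacobian hV hφ a i).restrict_scalars ℝ
  have hs : ∀ i j, ContDiffOn ℝ ∞ (fun z => h (φ z) i j) V := fun i j =>
    (hh i j).comp (hφ.restrict_scalars ℝ) hm
  have s1 := smoothMetric_static hV hs
  have sA := smoothMetric_static (h := fun w => (jacobian φ w).transpose) hV fun i j => hJs j i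
  have sB := smoothMetric_static (h := fun w => (jacobian φ w).map conj) hV fun i j =>
    Complex.conjCLE.contDiff.comp_contDiffOn (hJs i j)
  have hs' : ∀ i j, ContDiffOn ℝ ∞ (fun z => h' z i j) V := fun i j => by
    have : ContDiffOn ℝ ∞ (fun z => ((jacobian φ z).transpose * h (φ z) *
        (jacobian φ z).map conj) i j) V := by
      simp only [Matrix.mul_apply, Matrix.transpose_apply, Matrix.map_apply]
      exact ContDiffOn.sum fun b _ => (ContDiffOn.sum fun a _ => (hJs a i).mul (hs a b)).mul
        (Complex.conjCLE.contDiff.comp_contDiffOn (hJs b j))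
    exact this.congr fun z hz => by rw [hh' z hz]
  have s2 := smoothMetric_static hV hs'
  have uA : ∀ z ∈ V, IsUnit (jacobian φ z).transpose.det := fun z hz => by
    rw [Matrix.det_transpose]; exact hJ z hz
  have uB : ∀ z ∈ V, IsUnit ((jacobian φ z).map conj).det := fun z hz => by
    have : ((jacobian φ z).map conj).det = conj (jacobian φ z).det :=
      (RingHom.map_det (starRingEnd ℂ) _).symm
    rw [this]; exact (hJ z hz).map _
  have u1 : ∀ z ∈ V, IsUnit (h (φ z)).det := fun z hz => hu _ (hm hz)
  have u2 : ∀ z ∈ V, IsUnit (h' z).det := fun z hz => by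
    rw [hh' z hz, Matrix.det_mul, Matrix.det_mul]
    exact ((uA z hz).mul (u1 z hz)).mul (uB z hz)
  have hJd : ∀ z ∈ V, ∀ a i, DifferentiableAt ℂ (fun w => jacobian φ w a i) z := fun z hz a i =>
    ((contDiffOn_jacobian hV hφ a i).differentiableOn (by simp)).differentiableAt (hV.mem_nhds hz)
  have heq : toMatrix s2 = toMatrix sA * toMatrix s1 * toMatrix sB := matrix_ext fun q => by
    rw [map_mul, map_mul]
    exact hh' q.1.2 q.2.2
  have dA : ∀ j, mapD (Ω.wirt.db j) (toMatrix sA) = 0 := fun j => matrix_ext fun q => by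
    ext k l
    exact (ev_db_toMatrix sA q j k l).trans (dzbar_eq_zero (hJd _ q.2.2 _ _) j)
  have dB : ∀ i, mapD (Ω.wirt.d i) (toMatrix sB) = 0 := fun i => matrix_ext fun q => by
    ext k l
    exact (ev_d_toMatrix sB q i k l).trans (dz_conj_of_holomorphic (hJd _ q.2.2 _ _) i)
  let p : Ω.carrier := ⟨(0, w), ⟨le_rfl, one_pos⟩, hw⟩
  have e0 := ev_curvM s2 (fun q hq => u2 _ hq.2) p i j k l
  rw [← e0, heq, curvM_gauge _ _ _ _ _ (isUnit_det_of_ev fun q => uA _ q.2.2)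
    (isUnit_det_of_ev fun q => uB _ q.2.2) (isUnit_toMatrix s1 fun q hq => u1 _ hq.2) (dA j) (dB i)
    (by rw [mapD_comm (Ω.wirt.d_db i j), dB, map_zero]), Matrix.mul_apply, map_sum]
  simp only [Matrix.mul_apply, map_mul, map_sum, ev_toMatrix_apply,
    Matrix.transpose_apply, Matrix.map_apply, p]
  refine (Finset.sum_congr rfl fun d _ => congrArg (· * _) (Finset.sum_congr rfl fun c _ =>
    congrArg (_ * ·) ((ev_curvM s1 (fun q hq => u1 _ hq.2) p i j c d).trans
      (curvature_comp hU hV hφ hm hh hu hw i j c d)))).trans ?_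
  exact sum_mul_sum_eq_quadForm (jacobian φ w) (fun a b c d => curvature h a b c d (φ w)) i j k l

/-- The curvature is a tensor. -/
theorem curvatureForm_pullback (hU : IsOpen U) (hV : IsOpen V) (hφ : ContDiffOn ℂ ∞ φ V)
    (hm : Set.MapsTo φ V U) (hh : ∀ i j, ContDiffOn ℝ ∞ (fun z => h z i j) U)
    (hu : ∀ z ∈ U, IsUnit (h z).det) (hJ : ∀ z ∈ V, IsUnit (jacobian φ z).det)
    (hh' : ∀ z ∈ V, h' z = (jacobian φ z).transpose * h (φ z) * (jacobian φ z).map conj)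
    {w : Cn n} (hw : w ∈ V) (ξ η : Cn n) :
    curvatureForm h' w ξ η =
      curvatureForm h (φ w) ((jacobian φ w).mulVec ξ) ((jacobian φ w).mulVec η) := by
  have hc := curvature_pullback hU hV hφ hm hh hu hJ hh' hw
  have hcol : ∀ u : Cn n, (jacobian φ w).mulVec u = ∑ i, u i • fun a => jacobian φ w a i := by
    intro u
    funext a
    simp [Matrix.mulVec, dotProduct, mul_comm]
  have hq : ∀ u v : Cn n, curvatureForm h (φ w) u v =
      quadForm (fun a b c d => curvature h a b c d (φ w)) u u v v := fun u v => rfl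
  rw [hq, hcol, hcol, quadForm_sum₁]
  simp only [quadForm_sum₂]
  simp only [quadForm_sum₃]
  simp only [quadForm_sum₄, curvatureForm, hc, Finset.mul_sum]
  refine Finset.sum_congr rfl fun i _ => Finset.sum_congr rfl fun j _ =>
    Finset.sum_congr rfl fun k _ => Finset.sum_congr rfl fun l _ => by ring

end Pullback

/-! ### The metric and its curvature under changes of chart -/

section Charts

variable {n : ℕ} {M : Type*} [TopologicalSpace M] [ChartedSpace (Cn n) M]
  [IsManifold 𝓘(ℂ, Cn n) ω M] {e e' : OpenPartialHomeomorph M (Cn n)}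

theorem mdifferentiable_of_mem (he : e ∈ holomorphicCharts n M) :
    e.MDifferentiable 𝓘(ℂ, Cn n) 𝓘(ℂ, Cn n) :=
  ⟨(contMDiffOn_of_mem_maximalAtlas he).mdifferentiableOn (by simp),
    (contMDiffOn_symm_of_mem_maximalAtlas he).mdifferentiableOn (by simp)⟩

theorem contDiffOn_transition (he : e ∈ holomorphicCharts n M) (he' : e' ∈ holomorphicCharts n M) :
    ContDiffOn ℂ ω (e ∘ e'.symm) (e'.symm.trans e).source := by
  rw [← contMDiffOn_iff_contDiffOn]
  exact (contMDiffOn_of_mem_maximalAtlas he).comp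
    ((contMDiffOn_symm_of_mem_maximalAtlas he').mono (by simp)) (by
      intro w hw; simpa using hw.2)

/-- The derivative of the inverse of a chart. -/
def frame (e : OpenPartialHomeomorph M (Cn n)) (z : Cn n) :
    Cn n →L[ℂ] TangentSpace 𝓘(ℂ, Cn n) (e.symm z) :=
  mfderiv 𝓘(ℂ, Cn n) 𝓘(ℂ, Cn n) e.symm z

theorem frame_injective (he : e ∈ holomorphicCharts n M) {z : Cn n} (hz : z ∈ e.target) :
    Function.Injective (frame e z) := by
  have h := (mdifferentiable_of_mem he).comp_symm_deriv hz
  intro u v huv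
  have := congrArg (mfderiv 𝓘(ℂ, Cn n) 𝓘(ℂ, Cn n) e (e.symm z)) huv
  have hu := DFunLike.congr_fun h u
  have hv := DFunLike.congr_fun h v
  exact hu.symm.trans (this.trans hv)

variable (g : HermitianMetric n M)

theorem con_inChart (z : Cn n) (u v : Cn n) :
    con u v (g.inChart e z) = g.form (e.symm z) (frame e z u) (frame e z v) := by
  have e1 : ∀ u : Cn n, frame e z u = ∑ k, u k • frame e z (Pi.single k 1) := fun u => by
    conv_lhs => rw [eq_sum_single u]
    rw [map_sum]
    exact Finset.sum_congr rfl fun k _ => (frame e z).map_smul _ _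
  rw [e1 v, map_sum, con_apply, Finset.sum_comm]
  refine Finset.sum_congr rfl fun l _ => ?_
  rw [e1 u, map_sum (g.form (e.symm z)), LinearMap.sum_apply]
  refine Finset.sum_congr rfl fun k _ => ?_
  rw [LinearMap.map_smulₛₗ, LinearMap.map_smul (g.form (e.symm z)), LinearMap.smul_apply, mul_comm,
    mul_smul]
  rfl

theorem inChart_conjTranspose (z : Cn n) :
    (g.inChart e z).conjTranspose = g.inChart e z := by
  ext i j
  exact g.conj_symm (e.symm z) _ _

theorem con_inChart_pos (he : e ∈ holomorphicCharts n M) {z : Cn n} (hz : z ∈ e.target)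
    {u : Cn n} (hu : u ≠ 0) : 0 < (con u u (g.inChart e z)).re := by
  rw [con_inChart]
  refine g.pos _ _ fun h => hu ?_
  exact frame_injective he hz (h.trans (map_zero _).symm)

theorem con_eq_dotProduct (u : Cn n) (A : Matrix (Fin n) (Fin n) ℂ) :
    con u u A = dotProduct u (A.mulVec (star u)) := by
  simp only [con_apply, dotProduct, Matrix.mulVec, Finset.mul_sum, smul_eq_mul, Pi.star_apply]
  exact Finset.sum_congr rfl fun i _ => Finset.sum_congr rfl fun j _ => by
    rw [RCLike.star_def]; ring

open scoped ComplexOrder in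
theorem posDef_inChart (he : e ∈ holomorphicCharts n M) {z : Cn n} (hz : z ∈ e.target) :
    (g.inChart e z).PosDef := by
  have hh : (g.inChart e z).IsHermitian := inChart_conjTranspose g z
  refine Matrix.PosDef.of_dotProduct_mulVec_pos hh fun x hx => ?_
  rw [Complex.lt_def]
  refine ⟨?_, (hh.im_star_dotProduct_mulVec_self x).symm⟩
  have := con_inChart_pos g he hz (u := star x) (by simpa using hx)
  rwa [con_eq_dotProduct, star_star] at this

open scoped ComplexOrder in
theorem isUnit_inChart (he : e ∈ holomorphicCharts n M) {z : Cn n} (hz : z ∈ e.target) :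
    IsUnit (g.inChart e z).det :=
  (Matrix.isUnit_iff_isUnit_det _).1 (posDef_inChart g he hz).isUnit

theorem form_congr {x y : M} (hxy : x = y) (u v : Cn n) : g.form x u v = g.form y u v := by
  subst hxy; rfl

theorem frame_transition (he : e ∈ holomorphicCharts n M) (he' : e' ∈ holomorphicCharts n M)
    {w : Cn n} (hw : w ∈ (e'.symm.trans e).source) (u : Cn n) :
    (frame e' w u : Cn n) = frame e ((e ∘ e'.symm) w) ((jacobian (e ∘ e'.symm) w).mulVec u) := by
  have hO := (e'.symm.trans e).open_source
  have hw1 : w ∈ e'.target := hw.1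
  have hw2 : e'.symm w ∈ e.source := hw.2
  have h1 : e'.symm =ᶠ[nhds w] e.symm ∘ (e ∘ e'.symm) := by
    filter_upwards [hO.mem_nhds hw] with z hz
    exact (e.left_inv hz.2).symm
  have h2 : DifferentiableAt ℂ (e ∘ e'.symm) w :=
    ((contDiffOn_transition he he').differentiableOn (by simp)).differentiableAt (hO.mem_nhds hw)
  have h3 := mfderiv_comp (I := 𝓘(ℂ, Cn n)) (I' := 𝓘(ℂ, Cn n)) (I'' := 𝓘(ℂ, Cn n)) w
    ((mdifferentiable_of_mem he).mdifferentiableAt_symm (e.map_source hw2))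
    h2.mdifferentiableAt
  have h4 : ∀ u : Cn n, fderiv ℂ (e ∘ e'.symm) w u = (jacobian (e ∘ e'.symm) w).mulVec u := by
    intro u
    conv_lhs => rw [eq_sum_single u, map_sum]
    funext a
    simp [jacobian, Matrix.mulVec, dotProduct, mul_comm]
  have h5 : mfderiv 𝓘(ℂ, Cn n) 𝓘(ℂ, Cn n) e'.symm w =
      mfderiv 𝓘(ℂ, Cn n) 𝓘(ℂ, Cn n) (e.symm ∘ (e ∘ e'.symm)) w := h1.mfderiv_eq
  have h6 := DFunLike.congr_fun h5 u
  have h7 := DFunLike.congr_fun h3 u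
  refine h6.trans (h7.trans ?_)
  rw [← h4, ← mfderiv_eq_fderiv]
  rfl

theorem con_transition (he : e ∈ holomorphicCharts n M) (he' : e' ∈ holomorphicCharts n M)
    {w : Cn n} (hw : w ∈ (e'.symm.trans e).source) (u v : Cn n) :
    con u v (g.inChart e' w) = con ((jacobian (e ∘ e'.symm) w).mulVec u)
      ((jacobian (e ∘ e'.symm) w).mulVec v) (g.inChart e ((e ∘ e'.symm) w)) := by
  rw [con_inChart, con_inChart]
  have hx : e'.symm w = e.symm ((e ∘ e'.symm) w) := (e.left_inv hw.2).symm
  refine (form_congr g hx _ _).trans ?_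
  rw [frame_transition he he' hw, frame_transition he he' hw]

theorem ext_con {A B : Matrix (Fin n) (Fin n) ℂ} (h : ∀ u v, con u v A = con u v B) : A = B := by
  ext i j
  rw [← con_basisVec i j A, ← con_basisVec i j B, h]

theorem con_mul_mul_conj (J A : Matrix (Fin n) (Fin n) ℂ) (u v : Cn n) :
    con u v (J.transpose * A * J.map conj) = con (J.mulVec u) (J.mulVec v) A := by
  have e1 : ∀ (u v : Cn n) (A : Matrix (Fin n) (Fin n) ℂ),
      con u v A = dotProduct u (A.mulVec (star v)) := fun u v A => by
    simp only [con_apply, dotProduct, Matrix.mulVec, Finset.mul_sum, smul_eq_mul, Pi.star_apply]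
    exact Finset.sum_congr rfl fun i _ => Finset.sum_congr rfl fun j _ => by
      rw [RCLike.star_def]; ring
  have e3 : (J.map conj).mulVec (star v) = star (J.mulVec v) := by
    funext i
    simp [Matrix.mulVec, dotProduct]
  rw [e1, e1, ← Matrix.mulVec_mulVec, ← Matrix.mulVec_mulVec, e3,
    Matrix.dotProduct_mulVec u, Matrix.vecMul_transpose]

theorem inChart_transition (he : e ∈ holomorphicCharts n M) (he' : e' ∈ holomorphicCharts n M)
    {w : Cn n} (hw : w ∈ (e'.symm.trans e).source) :
    g.inChart e' w = (jacobian (e ∘ e'.symm) w).transpose * g.inChart e ((e ∘ e'.symm) w) *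
      (jacobian (e ∘ e'.symm) w).map conj :=
  ext_con fun u v => by rw [con_mul_mul_conj, con_transition g he he' hw]

/-- The transformation law exhibits the Jacobian determinant as a factor of the determinant of the
metric matrix in `e'`, which is nonzero. -/
theorem isUnit_jacobian (he : e ∈ holomorphicCharts n M) (he' : e' ∈ holomorphicCharts n M)
    {w : Cn n} (hw : w ∈ (e'.symm.trans e).source) (g : HermitianMetric n M) :
    IsUnit (jacobian (e ∘ e'.symm) w).det := by
  have h1 := isUnit_inChart g he' hw.1
  rw [inChart_transition g he he' hw, Matrix.det_mul, Matrix.det_mul, Matrix.det_transpose] at h1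
  exact isUnit_of_mul_isUnit_left (isUnit_of_mul_isUnit_left h1)

theorem contDiffOn_inChart (he : e ∈ holomorphicCharts n M) (i j : Fin n) :
    ContDiffOn ℝ ∞ (fun z => g.inChart e z i j) e.target :=
  contDiffOn_pi.1 (contDiffOn_pi.1 (g.smooth e he) i) j

theorem mapsTo_transition : Set.MapsTo (e ∘ e'.symm) (e'.symm.trans e).source e.target :=
  fun _ hw => e.map_source hw.2

theorem curvature_transition (he : e ∈ holomorphicCharts n M) (he' : e' ∈ holomorphicCharts n M)
    {w : Cn n} (hw : w ∈ (e'.symm.trans e).source) (i j k l : Fin n) :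
    curvature (g.inChart e') i j k l w =
      quadForm (fun a b c d => curvature (g.inChart e) a b c d ((e ∘ e'.symm) w))
      (fun a => jacobian (e ∘ e'.symm) w a i) (fun a => jacobian (e ∘ e'.symm) w a j)
      (fun a => jacobian (e ∘ e'.symm) w a k) (fun a => jacobian (e ∘ e'.symm) w a l) :=
  curvature_pullback e.open_target (e'.symm.trans e).open_source
    ((contDiffOn_transition he he').of_le (by simp)) mapsTo_transition
    (contDiffOn_inChart g he) (fun _ hz => isUnit_inChart g he hz)
    (fun _ hz => isUnit_jacobian he he' hz g) (fun _ hz => inChart_transition g he he' hz) hw i j k l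

theorem curvatureForm_transition (he : e ∈ holomorphicCharts n M)
    (he' : e' ∈ holomorphicCharts n M) {w : Cn n} (hw : w ∈ (e'.symm.trans e).source) (ξ η : Cn n) :
    curvatureForm (g.inChart e') w ξ η = curvatureForm (g.inChart e) ((e ∘ e'.symm) w)
      ((jacobian (e ∘ e'.symm) w).mulVec ξ) ((jacobian (e ∘ e'.symm) w).mulVec η) :=
  curvatureForm_pullback e.open_target (e'.symm.trans e).open_source
    ((contDiffOn_transition he he').of_le (by simp)) mapsTo_transition
    (contDiffOn_inChart g he) (fun _ hz => isUnit_inChart g he hz)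
    (fun _ hz => isUnit_jacobian he he' hz g) (fun _ hz => inChart_transition g he he' hz) hw ξ η

/-! ### Linear changes of coordinates -/

/-- An invertible matrix as a continuous linear equivalence. -/
def matEquiv (U : Matrix (Fin n) (Fin n) ℂ) (hU : IsUnit U.det) : Cn n ≃L[ℂ] Cn n :=
  (Matrix.toLin'OfInv (Matrix.nonsing_inv_mul U hU)
    (Matrix.mul_nonsing_inv U hU)).toContinuousLinearEquiv

theorem matEquiv_apply (U : Matrix (Fin n) (Fin n) ℂ) (hU : IsUnit U.det) (z : Cn n) :
    matEquiv U hU z = U.mulVec z := rfl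

/-- The chart `e` followed by `U⁻¹`. -/
def linChart (e : OpenPartialHomeomorph M (Cn n)) (U : Matrix (Fin n) (Fin n) ℂ)
    (hU : IsUnit U.det) : OpenPartialHomeomorph M (Cn n) :=
  e.transHomeomorph (matEquiv U hU).symm.toHomeomorph

variable {U : Matrix (Fin n) (Fin n) ℂ} (hU : IsUnit U.det)

theorem linChart_mem (he : e ∈ holomorphicCharts n M) :
    linChart e U hU ∈ holomorphicCharts n M := by
  refine OpenPartialHomeomorph.mem_maximalAtlas_of_contMDiffOn _ ?_ ?_
  · exact (matEquiv U hU).symm.contDiff.contMDiff.comp_contMDiffOn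
      (contMDiffOn_of_mem_maximalAtlas he)
  · exact (contMDiffOn_symm_of_mem_maximalAtlas he).comp
      (matEquiv U hU).contDiff.contMDiff.contMDiffOn fun w hw => hw

theorem mem_linChart_trans_source {w : Cn n} (hw : U.mulVec w ∈ e.target) :
    w ∈ ((linChart e U hU).symm.trans e).source :=
  ⟨hw, e.map_target hw⟩

theorem linChart_transition_apply {w : Cn n} (hw : U.mulVec w ∈ e.target) :
    (e ∘ (linChart e U hU).symm) w = U.mulVec w := e.right_inv hw

theorem jacobian_linChart {w : Cn n} (hw : U.mulVec w ∈ e.target) :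
    jacobian (e ∘ (linChart e U hU).symm) w = U := by
  have h1 : (e ∘ (linChart e U hU).symm) =ᶠ[nhds w] matEquiv U hU := by
    filter_upwards [((linChart e U hU).open_target).mem_nhds hw] with z hz
    exact linChart_transition_apply hU hz
  ext a i
  rw [jacobian, Matrix.of_apply, h1.fderiv_eq, (matEquiv U hU).fderiv]
  change U.mulVec (Pi.single i 1) a = U a i
  simp

theorem inChart_linChart (he : e ∈ holomorphicCharts n M) {w : Cn n}
    (hw : U.mulVec w ∈ e.target) : g.inChart (linChart e U hU) w =
      U.transpose * g.inChart e (U.mulVec w) * U.map conj := by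
  have := inChart_transition g he (linChart_mem hU he) (mem_linChart_trans_source hU hw)
  rwa [jacobian_linChart hU hw, linChart_transition_apply hU hw] at this

theorem curvature_linChart (he : e ∈ holomorphicCharts n M) {w : Cn n}
    (hw : U.mulVec w ∈ e.target) (i j k l : Fin n) :
    curvature (g.inChart (linChart e U hU)) i j k l w =
      quadForm (fun a b c d => curvature (g.inChart e) a b c d (U.mulVec w))
      (fun a => U a i) (fun a => U a j) (fun a => U a k) (fun a => U a l) := by
  have := curvature_transition g he (linChart_mem hU he) (mem_linChart_trans_source hU hw) i j k l
  rwa [jacobian_linChart hU hw, linChart_transition_apply hU hw] at this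

/-- Because `U` is constant, no derivative of it appears: the first derivatives in the new chart are
bounded by those in the old one and by the size of `U`. -/
theorem dz_linChart (he : e ∈ holomorphicCharts n M) {w : Cn n}
    (hw : U.mulVec w ∈ e.target) (m i j : Fin n) :
    dz m (fun z => g.inChart (linChart e U hU) z i j) w =
      ∑ p, ∑ q, U p i * conj (U q j) * ∑ a, U a m *
        dz a (fun z => g.inChart e z p q) (U.mulVec w) := by
  have h1 : (fun z => g.inChart (linChart e U hU) z i j) =ᶠ[nhds w]
      fun z => ∑ p, ∑ q, U p i * conj (U q j) * g.inChart e ((matEquiv U hU) z) p q := by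
    filter_upwards [((linChart e U hU).open_target).mem_nhds hw] with z hz
    rw [inChart_linChart g hU he hz, Matrix.mul_apply]
    simp only [Matrix.mul_apply, Matrix.transpose_apply, Matrix.map_apply, Finset.sum_mul]
    rw [Finset.sum_comm]
    exact Finset.sum_congr rfl fun p _ => Finset.sum_congr rfl fun q _ => by
      rw [matEquiv_apply]; ring
  have hd : ∀ p q, DifferentiableAt ℝ (fun z => g.inChart e z p q) (U.mulVec w) := fun p q =>
    ((contDiffOn_inChart g he p q).differentiableOn (by simp)).differentiableAt
      (e.open_target.mem_nhds hw)
  have hφ : DifferentiableAt ℂ (matEquiv U hU) w := (matEquiv U hU).differentiableAt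
  have hd' : ∀ p q, DifferentiableAt ℝ (fun z => g.inChart e ((matEquiv U hU) z) p q) w :=
    fun p q => (hd p q).comp w (hφ.restrictScalars ℝ)
  have hv : ∀ v, fderiv ℝ (fun z => ∑ p, ∑ q, U p i * conj (U q j) *
      g.inChart e ((matEquiv U hU) z) p q) w v = ∑ p, ∑ q, U p i * conj (U q j) *
      fderiv ℝ (fun z => g.inChart e ((matEquiv U hU) z) p q) w v := by
    intro v
    rw [fderiv_fun_sum fun p _ => DifferentiableAt.fun_sum fun q _ => (hd' p q).const_mul _,
      sum_apply]
    refine Finset.sum_congr rfl fun p _ => ?_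
    rw [fderiv_fun_sum fun q _ => (hd' p q).const_mul _, sum_apply]
    refine Finset.sum_congr rfl fun q _ => ?_
    rw [fderiv_const_mul (hd' p q)]
    rfl
  have hJ : jacobian (matEquiv U hU) w = U := by
    ext a i
    rw [jacobian, Matrix.of_apply, (matEquiv U hU).fderiv]
    change U.mulVec (Pi.single i 1) a = U a i
    simp
  rw [dz_congr h1, dz, hv, hv, Finset.mul_sum, ← Finset.sum_sub_distrib, Finset.sum_div]
  refine Finset.sum_congr rfl fun p _ => ?_
  rw [Finset.mul_sum, ← Finset.sum_sub_distrib, Finset.sum_div]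
  refine Finset.sum_congr rfl fun q _ => ?_
  have h3 := dz_comp (F := fun z => g.inChart e z p q) hφ (hd p q) m
  rw [hJ] at h3
  rw [matEquiv_apply] at h3
  rw [← h3, dz]
  ring

end Charts

/-! ### Unitary linear coordinates and uniform bounds on compact sets -/

section Unitary

variable {n : ℕ}

-- Factor `A = X* X` and let `U` be the entrywise conjugate of `X⁻¹`. The squared norm of row `a` of
-- `X⁻¹` is `A⁻¹ a a`, so the entries of `U` are controlled by `A⁻¹`, uniformly over compact sets
-- and without any continuous choice of frame.
open scoped ComplexOrder MatrixOrder in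
theorem exists_unitary_frame {A : Matrix (Fin n) (Fin n) ℂ} (hA : A.PosDef) :
    ∃ U : Matrix (Fin n) (Fin n) ℂ, IsUnit U.det ∧ U.transpose * A * U.map conj = 1 ∧
      ∀ a i, ‖U a i‖ ≤ ‖A⁻¹ a a‖ + 1 := by
  obtain ⟨X, hX⟩ := CStarAlgebra.nonneg_iff_eq_star_mul_self.1 hA.posSemidef.nonneg
  rw [Matrix.star_eq_conjTranspose] at hX
  have hdet : IsUnit A.det := (Matrix.isUnit_iff_isUnit_det _).1 hA.isUnit
  have hXd : IsUnit X.det := by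
    rw [hX, Matrix.det_mul] at hdet
    exact isUnit_of_mul_isUnit_right hdet
  have h1 : X * X⁻¹ = 1 := Matrix.mul_nonsing_inv _ hXd
  have h2 : (X⁻¹).conjTranspose * X.conjTranspose = 1 := by
    rw [← Matrix.conjTranspose_mul, h1, Matrix.conjTranspose_one]
  have h3 : ((X⁻¹).map conj).map conj = X⁻¹ := by
    ext i j
    simp only [Matrix.map_apply, Complex.conj_conj]
  have h4 : ((X⁻¹).map conj).transpose = (X⁻¹).conjTranspose := rfl
  have h5 : A⁻¹ = X⁻¹ * (X⁻¹).conjTranspose := by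
    rw [hX, Matrix.mul_inv_rev, Matrix.conjTranspose_nonsing_inv]
  refine ⟨(X⁻¹).map conj, ?_, ?_, fun a i => ?_⟩
  · have e : ((X⁻¹).map conj).det = conj (X⁻¹).det := (RingHom.map_det (starRingEnd ℂ) _).symm
    rw [e]
    refine IsUnit.map _ ?_
    have := congrArg Matrix.det h1
    rw [Matrix.det_mul, Matrix.det_one] at this
    exact IsUnit.of_mul_eq_one _ ((mul_comm _ _).trans this)
  · rw [h3, h4, hX, ← mul_assoc, h2, one_mul, h1]
  · rw [Matrix.map_apply, RCLike.norm_conj]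
    have e : A⁻¹ a a = ((∑ i, ‖X⁻¹ a i‖ ^ 2 : ℝ) : ℂ) := by
      rw [h5, Matrix.mul_apply]
      push_cast
      exact Finset.sum_congr rfl fun i _ => RCLike.mul_conj (X⁻¹ a i)
    have h6 : ‖X⁻¹ a i‖ ^ 2 ≤ ‖A⁻¹ a a‖ := by
      rw [e, Complex.norm_real, Real.norm_of_nonneg (by positivity)]
      exact Finset.single_le_sum (f := fun i => ‖X⁻¹ a i‖ ^ 2) (fun _ _ => by positivity)
        (Finset.mem_univ i)
    nlinarith [norm_nonneg (X⁻¹ a i)]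

theorem norm_quadForm_le_of_le {T : Fin n → Fin n → Fin n → Fin n → ℂ} {u v w y : Fin n → ℂ}
    {β r : ℝ} (hT : ∀ i j k l, ‖T i j k l‖ ≤ β)
    (hu : ∀ i, ‖u i‖ ≤ r) (hv : ∀ i, ‖v i‖ ≤ r) (hw : ∀ i, ‖w i‖ ≤ r) (hy : ∀ i, ‖y i‖ ≤ r) :
    ‖quadForm T u v w y‖ ≤ n * (n * (n * (n * (β * r * r * r * r)))) := by
  refine norm_sum_fin_le fun i => norm_sum_fin_le fun j => norm_sum_fin_le fun k =>
    norm_sum_fin_le fun l => ?_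
  exact norm_mul_le_of_le' (norm_mul_le_of_le' (norm_mul_le_of_le' (norm_mul_le_of_le'
    (hT i j k l) (hu i)) (((RCLike.norm_conj (v j)).le).trans (hv j))) (hw k))
    (((RCLike.norm_conj (y l)).le).trans (hy l))

namespace SpaceTime

variable {Ω : SpaceTime n} {h : ℝ → Cn n → Matrix (Fin n) (Fin n) ℂ}

theorem continuousOn_of_ev {F : ℝ → Cn n → ℂ} (f : Ω.Fn)
    (hF : ∀ p : Ω.carrier, F p.1.1 p.1.2 = Ω.ev p f) :
    ContinuousOn (fun q : ℝ × Cn n => F q.1 q.2) Ω.carrier :=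
  (Ω.contDiffOn_of_eq (f := f) (F := fun q => F q.1 q.2) hF).continuousOn

theorem continuousOn_curvature (hf : IsFlow Ω h) (i j k l : Fin n) :
    ContinuousOn (fun q : ℝ × Cn n => curvature (h q.1) i j k l q.2) Ω.carrier :=
  continuousOn_of_ev (F := fun t z => curvature (h t) i j k l z) _
    fun p => (ev_curvM hf.smooth hf.unit p i j k l).symm

/-- Bounds for the geometry on compact sets. -/
theorem exists_bound (hf : IsFlow Ω h) {C : Set (ℝ × Cn n)} (hC : IsCompact C)
    (hCs : C ⊆ Ω.carrier) : ∃ β : ℝ, 0 ≤ β ∧ ∀ q ∈ C,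
      (∀ m i j, ‖dz m (fun w => h q.1 w i j) q.2‖ ≤ β) ∧
      (∀ i j k l, ‖curvature (h q.1) i j k l q.2‖ ≤ β) ∧ ∀ i j, ‖(h q.1 q.2)⁻¹ i j‖ ≤ β := by
  have c1 : ContinuousOn (fun (q : ℝ × Cn n) m i j => dz m (fun w => h q.1 w i j) q.2) C :=
    continuousOn_pi.2 fun m => continuousOn_pi.2 fun i => continuousOn_pi.2 fun j =>
      (continuousOn_of_ev (F := fun t z => dz m (fun w => h t w i j) z) _
        fun p => (ev_d_toMatrix hf.smooth p m i j).symm).mono hCs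
  have c2 : ContinuousOn (fun (q : ℝ × Cn n) i j k l => curvature (h q.1) i j k l q.2) C :=
    continuousOn_pi.2 fun i => continuousOn_pi.2 fun j => continuousOn_pi.2 fun k =>
      continuousOn_pi.2 fun l => (continuousOn_curvature hf i j k l).mono hCs
  have c3 : ContinuousOn (fun (q : ℝ × Cn n) i j => (h q.1 q.2)⁻¹ i j) C :=
    continuousOn_pi.2 fun i => continuousOn_pi.2 fun j =>
      (continuousOn_of_ev (F := fun t z => (h t z)⁻¹ i j) _
        fun p => (ev_inv_toMatrix hf.smooth hf.unit p i j).symm).mono hCs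
  obtain ⟨b1, h1⟩ := hC.exists_bound_of_continuousOn c1
  obtain ⟨b2, h2⟩ := hC.exists_bound_of_continuousOn c2
  obtain ⟨b3, h3⟩ := hC.exists_bound_of_continuousOn c3
  refine ⟨|b1| + |b2| + |b3|, by positivity, fun q hq => ⟨fun m i j => ?_, fun i j k l => ?_,
    fun i j => ?_⟩⟩
  · have e1 := norm_le_pi_norm (fun m i j => dz m (fun w => h q.1 w i j) q.2) m
    have e2 := norm_le_pi_norm (fun i j => dz m (fun w => h q.1 w i j) q.2) i
    have e3 := norm_le_pi_norm (fun j => dz m (fun w => h q.1 w i j) q.2) j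
    have e4 := (e3.trans e2).trans (e1.trans (h1 q hq))
    linarith [le_abs_self b1, abs_nonneg b2, abs_nonneg b3]
  · have e1 := norm_le_pi_norm (fun i j k l => curvature (h q.1) i j k l q.2) i
    have e2 := norm_le_pi_norm (fun j k l => curvature (h q.1) i j k l q.2) j
    have e3 := norm_le_pi_norm (fun k l => curvature (h q.1) i j k l q.2) k
    have e4 := norm_le_pi_norm (fun l => curvature (h q.1) i j k l q.2) l
    have e5 := ((e4.trans e3).trans e2).trans (e1.trans (h2 q hq))
    linarith [le_abs_self b2, abs_nonneg b1, abs_nonneg b3]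
  · have e1 := norm_le_pi_norm (fun i j => (h q.1 q.2)⁻¹ i j) i
    have e2 := norm_le_pi_norm (fun j => (h q.1 q.2)⁻¹ i j) j
    have e3 := e2.trans (e1.trans (h3 q hq))
    linarith [le_abs_self b3, abs_nonneg b1, abs_nonneg b2]

end SpaceTime

end Unitary

/-! ### The derivative estimate on the manifold, uniform on compact sets -/

section ManifoldFlow

open SpaceTime

variable {n : ℕ} {M : Type*} [TopologicalSpace M] [ChartedSpace (Cn n) M]
  [IsManifold 𝓘(ℂ, Cn n) ω M] {e e' : OpenPartialHomeomorph M (Cn n)}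
  {g₀ : HermitianMetric n M} {τ : ℝ} {g : ℝ → HermitianMetric n M}

/-- The space-time domain of a chart. -/
def chartDomain (e : OpenPartialHomeomorph M (Cn n)) (hτ : 0 < τ) : SpaceTime n :=
  ⟨τ, e.target, hτ, e.open_target⟩

theorem isFlow_inChart (hg : IsHermitianCurvatureFlow g₀ τ g) (hτ : 0 < τ)
    (he : e ∈ holomorphicCharts n M) :
    IsFlow (chartDomain e hτ) (fun t => (g t).inChart e) where
  smooth i j := contDiffOn_pi.1 (contDiffOn_pi.1 (hg.smooth e he) i) j
  herm p _ := inChart_conjTranspose (g p.1) p.2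
  unit p hp := isUnit_inChart (g p.1) he hp.2
  flow p hp i j := hg.evolution e he p.2 hp.2 p.1 hp.1 i j

/-- The perturbed curvature `Ω(ξ, ξ̄, η, η̄) + c |ξ|² |η|²`. -/
def perturbedCurv (g : HermitianMetric n M) (c : ℝ) (e : OpenPartialHomeomorph M (Cn n)) (z : Cn n)
    (ξ η : Cn n) : ℝ :=
  (curvatureForm (g.inChart e) z ξ η).re +
    c * (con ξ ξ (g.inChart e z) * con η η (g.inChart e z)).re

theorem perturbedCurv_transition (g : HermitianMetric n M) (c : ℝ) (he : e ∈ holomorphicCharts n M)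
    (he' : e' ∈ holomorphicCharts n M) {w : Cn n} (hw : w ∈ (e'.symm.trans e).source) (ξ η : Cn n) :
    perturbedCurv g c e' w ξ η = perturbedCurv g c e ((e ∘ e'.symm) w)
      ((jacobian (e ∘ e'.symm) w).mulVec ξ) ((jacobian (e ∘ e'.symm) w).mulVec η) := by
  rw [perturbedCurv, perturbedCurv, curvatureForm_transition g he he' hw,
    con_transition g he he' hw, con_transition g he he' hw]

/-- On compact sets, the time derivative of the perturbed curvature at a null pair is bounded below
by the size of the perturbation. -/
theorem exists_deriv_lower_bound (hg : IsHermitianCurvatureFlow g₀ τ g) (hτ : 0 < τ)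
    (he : e ∈ holomorphicCharts n M) {K : Set (Cn n)} (hK : IsCompact K) (hKe : K ⊆ e.target)
    {T : ℝ} (hT : T < τ) : ∃ κ : ℝ, ∀ t ∈ Set.Icc 0 T, ∀ z ∈ K, ∀ c : ℝ, |c| ≤ 1 → ∀ ξ η : Cn n,
      con ξ ξ ((g t).inChart e z) = 1 → con η η ((g t).inChart e z) = 1 →
      (∀ e' ∈ holomorphicCharts n M, ∀ z' ∈ e'.target, ∀ u w : Cn n,
        0 ≤ perturbedCurv (g t) c e' z' u w) →
      perturbedCurv (g t) c e z ξ η = 0 →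
      ∃ d, HasDerivWithinAt (fun s => perturbedCurv (g s) c e z ξ η) d (Set.Ico 0 τ) t ∧
        - (κ * |c|) ≤ d := by
  have hf := isFlow_inChart hg hτ he
  obtain ⟨β, hβ0, hβ⟩ := exists_bound hf (isCompact_Icc.prod hK) (C := Set.Icc 0 T ×ˢ K)
    (fun q hq => ⟨⟨hq.1.1, hq.1.2.trans_lt hT⟩, hKe hq.2⟩)
  set r := β + 1 with hr
  -- `b1` and `b2` bound the first derivatives of the metric and the curvature after a linear change
  -- of coordinates whose matrix has entries of size at most `r`.
  set b1 := (n : ℝ) * (n * (r * r * (n * (r * β))))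
  set b2 := (n : ℝ) * (n * (n * (n * (β * r * r * r * r))))
  have hr0 : 0 ≤ r := by positivity
  have hb1 : 0 ≤ b1 := by positivity
  have hb2 : 0 ≤ b2 := by positivity
  refine ⟨evolutionConst n (1 + b1 + b2), fun t ht z hz c hc ξ η hξ hη hpos h0 => ?_⟩
  obtain ⟨hΓ, hO, hI⟩ := hβ (t, z) ⟨ht, hz⟩
  have hze := hKe hz
  have htτ : t ∈ Set.Ico 0 τ := ⟨ht.1, ht.2.trans_lt hT⟩
  obtain ⟨U, hU, hU1, hUb⟩ := exists_unitary_frame (posDef_inChart (g t) he hze)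
  have hUr : ∀ a i, ‖U a i‖ ≤ r := fun a i => (hUb a i).trans (by linarith [hI a a])
  set w := U⁻¹.mulVec z with hw
  have hUw : U.mulVec w = z := by
    rw [hw, Matrix.mulVec_mulVec, Matrix.mul_nonsing_inv _ hU, Matrix.one_mulVec]
  have hwt : U.mulVec w ∈ e.target := by rw [hUw]; exact hze
  have hback : ∀ u : Cn n, U.mulVec (U⁻¹.mulVec u) = u := fun u => by
    rw [Matrix.mulVec_mulVec, Matrix.mul_nonsing_inv _ hU, Matrix.one_mulVec]
  have he2 := linChart_mem hU he
  have hf2 := isFlow_inChart hg hτ he2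
  have hsrc := mem_linChart_trans_source hU hwt
  -- The matrix `U` is adapted to the metric at the single time `t`, but it is constant, so by
  -- tensoriality the two functions of `s` agree at all times and have the same derivative.
  have htr : ∀ s, perturbedCurv (g s) c (linChart e U hU) w (U⁻¹.mulVec ξ) (U⁻¹.mulVec η) =
      perturbedCurv (g s) c e z ξ η := fun s => by
    rw [perturbedCurv_transition (g s) c he he2 hsrc, jacobian_linChart hU hwt,
      linChart_transition_apply hU hwt, hUw, hback, hback]
  have h1 : (g t).inChart (linChart e U hU) w = 1 := by
    rw [inChart_linChart (g t) hU he hwt, hUw, hU1]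
  have hunit : ∀ u : Cn n, con u u ((g t).inChart e z) = 1 →
      ∑ i, U⁻¹.mulVec u i * conj (U⁻¹.mulVec u i) = 1 := by
    intro u hu
    rw [← con_self_one, ← hU1, con_mul_mul_conj, hback, hu]
  have hG : con (U⁻¹.mulVec ξ) (U⁻¹.mulVec ξ) ((g t).inChart (linChart e U hU) w) *
      con (U⁻¹.mulVec η) (U⁻¹.mulVec η) ((g t).inChart (linChart e U hU) w) = 1 := by
    rw [h1, con_self_one, con_self_one, hunit ξ hξ, hunit η hη, one_mul]
  have key := hf2.deriv_lower_bound ⟨(t, w), htτ, hwt⟩ h1 (β := 1 + b1 + b2) (by linarith)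
    (fun m i j => ?_) (fun i j k l => ?_) hc (hunit ξ hξ) (hunit η hη)
    (fun z' hz' u v => hpos _ he2 z' hz' u v) ?_
  · obtain ⟨d, hd, hdb⟩ := key
    refine ⟨d, ?_, hdb⟩
    have e1 : (fun s => perturbedCurv (g s) c e z ξ η) = fun s =>
      perturbedCurv (g s) c (linChart e U hU) w (U⁻¹.mulVec ξ) (U⁻¹.mulVec η) :=
      funext fun s => (htr s).symm
    rw [e1]
    exact hd
  · change ‖dz m (fun z => (g t).inChart (linChart e U hU) z i j) w‖ ≤ _
    rw [dz_linChart (g t) hU he hwt, hUw]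
    refine le_trans ?_ (by linarith : b1 ≤ 1 + b1 + b2)
    refine norm_sum_fin_le fun p => norm_sum_fin_le fun q => norm_mul_le_of_le'
      (norm_mul_le_of_le' (hUr p i) ((RCLike.norm_conj (U q j)).le.trans (hUr q j)))
      (norm_sum_fin_le fun a => norm_mul_le_of_le' (hUr a m) (hΓ a p q))
  · change ‖curvature ((g t).inChart (linChart e U hU)) i j k l w‖ ≤ _
    rw [curvature_linChart (g t) hU he hwt, hUw]
    refine le_trans ?_ (by linarith : b2 ≤ 1 + b1 + b2)
    exact norm_quadForm_le_of_le hO (fun a => hUr a i) (fun a => hUr a j) (fun a => hUr a k)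
      (fun a => hUr a l)
  · have h2 := (htr t).trans h0
    rw [perturbedCurv, hG] at h2
    simpa using h2

end ManifoldFlow

/-! ### The maximum principle -/

section MaximumPrinciple

open SpaceTime

variable {n : ℕ} {M : Type*} [TopologicalSpace M] [ChartedSpace (Cn n) M]
  [IsManifold 𝓘(ℂ, Cn n) ω M] {e e' : OpenPartialHomeomorph M (Cn n)}
  {g₀ : HermitianMetric n M} {τ : ℝ} {g : ℝ → HermitianMetric n M}

theorem con_smul_smul (a : ℂ) (ξ : Cn n) (A : Matrix (Fin n) (Fin n) ℂ) :
    con (a • ξ) (a • ξ) A = a * conj a * con ξ ξ A := by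
  simp only [con_apply, Finset.mul_sum, Pi.smul_apply, smul_eq_mul, map_mul]
  exact Finset.sum_congr rfl fun i _ => Finset.sum_congr rfl fun j _ => by ring

theorem perturbedCurv_smul (g : HermitianMetric n M) (c : ℝ) (z : Cn n) (r s : ℝ) (ξ η : Cn n) :
    perturbedCurv g c e z ((r : ℂ) • ξ) ((s : ℂ) • η) =
      r ^ 2 * s ^ 2 * perturbedCurv g c e z ξ η := by
  have h1 : curvatureForm (g.inChart e) z ((r : ℂ) • ξ) ((s : ℂ) • η) =
      ((r ^ 2 * s ^ 2 : ℝ) : ℂ) * curvatureForm (g.inChart e) z ξ η := by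
    change quadForm _ _ _ _ _ = _ * quadForm _ _ _ _ _
    rw [quadForm_smul₁, quadForm_smul₂, quadForm_smul₃, quadForm_smul₄]
    simp only [Complex.conj_ofReal]
    push_cast
    ring
  have h2 : con ((r : ℂ) • ξ) ((r : ℂ) • ξ) (g.inChart e z) *
      con ((s : ℂ) • η) ((s : ℂ) • η) (g.inChart e z) = ((r ^ 2 * s ^ 2 : ℝ) : ℂ) *
      (con ξ ξ (g.inChart e z) * con η η (g.inChart e z)) := by
    rw [con_smul_smul, con_smul_smul]
    simp only [Complex.conj_ofReal]
    push_cast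
    ring
  rw [perturbedCurv, h1, h2, Complex.re_ofReal_mul, Complex.re_ofReal_mul, perturbedCurv]
  ring

theorem con_inChart_ofReal (g : HermitianMetric n M) (z : Cn n) (ξ : Cn n) :
    ((con ξ ξ (g.inChart e z)).re : ℂ) = con ξ ξ (g.inChart e z) := by
  rw [con_inChart]
  exact Complex.conj_eq_iff_re.1 (g.conj_symm _ _ _)

theorem con_mul_con_pos (g : HermitianMetric n M) (he : e ∈ holomorphicCharts n M) {z : Cn n}
    (hz : z ∈ e.target) {ξ η : Cn n} (hξ : ξ ≠ 0) (hη : η ≠ 0) :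
    0 < (con ξ ξ (g.inChart e z) * con η η (g.inChart e z)).re := by
  rw [← con_inChart_ofReal g z ξ, Complex.re_ofReal_mul]
  exact mul_pos (con_inChart_pos g he hz hξ) (con_inChart_pos g he hz hη)

/-- Rescaling to a unit vector of the metric. -/
theorem exists_smul_con_eq_one (g : HermitianMetric n M) (he : e ∈ holomorphicCharts n M)
    {z : Cn n} (hz : z ∈ e.target) {ξ : Cn n} (hξ : ξ ≠ 0) :
    ∃ r : ℝ, con ((r : ℂ) • ξ) ((r : ℂ) • ξ) (g.inChart e z) = 1 := by
  have hp := con_inChart_pos g he hz hξ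
  refine ⟨(√(con ξ ξ (g.inChart e z)).re)⁻¹, ?_⟩
  rw [con_smul_smul, ← con_inChart_ofReal g z ξ, Complex.conj_ofReal]
  norm_cast
  rw [← mul_inv, Real.mul_self_sqrt hp.le]
  exact inv_mul_cancel₀ hp.ne'

theorem perturbedCurv_eq_zero_of_left (g : HermitianMetric n M) (c : ℝ) (z η : Cn n) :
    perturbedCurv g c e z 0 η = 0 := by
  have := perturbedCurv_smul (e := e) g c z 0 1 0 η
  simpa using this

theorem perturbedCurv_eq_zero_of_right (g : HermitianMetric n M) (c : ℝ) (z ξ : Cn n) :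
    perturbedCurv g c e z ξ 0 = 0 := by
  have := perturbedCurv_smul (e := e) g c z 1 0 ξ 0
  simpa using this

/-- By homogeneity, it suffices to test pairs of vectors of norm one. -/
theorem perturbedCurv_eq_sphere (g : HermitianMetric n M) (c : ℝ) (z : Cn n) {ξ η : Cn n}
    (hξ : ξ ≠ 0) (hη : η ≠ 0) : ∃ u ∈ Metric.sphere (0 : Cn n) 1, ∃ v ∈ Metric.sphere (0 : Cn n) 1,
      ∃ r : ℝ, 0 < r ∧ perturbedCurv g c e z ξ η = r * perturbedCurv g c e z u v := by
  have key : ∀ ξ : Cn n, ξ ≠ 0 → (((‖ξ‖⁻¹ : ℝ) : ℂ) • ξ) ∈ Metric.sphere (0 : Cn n) 1 ∧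
      ((‖ξ‖ : ℝ) : ℂ) • (((‖ξ‖⁻¹ : ℝ) : ℂ) • ξ) = ξ := fun ξ hξ => by
    have h0 : ‖ξ‖ ≠ 0 := norm_ne_zero_iff.2 hξ
    constructor
    · rw [mem_sphere_zero_iff_norm, norm_smul, Complex.norm_real, norm_inv, norm_norm,
        inv_mul_cancel₀ h0]
    · rw [smul_smul, ← Complex.ofReal_mul, mul_inv_cancel₀ h0, Complex.ofReal_one, one_smul]
  refine ⟨_, (key ξ hξ).1, _, (key η hη).1, ‖ξ‖ ^ 2 * ‖η‖ ^ 2, ?_, ?_⟩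
  · have := norm_pos_iff.2 hξ
    have := norm_pos_iff.2 hη
    positivity
  · rw [← perturbedCurv_smul, (key ξ hξ).2, (key η hη).2]

theorem continuousOn_perturbedCurv (hg : IsHermitianCurvatureFlow g₀ τ g) (hτ : 0 < τ)
    (he : e ∈ holomorphicCharts n M) {ψ : ℝ → ℝ} (hψ : Continuous ψ) :
    ContinuousOn (fun q : (ℝ × Cn n) × Cn n × Cn n =>
      perturbedCurv (g q.1.1) (ψ q.1.1) e q.1.2 q.2.1 q.2.2)
      ((Set.Ico 0 τ ×ˢ e.target) ×ˢ Set.univ) := by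
  have hf := isFlow_inChart hg hτ he
  have m1 : Set.MapsTo Prod.fst ((Set.Ico 0 τ ×ˢ e.target) ×ˢ (Set.univ : Set (Cn n × Cn n)))
      (chartDomain e hτ).carrier := fun q hq => hq.1
  have hR : ∀ i j k l, ContinuousOn (fun q : (ℝ × Cn n) × Cn n × Cn n =>
      curvature ((g q.1.1).inChart e) i j k l q.1.2) ((Set.Ico 0 τ ×ˢ e.target) ×ˢ Set.univ) :=
    fun i j k l => (continuousOn_curvature hf i j k l).comp continuousOn_fst m1
  have hG : ∀ i j, ContinuousOn (fun q : (ℝ × Cn n) × Cn n × Cn n =>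
      (g q.1.1).inChart e q.1.2 i j) ((Set.Ico 0 τ ×ˢ e.target) ×ˢ Set.univ) :=
    fun i j => (hf.smooth i j).continuousOn.comp continuousOn_fst m1
  have hξ : ∀ i, ContinuousOn (fun q : (ℝ × Cn n) × Cn n × Cn n => q.2.1 i)
      ((Set.Ico 0 τ ×ˢ e.target) ×ˢ Set.univ) := fun i => by fun_prop
  have hη : ∀ i, ContinuousOn (fun q : (ℝ × Cn n) × Cn n × Cn n => q.2.2 i)
      ((Set.Ico 0 τ ×ˢ e.target) ×ˢ Set.univ) := fun i => by fun_prop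
  simp only [perturbedCurv, curvatureForm, con_apply, smul_eq_mul]
  refine (Complex.continuous_re.comp_continuousOn ?_).add
    (ContinuousOn.mul (by fun_prop) (Complex.continuous_re.comp_continuousOn (.mul ?_ ?_)))
  · exact continuousOn_finsetSum _ fun i _ => continuousOn_finsetSum _ fun j _ =>
      continuousOn_finsetSum _ fun k _ => continuousOn_finsetSum _ fun l _ =>
        ((((hR i j k l).mul (hξ i)).mul (Complex.continuous_conj.comp_continuousOn (hξ j))).mul
          (hη k)).mul (Complex.continuous_conj.comp_continuousOn (hη l))
  · exact continuousOn_finsetSum _ fun i _ => continuousOn_finsetSum _ fun j _ =>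
      ((hξ i).mul (Complex.continuous_conj.comp_continuousOn (hξ j))).mul (hG i j)
  · exact continuousOn_finsetSum _ fun i _ => continuousOn_finsetSum _ fun j _ =>
      ((hη i).mul (Complex.continuous_conj.comp_continuousOn (hη j))).mul (hG i j)

theorem perturbedCurv_nonneg_of_pos_before (hg : IsHermitianCurvatureFlow g₀ τ g)
    (he : e ∈ holomorphicCharts n M) {z : Cn n} (hz : z ∈ e.target) {t : ℝ}
    (ht : t ∈ Set.Ico 0 τ) (h0 : 0 < t) {ψ : ℝ → ℝ} (hψ : Continuous ψ) {ξ η : Cn n}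
    (hpos : ∀ s ∈ Set.Ico 0 t, 0 < perturbedCurv (g s) (ψ s) e z ξ η) :
    0 ≤ perturbedCurv (g t) (ψ t) e z ξ η := by
  have hi : Continuous fun s : ℝ => (((s, z), (ξ, η)) : (ℝ × Cn n) × Cn n × Cn n) := by fun_prop
  have hm : Set.MapsTo (fun s : ℝ => (((s, z), (ξ, η)) : (ℝ × Cn n) × Cn n × Cn n)) (Set.Ico 0 τ)
      ((Set.Ico 0 τ ×ˢ e.target) ×ˢ Set.univ) := fun s hs => ⟨⟨hs, hz⟩, Set.mem_univ _⟩
  have hc := (continuousOn_perturbedCurv hg (h0.trans ht.2) he hψ).comp hi.continuousOn hm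
  have hl := (hc t ht).mono (s := Set.Ico 0 t) fun s hs => ⟨hs.1, hs.2.trans ht.2⟩
  rw [ContinuousWithinAt, nhdsWithin_Ico_eq_nhdsLT h0] at hl
  refine ge_of_tendsto hl ?_
  filter_upwards [Ico_mem_nhdsLT h0] with s hs
  exact (hpos s hs).le

theorem differentiableWithinAt_con (hg : IsHermitianCurvatureFlow g₀ τ g)
    (he : e ∈ holomorphicCharts n M) {z : Cn n} (hz : z ∈ e.target) {t : ℝ}
    (ht : t ∈ Set.Ico 0 τ) (ξ : Cn n) :
    DifferentiableWithinAt ℝ (fun s => con ξ ξ ((g s).inChart e z)) (Set.Ico 0 τ) t := by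
  simp only [con_apply, smul_eq_mul]
  exact DifferentiableWithinAt.fun_sum fun i _ => DifferentiableWithinAt.fun_sum fun j _ =>
    (hg.evolution e he z hz t ht i j).differentiableWithinAt.const_mul _

/-- Splitting off `(ψ s - ψ t)|ξ|²|η|²`, whose first factor vanishes at `t`, only `ψ'` times the
norms at time `t` is added, and these norms are one. -/
theorem hasDerivWithinAt_perturbedCurv (hg : IsHermitianCurvatureFlow g₀ τ g)
    (he : e ∈ holomorphicCharts n M) {z : Cn n} (hz : z ∈ e.target) {t : ℝ}
    (ht : t ∈ Set.Ico 0 τ) {ψ : ℝ → ℝ} {c d : ℝ} (hψ : HasDerivAt ψ c t) {ξ η : Cn n}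
    (hξ : con ξ ξ ((g t).inChart e z) = 1) (hη : con η η ((g t).inChart e z) = 1)
    (hd : HasDerivWithinAt (fun s => perturbedCurv (g s) (ψ t) e z ξ η) d (Set.Ico 0 τ) t) :
    HasDerivWithinAt (fun s => perturbedCurv (g s) (ψ s) e z ξ η) (d + c) (Set.Ico 0 τ) t := by
  have hG := ((differentiableWithinAt_con hg he hz ht ξ).fun_mul
    (differentiableWithinAt_con hg he hz ht η)).hasDerivWithinAt
  have hG2 := Complex.reCLM.hasFDerivAt.comp_hasDerivWithinAt t hG
  have hsum := hd.add (((hψ.hasDerivWithinAt (s := Set.Ico 0 τ)).sub_const (ψ t)).mul hG2)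
  have e1 : d + c = d + (c * Complex.reCLM (con ξ ξ ((g t).inChart e z) *
      con η η ((g t).inChart e z)) + (ψ t - ψ t) * Complex.reCLM (derivWithin (fun s =>
      con ξ ξ ((g s).inChart e z) * con η η ((g s).inChart e z)) (Set.Ico 0 τ) t)) := by
    rw [hξ, hη, sub_self, zero_mul, add_zero, one_mul, Complex.reCLM_apply, Complex.one_re, mul_one]
  rw [e1]
  have e2 : ∀ s, perturbedCurv (g s) (ψ s) e z ξ η = perturbedCurv (g s) (ψ t) e z ξ η +
      (ψ s - ψ t) * (con ξ ξ ((g s).inChart e z) * con η η ((g s).inChart e z)).re := fun s => by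
    rw [perturbedCurv, perturbedCurv]
    ring
  exact hsum.congr (fun s _ => e2 s) (e2 t)

/-- A finite cover of a compact manifold by compact subsets of chart domains. -/
theorem exists_compact_chart_cover [CompactSpace M] : ∃ (s : Finset M) (K : M → Set (Cn n)),
    (∀ x, IsCompact (K x)) ∧ (∀ x, K x ⊆ (chartAt (Cn n) x).target) ∧
    ∀ y, ∃ x ∈ s, y ∈ (chartAt (Cn n) x).source ∧ chartAt (Cn n) x y ∈ K x := by
  have h : ∀ x : M, ∃ K : Set (Cn n), IsCompact K ∧ K ⊆ (chartAt (Cn n) x).target ∧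
      K ∈ nhds (chartAt (Cn n) x x) := fun x => by
    obtain ⟨K, h1, h2, h3⟩ := local_compact_nhds
      ((chartAt (Cn n) x).open_target.mem_nhds (mem_chart_target (Cn n) x))
    exact ⟨K, h3, h2, h1⟩
  choose K hK hKt hKn using h
  obtain ⟨s, -, hs⟩ := isCompact_univ.elim_nhds_subcover
    (fun x : M => (chartAt (Cn n) x).source ∩ chartAt (Cn n) x ⁻¹' K x) fun x _ =>
      Filter.inter_mem (chart_source_mem_nhds (Cn n) x)
        ((chartAt (Cn n) x).continuousAt (mem_chart_source (Cn n) x) (hKn x))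
  refine ⟨s, K, hK, hKt, fun y => ?_⟩
  obtain ⟨x, hx, h1, h2⟩ := Set.mem_iUnion₂.1 (hs (Set.mem_univ y))
  exact ⟨x, hx, h1, h2⟩

/-- Tensoriality moves a pair of vectors into one of the finitely many charts of the cover, and
homogeneity onto the unit spheres. The sign of the perturbed curvature is thus decided on a compact
set. -/
theorem perturbedCurv_of_cover {s : Finset M} {K : M → Set (Cn n)}
    (hs : ∀ y, ∃ x ∈ s, y ∈ (chartAt (Cn n) x).source ∧ chartAt (Cn n) x y ∈ K x)
    (g : HermitianMetric n M) (c : ℝ) (he : e ∈ holomorphicCharts n M) {z : Cn n}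
    (hz : z ∈ e.target) {ξ η : Cn n} (hξ : ξ ≠ 0) (hη : η ≠ 0) :
    ∃ x ∈ s, ∃ z' ∈ K x, ∃ u ∈ Metric.sphere (0 : Cn n) 1, ∃ v ∈ Metric.sphere (0 : Cn n) 1,
      ∃ r : ℝ, 0 < r ∧ perturbedCurv g c e z ξ η =
        r * perturbedCurv g c (chartAt (Cn n) x) z' u v := by
  obtain ⟨x, hx, h1, h2⟩ := hs (e.symm z)
  have hx' : chartAt (Cn n) x ∈ holomorphicCharts n M := IsManifold.chart_mem_maximalAtlas x
  have hw : z ∈ (e.symm.trans (chartAt (Cn n) x)).source := by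
    rw [OpenPartialHomeomorph.trans_source]
    exact ⟨hz, h1⟩
  have hJ := isUnit_jacobian hx' he hw g
  have hne : ∀ u : Cn n, u ≠ 0 →
      (jacobian (chartAt (Cn n) x ∘ e.symm) z).mulVec u ≠ 0 := fun u hu h0 => hu <| by
    have := congrArg (jacobian (chartAt (Cn n) x ∘ e.symm) z)⁻¹.mulVec h0
    rwa [Matrix.mulVec_mulVec, Matrix.nonsing_inv_mul _ hJ, Matrix.one_mulVec,
      Matrix.mulVec_zero] at this
  obtain ⟨u, hu, v, hv, r, hr, h⟩ := perturbedCurv_eq_sphere (e := chartAt (Cn n) x) g c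
    ((chartAt (Cn n) x ∘ e.symm) z) (hne ξ hξ) (hne η hη)
  exact ⟨x, hx, _, h2, u, hu, v, hv, r, hr, (perturbedCurv_transition g c hx' he hw ξ η).trans h⟩

/-- A function which is positive before `t` and vanishes at `t` has non-positive derivative. -/
theorem deriv_nonpos_of_pos_before {φ : ℝ → ℝ} {d t τ : ℝ} (ht : t ∈ Set.Ico 0 τ) (h0 : 0 < t)
    (hd : HasDerivWithinAt φ d (Set.Ico 0 τ) t) (hpos : ∀ s ∈ Set.Ico 0 t, 0 < φ s)
    (hφ : φ t = 0) : d ≤ 0 := by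
  have h1 : HasDerivWithinAt φ d (Set.Ico 0 t) t :=
    hd.mono fun s hs => ⟨hs.1, hs.2.trans ht.2⟩
  rw [hasDerivWithinAt_iff_tendsto_slope' (fun h => lt_irrefl _ h.2),
    nhdsWithin_Ico_eq_nhdsLT h0] at h1
  refine le_of_tendsto h1 ?_
  filter_upwards [Ico_mem_nhdsLT h0] with s hs
  rw [slope_def_field, hφ, sub_zero]
  exact div_nonpos_of_nonneg_of_nonpos (hpos s hs).le (by linarith [hs.2])

/-- The maximum principle for the perturbed curvature. -/
theorem exists_maximum_principle [CompactSpace M] (hg : IsHermitianCurvatureFlow g₀ τ g) {T : ℝ}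
    (hT0 : 0 ≤ T) (hT : T < τ) : ∃ κ : ℝ, 0 < κ ∧ ∀ ψ ψ' : ℝ → ℝ,
      (∀ t, HasDerivAt ψ (ψ' t) t) → (∀ t ∈ Set.Icc 0 T, |ψ t| ≤ 1) →
      (∀ t, κ * |ψ t| < ψ' t) →
      (∀ e ∈ holomorphicCharts n M, ∀ z ∈ e.target, ∀ ξ η : Cn n, ξ ≠ 0 → η ≠ 0 →
        0 < perturbedCurv (g 0) (ψ 0) e z ξ η) →
      ∀ e ∈ holomorphicCharts n M, ∀ z ∈ e.target, ∀ ξ η : Cn n, ξ ≠ 0 → η ≠ 0 →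
        0 < perturbedCurv (g T) (ψ T) e z ξ η := by
  have hτ : 0 < τ := hT0.trans_lt hT
  obtain ⟨s, K, hK, hKt, hs⟩ := exists_compact_chart_cover (n := n) (M := M)
  have hch : ∀ x : M, chartAt (Cn n) x ∈ holomorphicCharts n M := fun x =>
    IsManifold.chart_mem_maximalAtlas x
  choose κ₀ hκ₀ using fun x : M =>
    exists_deriv_lower_bound hg hτ (hch x) (hK x) (hKt x) hT
  have hκ0 : 0 ≤ ∑ x ∈ s, |κ₀ x| := Finset.sum_nonneg fun x _ => abs_nonneg _
  -- The sum dominates the constants of all charts in the cover; the `1` makes `κ` positive.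
  refine ⟨∑ x ∈ s, |κ₀ x| + 1, by linarith, fun ψ ψ' hψ hψ1 hκ hinit => ?_⟩
  have hψc : Continuous ψ := continuous_iff_continuousAt.2 fun t => (hψ t).continuousAt
  set S := Metric.sphere (0 : Cn n) 1
  have hS : IsCompact S := isCompact_sphere _ _
  have hS0 : ∀ u ∈ S, u ≠ 0 := fun u hu h => by
    have := mem_sphere_zero_iff_norm.1 hu
    rw [h, norm_zero] at this
    exact zero_ne_one this
  set D : M → Set ((ℝ × Cn n) × Cn n × Cn n) := fun x => (Set.Icc 0 T ×ˢ K x) ×ˢ (S ×ˢ S)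
  set F : M → (ℝ × Cn n) × Cn n × Cn n → ℝ := fun x q =>
    perturbedCurv (g q.1.1) (ψ q.1.1) (chartAt (Cn n) x) q.1.2 q.2.1 q.2.2
  have hD : ∀ x, IsCompact (D x) := fun x => (isCompact_Icc.prod (hK x)).prod (hS.prod hS)
  have hF : ∀ x, ContinuousOn (F x) (D x) := fun x =>
    (continuousOn_perturbedCurv hg hτ (hch x) hψc).mono fun q hq =>
      ⟨⟨⟨hq.1.1.1, hq.1.1.2.trans_lt hT⟩, hKt x hq.1.2⟩, Set.mem_univ _⟩
  -- The set of times at which positivity fails. It is a finite union of images of compact sets, so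
  -- if it is nonempty it has a least element, which is the first bad time.
  set A : Set ℝ := ⋃ x ∈ s, (fun q : (ℝ × Cn n) × Cn n × Cn n => q.1.1) ''
    (D x ∩ F x ⁻¹' Set.Iic 0) with hA
  have hAc : IsCompact A := s.isCompact_biUnion fun x _ =>
    ((hD x).of_isClosed_subset
      ((hF x).preimage_isClosed_of_isClosed (hD x).isClosed isClosed_Iic)
      Set.inter_subset_left).image (by fun_prop)
  have hnot : ∀ t ∈ Set.Icc 0 T, t ∉ A → ∀ e ∈ holomorphicCharts n M, ∀ z ∈ e.target,
      ∀ ξ η : Cn n, ξ ≠ 0 → η ≠ 0 → 0 < perturbedCurv (g t) (ψ t) e z ξ η := by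
    intro t ht htA e he z hz ξ η hξ hη
    obtain ⟨x, hx, z', hz', u, hu, v, hv, r, hr, h⟩ :=
      perturbedCurv_of_cover hs (g t) (ψ t) he hz hξ hη
    rw [h]
    refine mul_pos hr (not_le.1 fun hle => htA ?_)
    exact Set.mem_iUnion₂.2 ⟨x, hx, ((t, z'), u, v), ⟨⟨⟨ht, hz'⟩, hu, hv⟩, hle⟩, rfl⟩
  suffices hAe : ¬ A.Nonempty from
    hnot T ⟨hT0, le_rfl⟩ fun h => hAe ⟨T, h⟩
  intro hAn
  obtain ⟨t, htA, hmin⟩ := hAc.exists_isLeast hAn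
  obtain ⟨x, hx, ⟨⟨t', z⟩, ξ, η⟩, ⟨⟨⟨htT, hz⟩, hξ, hη⟩, hle⟩, rfl⟩ := Set.mem_iUnion₂.1 htA
  change t' ∈ Set.Icc 0 T at htT
  change z ∈ K x at hz
  change ξ ∈ S at hξ
  change η ∈ S at hη
  change perturbedCurv (g t') (ψ t') (chartAt (Cn n) x) z ξ η ≤ 0 at hle
  have hzt := hKt x hz
  have ht0 : 0 < t' := by
    refine lt_of_le_of_ne htT.1 fun h => ?_
    rw [← h] at hle
    exact not_lt.2 hle (hinit _ (hch x) z hzt ξ η (hS0 ξ hξ) (hS0 η hη))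
  have htτ : t' ∈ Set.Ico 0 τ := ⟨htT.1, htT.2.trans_lt hT⟩
  have hbefore : ∀ r ∈ Set.Ico 0 t', ∀ e ∈ holomorphicCharts n M, ∀ z ∈ e.target,
      ∀ ξ η : Cn n, ξ ≠ 0 → η ≠ 0 → 0 < perturbedCurv (g r) (ψ r) e z ξ η := fun r hr =>
    hnot r ⟨hr.1, hr.2.le.trans htT.2⟩ fun h => not_lt.2 (hmin h) hr.2
  have hnow : ∀ e ∈ holomorphicCharts n M, ∀ z ∈ e.target, ∀ ξ η : Cn n,
      0 ≤ perturbedCurv (g t') (ψ t') e z ξ η := by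
    intro e he z hz ξ η
    rcases eq_or_ne ξ 0 with rfl | hξ
    · exact (perturbedCurv_eq_zero_of_left _ _ _ _).ge
    rcases eq_or_ne η 0 with rfl | hη
    · exact (perturbedCurv_eq_zero_of_right _ _ _ _).ge
    exact perturbedCurv_nonneg_of_pos_before hg he hz htτ ht0 hψc
      fun r hr => hbefore r hr e he z hz ξ η hξ hη
  have heq := le_antisymm hle (hnow _ (hch x) z hzt ξ η)
  -- The null pair is found on coordinate spheres, but the derivative estimate needs unit vectors of
  -- the metric. Rescaling keeps it null.
  obtain ⟨a, ha⟩ := exists_smul_con_eq_one (g t') (hch x) hzt (hS0 ξ hξ)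
  obtain ⟨b, hb⟩ := exists_smul_con_eq_one (g t') (hch x) hzt (hS0 η hη)
  have hzero : perturbedCurv (g t') (ψ t') (chartAt (Cn n) x) z ((a : ℂ) • ξ) ((b : ℂ) • η) = 0 := by
    rw [perturbedCurv_smul, heq, mul_zero]
  have hne : ∀ u : Cn n, con u u ((g t').inChart (chartAt (Cn n) x) z) = 1 → u ≠ 0 :=
    fun u hu h => by
      rw [h] at hu
      simp [con_apply] at hu
  generalize (a : ℂ) • ξ = u at ha hzero
  generalize (b : ℂ) • η = v at hb hzero
  obtain ⟨d, hd, hdb⟩ := hκ₀ x t' htT z hz (ψ t') (hψ1 t' htT) u v ha hb hnow hzero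
  have hφ := deriv_nonpos_of_pos_before htτ ht0
    (hasDerivWithinAt_perturbedCurv hg (hch x) hzt htτ (hψ t') ha hb hd)
    (fun r hr => hbefore r hr _ (hch x) z hzt u v (hne u ha) (hne v hb)) hzero
  have h1 : κ₀ x ≤ ∑ x ∈ s, |κ₀ x| := (le_abs_self _).trans
    (Finset.single_le_sum (f := fun x => |κ₀ x|) (fun _ _ => abs_nonneg _) hx)
  -- The contradiction: `d + ψ' ≤ 0` at the first zero, whereas `d ≥ -κ₀ |ψ|` and `ψ' > κ |ψ| ≥ κ₀
  -- |ψ|`.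
  have h2 := hκ t'
  have h3 := mul_le_mul_of_nonneg_right h1 (abs_nonneg (ψ t'))
  rw [add_mul, one_mul] at h2
  linarith [abs_nonneg (ψ t')]

end MaximumPrinciple

/-! ### Preservation of Griffiths non-negativity and positivity -/

section Preservation

open Filter Topology

variable {n : ℕ} {M : Type*} [TopologicalSpace M] [ChartedSpace (Cn n) M]
  [IsManifold 𝓘(ℂ, Cn n) ω M] [CompactSpace M] {g₀ : HermitianMetric n M} {τ : ℝ}
  {g : ℝ → HermitianMetric n M}

theorem griffithsNonneg_of_flow (hg : IsHermitianCurvatureFlow g₀ τ g) (h0 : g₀.GriffithsNonneg)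
    {T : ℝ} (hT : T ∈ Set.Ico 0 τ) : (g T).GriffithsNonneg := by
  obtain ⟨κ, hκ, hmax⟩ := exists_maximum_principle hg hT.1 hT.2
  intro e he z hz ξ η hξ hη
  have hpos := con_mul_con_pos (g T) he hz hξ hη
  have key : ∀ ε ∈ Set.Ioo (0 : ℝ) 1, 0 < perturbedCurv (g T) ε e z ξ η := by
    intro ε hε
    -- This `ψ` satisfies `ψ' = (κ + 1)ψ > κψ`. The shift by `T` gives `ψ(T) = ε` and keeps `ψ ≤ 1`
    -- on `[0,T]`. Letting `ε` tend to zero removes the perturbation.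
    have := hmax (fun t => ε * Real.exp ((κ + 1) * (t - T)))
      (fun t => ε * (Real.exp ((κ + 1) * (t - T)) * (κ + 1))) (fun t => ?_) (fun t ht => ?_)
      (fun t => ?_) (fun e he z hz ξ η hξ hη => ?_) e he z hz ξ η hξ hη
    · simpa using this
    · have h1 : HasDerivAt (fun t => (κ + 1) * (t - T)) (κ + 1) t := by
        simpa using ((hasDerivAt_id t).sub_const T).const_mul (κ + 1)
      exact h1.exp.const_mul ε
    · have h1 : Real.exp ((κ + 1) * (t - T)) ≤ 1 :=
        Real.exp_le_one_iff.2 (mul_nonpos_of_nonneg_of_nonpos (by linarith) (by linarith [ht.2]))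
      rw [abs_of_nonneg (mul_nonneg hε.1.le (Real.exp_pos _).le)]
      exact mul_le_one₀ hε.2.le (Real.exp_pos _).le h1
    · have h1 := mul_pos hε.1 (Real.exp_pos ((κ + 1) * (t - T)))
      rw [abs_of_pos h1]
      nlinarith
    · rw [perturbedCurv]
      refine add_pos_of_nonneg_of_pos ?_ (mul_pos (mul_pos hε.1 (Real.exp_pos _))
        (con_mul_con_pos (g 0) he hz hξ hη))
      rw [hg.initial]
      exact h0 e he z hz ξ η hξ hη
  have hl : Tendsto (fun ε => perturbedCurv (g T) ε e z ξ η) (𝓝[>] 0)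
      (𝓝 (perturbedCurv (g T) 0 e z ξ η)) := by
    refine Continuous.continuousWithinAt ?_
    unfold perturbedCurv
    fun_prop
  have := ge_of_tendsto hl (b := 0) (by
    filter_upwards [Ioo_mem_nhdsGT (zero_lt_one' ℝ)] with ε hε using (key ε hε).le)
  simpa [perturbedCurv] using this

/-- By compactness, strict positivity at the initial time leaves room for subtracting a small
multiple of `|ξ|²|η|²`. -/
theorem exists_perturbedCurv_pos (hg : IsHermitianCurvatureFlow g₀ τ g) (hτ : 0 < τ)
    (h0 : (g 0).GriffithsPos) : ∃ δ : ℝ, 0 < δ ∧ δ ≤ 1 ∧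
      ∀ e ∈ holomorphicCharts n M, ∀ z ∈ e.target, ∀ ξ η : Cn n, ξ ≠ 0 → η ≠ 0 →
        0 < perturbedCurv (g 0) (-δ) e z ξ η := by
  obtain ⟨s, K, hK, hKt, hs⟩ := exists_compact_chart_cover (n := n) (M := M)
  have hS0 : ∀ u ∈ Metric.sphere (0 : Cn n) 1, u ≠ 0 := fun u hu h => by
    have := mem_sphere_zero_iff_norm.1 hu
    rw [h, norm_zero] at this
    exact zero_ne_one this
  have key : ∀ x ∈ s, ∀ᶠ δ : ℝ in 𝓝[>] 0, ∀ z ∈ K x, ∀ u ∈ Metric.sphere (0 : Cn n) 1,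
      ∀ v ∈ Metric.sphere (0 : Cn n) 1,
        0 < perturbedCurv (g 0) (-δ) (chartAt (Cn n) x) z u v := by
    intro x _
    have hx : chartAt (Cn n) x ∈ holomorphicCharts n M := IsManifold.chart_mem_maximalAtlas x
    set D : Set ((ℝ × Cn n) × Cn n × Cn n) :=
      ({0} ×ˢ K x) ×ˢ (Metric.sphere 0 1 ×ˢ Metric.sphere 0 1)
    have hD : IsCompact D := (isCompact_singleton.prod (hK x)).prod
      ((isCompact_sphere _ _).prod (isCompact_sphere _ _))
    have hDs : D ⊆ (Set.Ico 0 τ ×ˢ (chartAt (Cn n) x).target) ×ˢ Set.univ := fun q hq =>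
      ⟨⟨by rw [Set.mem_singleton_iff.1 hq.1.1]; exact ⟨le_rfl, hτ⟩, hKt x hq.1.2⟩, Set.mem_univ _⟩
    have hc : ∀ c : ℝ, ContinuousOn (fun q : (ℝ × Cn n) × Cn n × Cn n =>
        perturbedCurv (g q.1.1) c (chartAt (Cn n) x) q.1.2 q.2.1 q.2.2) D := fun c =>
      (continuousOn_perturbedCurv hg hτ hx (continuous_const (y := c))).mono hDs
    obtain ⟨m, hm0, hm⟩ := hD.exists_forall_le' (a := 0) (hc 0) fun q hq => by
      rw [Set.mem_singleton_iff.1 hq.1.1]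
      have := h0 _ hx q.1.2 (hKt x hq.1.2) q.2.1 q.2.2 (hS0 _ hq.2.1) (hS0 _ hq.2.2)
      simpa [perturbedCurv] using this
    obtain ⟨b, hb⟩ := hD.exists_bound_of_continuousOn (hc 1)
    -- Write `F c` for the value with perturbation `c`. As `F` is affine in `c`, `F (-δ) = (1 + δ) F
    -- 0 - δ F 1`, with `F 0 ≥ m` and `F 1 ≤ |b|`; so `δ (|b| + 1) < m` suffices.
    filter_upwards [Ioo_mem_nhdsGT (show 0 < m / (|b| + 1) by positivity)] with δ hδ z hz u hu v hv
    have hq : (((0, z), u, v) : (ℝ × Cn n) × Cn n × Cn n) ∈ D := ⟨⟨rfl, hz⟩, hu, hv⟩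
    have h1 := hm _ hq
    have h2 := (le_abs_self _).trans ((hb _ hq).trans (le_abs_self b))
    have h3 := (lt_div_iff₀ (by positivity)).1 hδ.2
    have h4 := mul_le_mul_of_nonneg_left h2 hδ.1.le
    have h5 := mul_nonneg hδ.1.le (hm0.le.trans h1)
    simp only [perturbedCurv] at h1 h4 h5 ⊢
    linarith [hδ.1]
  obtain ⟨δ, hδ, hδ1⟩ := (((Filter.eventually_all_finset s).2 key).and
    (Ioo_mem_nhdsGT (zero_lt_one' ℝ))).exists
  refine ⟨δ, hδ1.1, hδ1.2.le, fun e he z hz ξ η hξ hη => ?_⟩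
  obtain ⟨x, hx, z', hz', u, hu, v, hv, r, hr, h⟩ :=
    perturbedCurv_of_cover hs (g 0) (-δ) he hz hξ hη
  rw [h]
  exact mul_pos hr (hδ x hx z' hz' u hu v hv)

theorem griffithsPos_of_flow (hg : IsHermitianCurvatureFlow g₀ τ g) (h0 : g₀.GriffithsPos)
    {T : ℝ} (hT : T ∈ Set.Ico 0 τ) : (g T).GriffithsPos := by
  obtain ⟨κ, hκ, hmax⟩ := exists_maximum_principle hg hT.1 hT.2
  obtain ⟨δ, hδ, hδ1, hpos⟩ := exists_perturbedCurv_pos hg (hT.1.trans_lt hT.2)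
    (by rw [hg.initial]; exact h0)
  intro e he z hz ξ η hξ hη
  -- This `ψ` is negative with `ψ' = (κ + 1)|ψ| > κ|ψ|`. Since it never reaches zero, the conclusion
  -- at `T` bounds the curvature below by a positive multiple of `|ξ|²|η|²`.
  have := hmax (fun t => -δ * Real.exp (-(κ + 1) * t))
    (fun t => -δ * (Real.exp (-(κ + 1) * t) * -(κ + 1))) (fun t => ?_) (fun t ht => ?_)
    (fun t => ?_) ?_ e he z hz ξ η hξ hη
  · have h1 := mul_pos (mul_pos hδ (Real.exp_pos (-(κ + 1) * T)))
      (con_mul_con_pos (g T) he hz hξ hη)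
    rw [perturbedCurv] at this
    linarith
  · have h1 : HasDerivAt (fun t => -(κ + 1) * t) (-(κ + 1)) t := by
      simpa using (hasDerivAt_id t).const_mul (-(κ + 1))
    exact h1.exp.const_mul (-δ)
  · have h1 : Real.exp (-(κ + 1) * t) ≤ 1 :=
      Real.exp_le_one_iff.2 (mul_nonpos_of_nonpos_of_nonneg (by linarith) ht.1)
    rw [abs_mul, abs_neg, abs_of_pos hδ, abs_of_pos (Real.exp_pos _)]
    exact mul_le_one₀ hδ1 (Real.exp_pos _).le h1
  · have h1 := mul_pos hδ (Real.exp_pos (-(κ + 1) * t))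
    rw [abs_mul, abs_neg, abs_of_pos hδ, abs_of_pos (Real.exp_pos _)]
    linarith
  · simpa using hpos

end Preservation

end HermitianFlow

end

theorem theorem4p1 (n : ℕ) (M : Type*) [TopologicalSpace M] [T2Space M] [CompactSpace M]
    [ChartedSpace (HermitianFlow.Cn n) M] [IsManifold 𝓘(ℂ, HermitianFlow.Cn n) ω M]
    (g₀ : HermitianFlow.HermitianMetric n M) (τ : ℝ) (g : ℝ → HermitianFlow.HermitianMetric n M)
    (hg : HermitianFlow.IsHermitianCurvatureFlow g₀ τ g) :
    (g₀.GriffithsNonneg → ∀ t ∈ Set.Ico 0 τ, (g t).GriffithsNonneg) ∧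
    (g₀.GriffithsPos → ∀ t ∈ Set.Ico 0 τ, (g t).GriffithsPos) :=
  ⟨fun h _ ht => HermitianFlow.griffithsNonneg_of_flow hg h ht,
    fun h _ ht => HermitianFlow.griffithsPos_of_flow hg h ht⟩
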